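/- Let $\mathbb N=\{1,2,\dots\}$ and let $T_1,T_2,\dots$ be i.i.d. $\mathbb N$-valued random variables on a probability space with law $\mathsf P$, such that $\mathsf P[T_1=t]=\ell(t)/t^{\alpha+1}>0$ for all $t\in\mathbb N$, where $\alpha\ge 1$ and $\ell:[1,\infty)\to\mathbb R$ is measurable and slowly varying at infinity (that is, $\ell(z)>0$ for all large $z$, and $\lim_{z\to\infty}\ell(\lambda z)/\ell(z)=1$ for every $\lambda>0$). Put $S_0=0$, $S_i=T_1+\dots+T_i$, $L_n=\sup\{i\ge 0: S_i\le n\}$ and $M_n=\max\{T_1,\dots,T_{L_n}\}$, and let $\{n\in S\}$ be the event that $S_i=n$ for some $i\ge 0$. For $n\ge 0$ and $h\in\mathbb R$ the pure pinning model is the probability $\mathsf P_{n,h,0}$ with $$\frac{\mathrm d\mathsf P_{n,h,0}}{\mathrm d\mathsf P}=\frac{1}{Z_{n,h}}\,e^{hL_n}\mathbf 1_{\{n\in S\}},\qquad Z_{n,h}=\mathsf E\big[e^{hL_n}\mathbf 1_{\{n\in S\}}\big].$$ Let $f(h)=\lim_{n\to\infty}\frac1n\log Z_{n,h}$ be the free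 energy, $h_c=\inf\{h\in\mathbb R: f(h)>0\}$ the critical point, $\rho=f'$ on $(h_c,\infty)$ the contact density, $\rho_c=\lim_{h\downarrow h_c}\rho(h)$, and $\imath_\rho:(\rho_c,1)\to(h_c,\infty)$ the inverse function of $\rho$. These quantities are well defined: the limit $f(h)$ exists and is finite for every $h\in\mathbb R$, the infimum $h_c$ is finite, $f$ is differentiable on $(h_c,\infty)$, the limit $\rho_c$ exists and is finite, and $\rho$ is a bijection from $(h_c,\infty)$ onto $(\rho_c,1)$. Moreover, the following hold. (i) For every $h\in\mathbb R$, every set $R\subset(\rho_c,1)$ that is closed in $\mathbb R$, and every $\epsilon>0$, $$\lim_{n\to\infty}\ \sup_{l\in nR\cap\mathbb N}\ \mathsf P_{n,h,0}\bigg[\bigg|\frac{M_n}{\log n}-\frac{1}{f(\imath_\rho(l/n))}\bigg|>\epsilon\,\bigg|\,L_n=l\bigg]=0.$$ (ii) If $\rho_c>0$, then for every $h\in\mathbb R$, every set $R\subset(0,\rho_c)$ that is closed in $\mathbb R$, and every $\epsilon>0$, $$\lim_{n\to\infty}\ \sup_{l\in nR\cap\mathbb N}\ \mathsf P_{n,h,0}\bigg[\bigg|\frac{M_n}{n}-\bigg(1-\frac{l/n}{\rho_c}\bigg)\bigg|>\epsilon\,\bigg|\,L_n=l\bigg]=0.$$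 (The supremum over the empty set is $0$.) -/

import Mathlib

open MeasureTheory ProbabilityTheory Filter Topology Set

noncomputable section

namespace Pinning

/-- A real function on `[1, ∞)` (values of `ℓ` below `1` play no role) is slowly varying at
infinity. -/
def SlowlyVarying (ℓ : ℝ → ℝ) : Prop :=
  Measurable (fun z : Ici (1 : ℝ) => ℓ z) ∧
  (∀ᶠ z in atTop, 0 < ℓ z) ∧
  ∀ c : ℝ, 0 < c → Tendsto (fun z => ℓ (c * z) / ℓ z) atTop (𝓝 1)

/-- The inter-arrival times `T_1, T_2, …` are i.i.d. random variables with values in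
`{1, 2, …}` on a probability space, with `P[T_1 = t] = ℓ(t) / t^(α+1) > 0` for all `t ≥ 1`,
where `α ≥ 1` and `ℓ` is slowly varying.  The variable `T_{i+1}` is called `T i`. -/
structure InterArrival {Ω : Type*} [MeasurableSpace Ω] (P : Measure Ω) (T : ℕ → Ω → ℕ)
    (α : ℝ) (ℓ : ℝ → ℝ) : Prop where
  isProbability : IsProbabilityMeasure P
  measurable : ∀ i, Measurable (T i)
  one_le : ∀ i s, 1 ≤ T i s
  indep : iIndepFun T P
  identDistrib : ∀ i, IdentDistrib (T i) (T 0) P P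
  one_le_alpha : 1 ≤ α
  slowlyVarying : SlowlyVarying ℓ
  law : ∀ t : ℕ, 1 ≤ t → P.real {s | T 0 s = t} = ℓ t / (t : ℝ) ^ (α + 1)
  law_pos : ∀ t : ℕ, 1 ≤ t → 0 < P.real {s | T 0 s = t}

section Model

variable {Ω : Type*}

/-- Renewal times `S_i = T_1 + ⋯ + T_i`, with `S_0 = 0`. -/
def renewalTime (T : ℕ → Ω → ℕ) (i : ℕ) (s : Ω) : ℕ := ∑ j ∈ Finset.range i, T j s

/-- Contact number `L_n = sup {i : S_i ≤ n}`. -/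
def contactNumber (T : ℕ → Ω → ℕ) (n : ℕ) (s : Ω) : ℕ := sSup {i : ℕ | renewalTime T i s ≤ n}

/-- Maximal gap between contacts `M_n = max {T_1, …, T_{L_n}}`. -/
def maxGap (T : ℕ → Ω → ℕ) (n : ℕ) (s : Ω) : ℕ :=
  (Finset.range (contactNumber T n s)).sup (fun j => T j s)

/-- The event `{n ∈ S}` that `n` is a renewal time. -/
def isContact (T : ℕ → Ω → ℕ) (n : ℕ) : Set Ω := {s | ∃ i, renewalTime T i s = n}

/-- Boltzmann weight `exp (∑_{i=1}^{L_n} (h + ω_{S_i})) 1_{n ∈ S}` with charges `ω`. -/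
def weight (T : ℕ → Ω → ℕ) (n : ℕ) (h : ℝ) (ω : ℕ → ℝ) : Ω → ℝ :=
  (isContact T n).indicator fun s =>
    Real.exp (∑ i ∈ Finset.Icc 1 (contactNumber T n s), (h + ω (renewalTime T i s)))

variable [MeasurableSpace Ω]

/-- Partition function `Z_{n,h}(ω)`. -/
def partitionFunction (P : Measure Ω) (T : ℕ → Ω → ℕ) (n : ℕ) (h : ℝ) (ω : ℕ → ℝ) : ℝ :=
  ∫ s, weight T n h ω s ∂P

/-- The pinning model `P_{n,h,ω}`. -/
def pinningMeasure (P : Measure Ω) (T : ℕ → Ω → ℕ) (n : ℕ) (h : ℝ) (ω : ℕ → ℝ) : Measure Ω :=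
  P.withDensity fun s => ENNReal.ofReal (weight T n h ω s / partitionFunction P T n h ω)

/-- Finite-volume free energy `(1/n) log Z_{n,h}(0)` of the pure model. -/
def finiteFreeEnergy (P : Measure Ω) (T : ℕ → Ω → ℕ) (n : ℕ) (h : ℝ) : ℝ :=
  1 / (n : ℝ) * Real.log (partitionFunction P T n h 0)

/-- Free energy `f(h) = lim_n (1/n) log Z_{n,h}(0)` of the pure model. -/
def freeEnergy (P : Measure Ω) (T : ℕ → Ω → ℕ) (h : ℝ) : ℝ :=
  limUnder atTop fun n : ℕ => finiteFreeEnergy P T n h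

/-- Critical point `h_c = inf {h : f(h) > 0}`. -/
def criticalPoint (P : Measure Ω) (T : ℕ → Ω → ℕ) : ℝ := sInf {h : ℝ | 0 < freeEnergy P T h}

/-- Contact density `ρ = ∂_h f`, used on `(h_c, ∞)`. -/
def contactDensity (P : Measure Ω) (T : ℕ → Ω → ℕ) : ℝ → ℝ := deriv (freeEnergy P T)

/-- Critical contact density `ρ_c = lim_{h ↓ h_c} ρ(h)`. -/
def criticalDensity (P : Measure Ω) (T : ℕ → Ω → ℕ) : ℝ :=
  limUnder (𝓝[>] criticalPoint P T) (contactDensity P T)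

/-- The inverse of `ρ : (h_c, ∞) → (ρ_c, 1)`. -/
def inverseDensity (P : Measure Ω) (T : ℕ → Ω → ℕ) : ℝ → ℝ :=
  Function.invFunOn (contactDensity P T) (Ioi (criticalPoint P T))

/-- The quantities `f`, `h_c`, `ρ`, `ρ_c` and the inverse of `ρ` are given by honest limits,
infima, derivatives and inverses. -/
structure WellDefined (P : Measure Ω) (T : ℕ → Ω → ℕ) : Prop where
  tendsto_freeEnergy : ∀ h, Tendsto (fun n : ℕ => finiteFreeEnergy P T n h) atTop (𝓝 (freeEnergy P T h))
  isGLB_criticalPoint : IsGLB {h : ℝ | 0 < freeEnergy P T h} (criticalPoint P T)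
  hasDerivAt_freeEnergy : ∀ h, criticalPoint P T < h →
    HasDerivAt (freeEnergy P T) (contactDensity P T h) h
  tendsto_contactDensity : Tendsto (contactDensity P T) (𝓝[>] criticalPoint P T)
    (𝓝 (criticalDensity P T))
  bijOn_contactDensity : BijOn (contactDensity P T) (Ioi (criticalPoint P T))
    (Ioo (criticalDensity P T) 1)

end Model

/-- The set `nR ∩ {1, 2, …}`. -/
def scaledNat (n : ℕ) (R : Set ℝ) : Set ℕ := {l : ℕ | 1 ≤ l ∧ ∃ r ∈ R, (l : ℝ) = n * r}

end Pinning

end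

/-! Conditioning on `L_n = l` removes the pinning: on that event the density equals a constant on
`{S_l = n}` and vanishes elsewhere, so neither `h` nor the partition function matters. What remains
are `l` i.i.d. steps of law `K` conditioned on their sum being `n`. A union bound
(`cond_pinningMeasure_le`) controls the largest of them by `exceptionalRatio`, a quotient of
convolution powers: the numerator accounts for all steps below `b`, or some step in `G`; the
denominator is the weight of sum `n`.

Identification of the thermodynamic quantities: `renewalSum` solves a renewal equation, whence `h_c
= 0` and, on `(0, ∞)`, the free energy is the inverse of `logLap K`, minus the logarithm of the
Laplace transform. Thus `ρ = 1 / meanGap K ∘ f`, and `φ = f(ι_ρ(r))` is the parameter for which the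
law proportional to `K(t) e^(-φ t)` has mean `1 / r`. If `ρ_c > 0`, then `K` has the finite mean `μ
= 1 / ρ_c`.

Dense regime: the ratio is invariant under tilting. With the above `φ` for `r = l / n`, the sum `n`
is exactly the mean of the tilted sum, and a local limit theorem, uniform for `φ` in a compact set
(`exists_local_limit_bounds`), bounds the denominator below by a multiple of `1 / √l`. The tilted
law decays like `e^(-φ t)` up to polynomial factors, so the largest of order `n` steps is close to
`log n / φ` (`exists_exceptionalRatio_le`).

Sparse regime: `n` exceeds `l μ` by a positive fraction of `n`, and a single large step is the
cheapest way to achieve this. It yields a denominator of order at least `n K(n)`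
(`exists_le_convPow`). Macroscopic steps far from `n - l μ` contribute `o(n K(n))` by the weak law
(`eventually_wrong_jump_le`), and configurations without steps of size `δ n` contribute an
arbitrarily small multiple of `n K(n)` for small `δ` (`exists_small_jumps_le`).

Beyond the fact that `K` is a positive law of mass one, slow variation enters only through the
polynomial comparison `PolynomiallyRegular`. -/

namespace Pinning

/-! ### Convolution powers and coefficientwise inequalities of generating series -/

/-- The `l`-fold convolution power of a sequence, evaluated at `n`. -/
noncomputable def convPow (w : ℕ → ℝ) (l n : ℕ) : ℝ := PowerSeries.coeff n (PowerSeries.mk w ^ l)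

/-- A power series all of whose coefficients are nonnegative. -/
def CoeffNonneg (A : PowerSeries ℝ) : Prop := ∀ n, 0 ≤ PowerSeries.coeff n A

namespace CoeffNonneg

variable {A B : PowerSeries ℝ}

theorem add (hA : CoeffNonneg A) (hB : CoeffNonneg B) : CoeffNonneg (A + B) := fun n => by
  rw [map_add]; exact add_nonneg (hA n) (hB n)

theorem mul (hA : CoeffNonneg A) (hB : CoeffNonneg B) : CoeffNonneg (A * B) := fun n => by
  rw [PowerSeries.coeff_mul]
  exact Finset.sum_nonneg fun p _ => mul_nonneg (hA _) (hB _)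

theorem one : CoeffNonneg 1 := fun n => by
  rw [PowerSeries.coeff_one]; split_ifs <;> norm_num

theorem zero : CoeffNonneg 0 := fun n => by simp

theorem pow (hA : CoeffNonneg A) (l : ℕ) : CoeffNonneg (A ^ l) := by
  induction l with
  | zero => simpa using one
  | succ l ih => rw [pow_succ]; exact ih.mul hA

theorem natCast_mul (hA : CoeffNonneg A) (l : ℕ) : CoeffNonneg ((l : PowerSeries ℝ) * A) := by
  induction l with
  | zero => simpa using zero
  | succ l ih => rw [Nat.cast_succ, add_mul, one_mul]; exact ih.add hA

theorem pow_sub_pow (hB : CoeffNonneg B) (hAB : CoeffNonneg (A - B)) (l : ℕ) :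
    CoeffNonneg (A ^ l - B ^ l) := by
  have hA : CoeffNonneg A := by simpa using hAB.add hB
  induction l with
  | zero => simpa using zero
  | succ l ih =>
    have : A ^ (l + 1) - B ^ (l + 1) = (A - B) * A ^ l + B * (A ^ l - B ^ l) := by ring
    rw [this]
    exact (hAB.mul (hA.pow l)).add (hB.mul ih)

/-- When `B` generates a restriction of the law generated by `A`, the difference of powers counts
words with at least one forbidden letter, and the bound sums over its position. In the induction the
new defect is `B` times the old one plus `(l + 1) (A - B)² A ^ l`. -/
theorem union_bound (hB : CoeffNonneg B) (hAB : CoeffNonneg (A - B)) (l : ℕ) :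
    CoeffNonneg (((l + 1 : ℕ) : PowerSeries ℝ) * ((A - B) * A ^ l) - (A ^ (l + 1) - B ^ (l + 1))) := by
  have hA : CoeffNonneg A := by simpa using hAB.add hB
  induction l with
  | zero => simpa using zero
  | succ l ih =>
    have := (hB.mul ih).add ((((hAB.mul hAB).mul (hA.pow l))).natCast_mul (l + 1))
    convert this using 1
    push_cast
    ring

/-- This keeps only the words with exactly one letter from `A - B`, i.e. the linear term in `A - B`
of the binomial expansion of `((A - B) + B) ^ (l + 1)`. -/
theorem one_jump (hB : CoeffNonneg B) (hAB : CoeffNonneg (A - B)) (l : ℕ) :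
    CoeffNonneg (A ^ (l + 1) - ((l + 1 : ℕ) : PowerSeries ℝ) * ((A - B) * B ^ l)) := by
  induction l with
  | zero => simpa using hB
  | succ l ih =>
    have := (hB.mul ih).add (hAB.mul (pow_sub_pow hB hAB (l + 1)))
    convert this using 1
    push_cast
    ring

end CoeffNonneg

theorem convPow_zero (w : ℕ → ℝ) (n : ℕ) : convPow w 0 n = if n = 0 then 1 else 0 := by
  simp [convPow, PowerSeries.coeff_one]

theorem convPow_succ (w : ℕ → ℝ) (l n : ℕ) :
    convPow w (l + 1) n = ∑ p ∈ Finset.HasAntidiagonal.antidiagonal n, w p.1 * convPow w l p.2 := by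
  simp [convPow, pow_succ', PowerSeries.coeff_mul]

theorem coeffNonneg_mk {w : ℕ → ℝ} (hw : ∀ t, 0 ≤ w t) : CoeffNonneg (PowerSeries.mk w) :=
  fun n => by simpa using hw n

theorem coeffNonneg_mk_sub {v w : ℕ → ℝ} (hw : ∀ t, w t ≤ v t) :
    CoeffNonneg (PowerSeries.mk v - PowerSeries.mk w) :=
  fun n => by simpa using hw n

theorem convPow_nonneg {w : ℕ → ℝ} (hw : ∀ t, 0 ≤ w t) (l n : ℕ) : 0 ≤ convPow w l n :=
  (coeffNonneg_mk hw).pow l n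

theorem convPow_mono {v w : ℕ → ℝ} (hw : ∀ t, 0 ≤ w t) (hvw : ∀ t, w t ≤ v t) (l n : ℕ) :
    convPow w l n ≤ convPow v l n := by
  have := (coeffNonneg_mk hw).pow_sub_pow (coeffNonneg_mk_sub hvw) l n
  rwa [map_sub, sub_nonneg] at this

theorem convPow_sub_le {v w : ℕ → ℝ} (hw : ∀ t, 0 ≤ w t) (hvw : ∀ t, w t ≤ v t) (l n : ℕ) :
    convPow v (l + 1) n - convPow w (l + 1) n ≤
      (l + 1) * ∑ p ∈ Finset.HasAntidiagonal.antidiagonal n, (v p.1 - w p.1) * convPow v l p.2 := by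
  have := (coeffNonneg_mk hw).union_bound (coeffNonneg_mk_sub hvw) l n
  rw [map_sub, ← nsmul_eq_mul, map_nsmul, nsmul_eq_mul, PowerSeries.coeff_mul, map_sub,
    sub_nonneg] at this
  simpa [convPow] using this

theorem le_convPow {v w : ℕ → ℝ} (hw : ∀ t, 0 ≤ w t) (hvw : ∀ t, w t ≤ v t) (l n : ℕ) :
    (l + 1) * ∑ p ∈ Finset.HasAntidiagonal.antidiagonal n, (v p.1 - w p.1) * convPow w l p.2
      ≤ convPow v (l + 1) n := by
  have := (coeffNonneg_mk hw).one_jump (coeffNonneg_mk_sub hvw) l n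
  rw [map_sub, ← nsmul_eq_mul, map_nsmul, nsmul_eq_mul, PowerSeries.coeff_mul, sub_nonneg] at this
  simpa [convPow] using this

theorem convPow_const_mul (a : ℝ) (w : ℕ → ℝ) (l n : ℕ) :
    convPow (fun t => a * w t) l n = a ^ l * convPow w l n := by
  induction l generalizing n with
  | zero => simp [convPow_zero]
  | succ l ih =>
    simp only [convPow_succ, ih, Finset.mul_sum]
    exact Finset.sum_congr rfl fun p _ => by ring

theorem convPow_mul_pow (x : ℝ) (w : ℕ → ℝ) (l n : ℕ) :
    convPow (fun t => w t * x ^ t) l n = convPow w l n * x ^ n := by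
  induction l generalizing n with
  | zero => by_cases h : n = 0 <;> simp [convPow_zero, h]
  | succ l ih =>
    simp only [convPow_succ, ih, Finset.sum_mul]
    refine Finset.sum_congr rfl fun p hp => ?_
    rw [← Finset.HasAntidiagonal.mem_antidiagonal.1 hp, pow_add]; ring

theorem convPow_eq_zero {w : ℕ → ℝ} (h0 : w 0 = 0) {l n : ℕ} (h : n < l) : convPow w l n = 0 := by
  induction l generalizing n with
  | zero => omega
  | succ l ih =>
    rw [convPow_succ]
    refine Finset.sum_eq_zero fun p hp => ?_
    have := Finset.HasAntidiagonal.mem_antidiagonal.1 hp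
    rcases Nat.eq_zero_or_pos p.1 with h1 | h1
    · rw [h1, h0, zero_mul]
    · rw [ih (by omega), mul_zero]

/-- Iterated Cauchy products. Complex `z` in the closed disc serves both the total mass (`z = 1`)
and the characteristic function (`z = e^(iθ)`). -/
theorem hasSum_convPow_mul_pow {w : ℕ → ℝ} (hw : ∀ t, 0 ≤ w t) (hs : Summable w) {z : ℂ}
    (hz : ‖z‖ ≤ 1) (l : ℕ) :
    Summable (fun n => ‖(convPow w l n : ℂ) * z ^ n‖) ∧
      ∑' n, (convPow w l n : ℂ) * z ^ n = (∑' t, (w t : ℂ) * z ^ t) ^ l := by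
  have hs1 : Summable fun t => ‖(w t : ℂ) * z ^ t‖ := by
    refine hs.of_nonneg_of_le (fun _ => norm_nonneg _) fun t => ?_
    rw [norm_mul, norm_pow, Complex.norm_real, Real.norm_of_nonneg (hw t)]
    exact mul_le_of_le_one_right (hw t) (pow_le_one₀ (norm_nonneg _) hz)
  induction l with
  | zero =>
    have h : ∀ n, n ∉ ({0} : Finset ℕ) → (convPow w 0 n : ℂ) * z ^ n = 0 := fun n hn => by
      have : n ≠ 0 := by simpa using hn
      simp [convPow_zero, this]
    refine ⟨summable_of_ne_finset_zero (s := {0}) fun n hn => by rw [h n hn, norm_zero], ?_⟩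
    rw [tsum_eq_sum h]
    simp [convPow_zero]
  | succ l ih =>
    have key : ∀ n, (convPow w (l + 1) n : ℂ) * z ^ n = ∑ p ∈ Finset.HasAntidiagonal.antidiagonal n,
        ((w p.1 : ℂ) * z ^ p.1) * ((convPow w l p.2 : ℂ) * z ^ p.2) := fun n => by
      rw [convPow_succ]
      push_cast
      rw [Finset.sum_mul]
      refine Finset.sum_congr rfl fun p hp => ?_
      rw [← Finset.HasAntidiagonal.mem_antidiagonal.1 hp, pow_add]; ring
    have h1 := summable_norm_sum_mul_antidiagonal_of_summable_norm hs1 ih.1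
    have h2 := tsum_mul_tsum_eq_tsum_sum_antidiagonal_of_summable_norm hs1 ih.1
    rw [ih.2, ← pow_succ'] at h2
    constructor
    · simpa only [key] using h1
    · rw [h2]
      exact tsum_congr key

theorem hasSum_convPow {w : ℕ → ℝ} (hw : ∀ t, 0 ≤ w t) (hs : Summable w) (l : ℕ) :
    HasSum (convPow w l) ((∑' t, w t) ^ l) := by
  obtain ⟨h1, h2⟩ := hasSum_convPow_mul_pow hw hs (z := 1) (by simp) l
  have h3 := h1.of_norm.hasSum
  rw [h2] at h3
  simp only [one_pow, mul_one] at h3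
  rw [← Complex.ofReal_tsum, ← Complex.ofReal_pow] at h3
  exact Complex.hasSum_ofReal.1 h3

theorem sum_convPow_le {w : ℕ → ℝ} (hw : ∀ t, 0 ≤ w t) (hs : Summable w) (l : ℕ)
    (s : Finset ℕ) : ∑ n ∈ s, convPow w l n ≤ (∑' t, w t) ^ l :=
  sum_le_hasSum s (fun _ _ => convPow_nonneg hw _ _) (hasSum_convPow hw hs l)

theorem convPow_le {w : ℕ → ℝ} (hw : ∀ t, 0 ≤ w t) (hs : Summable w) (l n : ℕ) :
    convPow w l n ≤ (∑' t, w t) ^ l := by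
  simpa using sum_convPow_le hw hs l {n}

/-! ### From the pinning measure to convolution powers -/

section Bridge

variable {Ω : Type*} [MeasurableSpace Ω] {P : Measure Ω} {T : ℕ → Ω → ℕ} {α : ℝ} {ℓ : ℝ → ℝ}

/-- A probability on the positive integers, charging all of them. -/
structure IsStepLaw (K : ℕ → ℝ) : Prop where
  zero : K 0 = 0
  pos : ∀ t, 1 ≤ t → 0 < K t
  hasSum : HasSum K 1

theorem IsStepLaw.nonneg {K : ℕ → ℝ} (hK : IsStepLaw K) (t : ℕ) : 0 ≤ K t := by
  rcases Nat.eq_zero_or_pos t with rfl | h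
  · exact hK.zero.ge
  · exact (hK.pos t h).le

theorem IsStepLaw.le_one {K : ℕ → ℝ} (hK : IsStepLaw K) (t : ℕ) : K t ≤ 1 :=
  le_hasSum hK.hasSum t fun j _ => hK.nonneg j

/-- The law of an inter-arrival time. -/
noncomputable def stepLaw (P : Measure Ω) (T : ℕ → Ω → ℕ) (t : ℕ) : ℝ := P.real {s | T 0 s = t}

theorem InterArrival.isStepLaw (hT : InterArrival P T α ℓ) : IsStepLaw (stepLaw P T) where
  zero := by
    have : {s | T 0 s = 0} = ∅ := by
      ext s
      have := hT.one_le 0 s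
      simp only [mem_ofPred_eq, mem_empty_iff_false, iff_false]
      omega
    simp [stepLaw, this]
  pos := hT.law_pos
  hasSum := by
    have := hT.isProbability
    have h1 := tsum_measure_preimage_singleton (μ := P) (f := T 0) (s := univ) (to_countable _)
      fun t _ => hT.measurable 0 (measurableSet_singleton t)
    rw [tsum_univ (fun t => P (T 0 ⁻¹' {t})), preimage_univ, measure_univ] at h1
    have h2 := ENNReal.hasSum_toReal (f := fun t => P (T 0 ⁻¹' {t})) (by rw [h1]; simp)
    rw [← ENNReal.tsum_toReal_eq fun t => measure_ne_top _ _, h1] at h2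
    rw [ENNReal.toReal_one] at h2
    exact h2

theorem measurable_renewalTime (hT : ∀ i, Measurable (T i)) (l : ℕ) :
    Measurable (renewalTime T l) := by
  unfold renewalTime
  exact Finset.measurable_fun_sum _ fun j _ => hT j

theorem measurableSet_restricted (hT : ∀ i, Measurable (T i)) (G : Set ℕ) (l n : ℕ) :
    MeasurableSet {s | renewalTime T l s = n ∧ ∀ j < l, T j s ∈ G} := by
  have : {s | renewalTime T l s = n ∧ ∀ j < l, T j s ∈ G} =
      renewalTime T l ⁻¹' {n} ∩ ⋂ j, ⋂ (_ : j < l), T j ⁻¹' G := by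
    ext s; simp
  rw [this]
  exact (measurable_renewalTime hT l (measurableSet_singleton n)).inter
    (MeasurableSet.iInter fun j => MeasurableSet.iInter fun _ => hT j (MeasurableSet.of_discrete (s := G)))

/-- The induction splits off the last step, which is independent of the earlier ones. The set `G` is
used as `Iio b`, as the complement of an exceptional set, and as `univ`. -/
theorem InterArrival.measureReal_restricted (hT : InterArrival P T α ℓ) (G : Set ℕ) (l n : ℕ) :
    P.real {s | renewalTime T l s = n ∧ ∀ j < l, T j s ∈ G} =
      convPow (G.indicator (stepLaw P T)) l n := by
  have := hT.isProbability
  induction l generalizing n with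
  | zero =>
    by_cases h : n = 0
    · simp [convPow_zero, renewalTime, h]
    · simp [convPow_zero, renewalTime, h, Ne.symm h]
  | succ l ih =>
    rw [convPow_succ]
    have hset : {s | renewalTime T (l + 1) s = n ∧ ∀ j < l + 1, T j s ∈ G} =
        ⋃ p ∈ Finset.HasAntidiagonal.antidiagonal n, {s | T l s = p.1 ∧ p.1 ∈ G} ∩
          {s | renewalTime T l s = p.2 ∧ ∀ j < l, T j s ∈ G} := by
      ext s
      simp only [renewalTime, Finset.sum_range_succ, mem_ofPred_eq, mem_iUnion, mem_inter_iff,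
        Finset.HasAntidiagonal.mem_antidiagonal, exists_prop, Prod.exists, Nat.lt_succ_iff_lt_or_eq]
      constructor
      · rintro ⟨h1, h2⟩
        exact ⟨T l s, _, by rw [add_comm]; exact h1, ⟨rfl, h2 l (Or.inr rfl)⟩, rfl,
          fun j hj => h2 j (Or.inl hj)⟩
      · rintro ⟨a, b, h1, ⟨h2, h3⟩, h4, h5⟩
        refine ⟨by omega, ?_⟩
        rintro j (hj | rfl)
        · exact h5 j hj
        · rwa [h2]
    have hmeas : ∀ t : ℕ, MeasurableSet {s | T l s = t ∧ t ∈ G} := fun t => by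
      by_cases h : t ∈ G
      · simp only [h, and_true]
        exact hT.measurable l (measurableSet_singleton t)
      · simp [h]
    rw [hset, measureReal_biUnion_finset]
    · refine Finset.sum_congr rfl fun p _ => ?_
      rw [← ih p.2]
      have hind := hT.indep.indepFun_finset {l} (Finset.range l) (by simp) hT.measurable
      have h1 : {s | T l s = p.1 ∧ p.1 ∈ G} =
          (fun a (i : ({l} : Finset ℕ)) => T i a) ⁻¹' {x | x ⟨l, by simp⟩ = p.1 ∧ p.1 ∈ G} := by
        ext s; simp
      have h2 : {s | renewalTime T l s = p.2 ∧ ∀ j < l, T j s ∈ G} =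
          (fun a (i : Finset.range l) => T i a) ⁻¹' {x | ∑ i, x i = p.2 ∧ ∀ i, x i ∈ G} := by
        ext s
        simp only [renewalTime, mem_ofPred_eq, mem_preimage, Subtype.forall, Finset.mem_range]
        rw [← Finset.sum_coe_sort]
      have h3 : P.real {s | T l s = p.1 ∧ p.1 ∈ G} = G.indicator (stepLaw P T) p.1 := by
        by_cases h : p.1 ∈ G
        · have := (hT.identDistrib l).measure_mem_eq (measurableSet_singleton p.1)
          rw [indicator_of_mem h]
          simp only [h, and_true, stepLaw, measureReal_def]
          exact congrArg _ this
        · simp [h]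
      rw [← h3, h1, h2]
      simp only [measureReal_def]
      rw [hind.measure_inter_preimage_eq_mul _ _ MeasurableSet.of_discrete
        MeasurableSet.of_discrete, ENNReal.toReal_mul]
    · intro p hp q hq hpq
      refine Set.disjoint_left.2 fun s hs hs' => hpq ?_
      have e1 : p.1 = q.1 := hs.1.1.symm.trans hs'.1.1
      have e2 : p.2 = q.2 := hs.2.1.symm.trans hs'.2.1
      exact Prod.ext e1 e2
    · intro p _
      exact (hmeas p.1).inter (measurableSet_restricted hT.measurable G l p.2)

theorem InterArrival.measureReal_renewalTime (hT : InterArrival P T α ℓ) (l n : ℕ) :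
    P.real {s | renewalTime T l s = n} = convPow (stepLaw P T) l n := by
  simpa using hT.measureReal_restricted univ l n

theorem InterArrival.strictMono (hT : InterArrival P T α ℓ) (s : Ω) :
    StrictMono fun i => renewalTime T i s :=
  strictMono_nat_of_lt_succ fun i => by
    have := hT.one_le i s
    simp only [renewalTime, Finset.sum_range_succ]
    omega

theorem InterArrival.contactNumber_eq (hT : InterArrival P T α ℓ) {l n : ℕ} {s : Ω}
    (h : renewalTime T l s = n) : contactNumber T n s = l := by
  have : {i : ℕ | renewalTime T i s ≤ n} = Iic l := by
    ext i
    rw [← h]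
    exact (hT.strictMono s).le_iff_le
  rw [contactNumber, this, csSup_Iic]

theorem InterArrival.weight_eq (hT : InterArrival P T α ℓ) {l n : ℕ} {s : Ω} (h : ℝ)
    (hs : renewalTime T l s = n) : weight T n h 0 s = Real.exp h ^ l := by
  have : s ∈ isContact T n := ⟨l, hs⟩
  rw [weight, indicator_of_mem this, hT.contactNumber_eq hs, ← Real.exp_nat_mul]
  simp

theorem InterArrival.weight_eq_sum (hT : InterArrival P T α ℓ) (n : ℕ) (h : ℝ) (s : Ω) :
    weight T n h 0 s = ∑ l ∈ Finset.range (n + 1),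
      {s | renewalTime T l s = n}.indicator (fun _ => Real.exp h ^ l) s := by
  by_cases hs : s ∈ isContact T n
  · obtain ⟨l, hl⟩ := hs
    have hln : l ≤ n := by rw [← hl]; exact (hT.strictMono s).le_apply
    rw [hT.weight_eq h hl, Finset.sum_eq_single l]
    · rw [indicator_of_mem (by exact hl)]
    · intro j _ hj
      refine indicator_of_notMem (fun hj' => hj ?_) _
      exact (hT.strictMono s).injective (hj'.trans hl.symm)
    · intro hl'; exact absurd (Finset.mem_range.2 (by omega)) hl'
  · rw [weight, indicator_of_notMem hs, Finset.sum_eq_zero]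
    intro l _
    exact indicator_of_notMem (s := {s | renewalTime T l s = n}) (fun hl => hs ⟨l, hl⟩) _

theorem InterArrival.partitionFunction_eq (hT : InterArrival P T α ℓ) (n : ℕ) (h : ℝ) :
    partitionFunction P T n h 0 =
      ∑ l ∈ Finset.range (n + 1), Real.exp h ^ l * convPow (stepLaw P T) l n := by
  have := hT.isProbability
  have hm : ∀ l, MeasurableSet {s | renewalTime T l s = n} := fun l =>
    measurable_renewalTime hT.measurable l (measurableSet_singleton n)
  simp only [partitionFunction, hT.weight_eq_sum]
  rw [integral_finsetSum _ fun l _ => (integrable_const _).indicator (hm l)]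
  refine Finset.sum_congr rfl fun l _ => ?_
  rw [integral_indicator_const _ (hm l), hT.measureReal_renewalTime, smul_eq_mul, mul_comm]

theorem InterArrival.measurableSet_contactNumber (hT : InterArrival P T α ℓ) (n l : ℕ) :
    MeasurableSet ({s | contactNumber T n s = l} : Set Ω) := by
  have : ({s | contactNumber T n s = l} : Set Ω) =
      {s | renewalTime T l s ≤ n} ∩ {s | n < renewalTime T (l + 1) s} := by
    ext s
    have hmono := hT.strictMono s
    have hbdd : BddAbove {i : ℕ | renewalTime T i s ≤ n} :=
      ⟨n, fun i hi => (hmono.le_apply).trans hi⟩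
    have hne : ({i : ℕ | renewalTime T i s ≤ n}).Nonempty := ⟨0, by simp [renewalTime]⟩
    simp only [mem_ofPred_eq, mem_inter_iff, contactNumber]
    constructor
    · rintro rfl
      refine ⟨Nat.sSup_mem hne hbdd, ?_⟩
      by_contra! hcon
      have := le_csSup hbdd (a := sSup {i : ℕ | renewalTime T i s ≤ n} + 1) hcon
      omega
    · rintro ⟨h1, h2⟩
      refine le_antisymm (csSup_le hne fun i hi => ?_) (le_csSup hbdd h1)
      have : renewalTime T i s < renewalTime T (l + 1) s := lt_of_le_of_lt hi h2
      have := hmono.lt_iff_lt.1 this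
      omega
  rw [this]
  exact (measurable_renewalTime hT.measurable l (MeasurableSet.of_discrete (s := Iic n))).inter
    (measurable_renewalTime hT.measurable (l + 1) (MeasurableSet.of_discrete (s := Ioi n)))

/-- On `{L_n = l}` the density is constant where `S_l = n` and zero elsewhere; the constant factor
is what cancels under conditioning. -/
theorem InterArrival.pinningMeasure_inter (hT : InterArrival P T α ℓ) (n l : ℕ) (h : ℝ)
    (E : Set Ω) :
    pinningMeasure P T n h 0 ({s | contactNumber T n s = l} ∩ E) =
      ENNReal.ofReal (Real.exp h ^ l / partitionFunction P T n h 0) *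
        P ({s | renewalTime T l s = n} ∩ E) := by
  have := hT.isProbability
  have hm : MeasurableSet {s | renewalTime T l s = n} :=
    measurable_renewalTime hT.measurable l (measurableSet_singleton n)
  have hind : ∀ s ∈ ({s | contactNumber T n s = l} : Set Ω),
      ENNReal.ofReal (weight T n h 0 s / partitionFunction P T n h 0) =
      {s | renewalTime T l s = n}.indicator
        (fun _ => ENNReal.ofReal (Real.exp h ^ l / partitionFunction P T n h 0)) s := by
    intro s hs
    by_cases hc : s ∈ isContact T n
    · obtain ⟨i, hi⟩ := hc
      have : i = l := (hT.contactNumber_eq hi).symm.trans hs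
      subst this
      rw [indicator_of_mem (by exact hi), hT.weight_eq h hi]
    · have hc' : s ∉ {s | renewalTime T l s = n} := fun hl => hc ⟨l, hl⟩
      rw [weight, indicator_of_notMem hc, indicator_of_notMem hc']
      simp
  have hcm := hT.measurableSet_contactNumber n l
  have hsub : {s | renewalTime T l s = n} ⊆ ({s | contactNumber T n s = l} : Set Ω) :=
    fun s hs => hT.contactNumber_eq hs
  rw [pinningMeasure, withDensity_apply', ← Measure.restrict_restrict hcm,
    setLIntegral_congr_fun hcm hind, lintegral_indicator hm, setLIntegral_const,
    Measure.restrict_apply hm, inter_eq_left.2 hsub, Measure.restrict_apply hm]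

/-- The maximum is attained by some step: if it is below `b`, all steps are, and if it lies in `G`,
some step does. The second case is the complement of "no step in `G`", which `convPow_sub_le`
estimates. -/
theorem InterArrival.cond_pinningMeasure_le (hT : InterArrival P T α ℓ) (n l : ℕ) (h : ℝ)
    {B G : Set ℕ} {b : ℕ} (hb : ∀ m ∈ B, m < b ∨ m ∈ G) :
    ProbabilityTheory.cond (pinningMeasure P T n h 0) {s | contactNumber T n s = l + 1}
      {s | maxGap T n s ∈ B} ≤ ENNReal.ofReal
        ((convPow ((Iio b).indicator (stepLaw P T)) (l + 1) n + (l + 1) *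
          ∑ p ∈ Finset.HasAntidiagonal.antidiagonal n,
            G.indicator (stepLaw P T) p.1 * convPow (stepLaw P T) l p.2) /
          convPow (stepLaw P T) (l + 1) n) := by
  have := hT.isProbability
  have hK : ∀ t, 0 ≤ stepLaw P T t := fun t => measureReal_nonneg
  set c := ENNReal.ofReal (Real.exp h ^ (l + 1) / partitionFunction P T n h 0) with hc
  have h1 := hT.pinningMeasure_inter n (l + 1) h univ
  rw [inter_univ, inter_univ] at h1
  have h2 := hT.pinningMeasure_inter n (l + 1) h {s | maxGap T n s ∈ B}
  have hnum : P.real ({s | renewalTime T (l + 1) s = n} ∩ {s | maxGap T n s ∈ B}) ≤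
      convPow ((Iio b).indicator (stepLaw P T)) (l + 1) n + (l + 1) *
          ∑ p ∈ Finset.HasAntidiagonal.antidiagonal n,
            G.indicator (stepLaw P T) p.1 * convPow (stepLaw P T) l p.2 := by
    set A := {s | renewalTime T (l + 1) s = n ∧ ∀ j < l + 1, T j s ∈ Iio b}
    set D := {s | renewalTime T (l + 1) s = n ∧ ∀ j < l + 1, T j s ∈ Gᶜ}
    have hDm : MeasurableSet D := measurableSet_restricted hT.measurable Gᶜ (l + 1) n
    have hsub : {s | renewalTime T (l + 1) s = n} ∩ {s | maxGap T n s ∈ B} ⊆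
        A ∪ ({s | renewalTime T (l + 1) s = n} \ D) := by
      rintro s ⟨h3, h4⟩
      have h3' : renewalTime T (l + 1) s = n := h3
      have h4' : maxGap T n s ∈ B := h4
      rw [maxGap, hT.contactNumber_eq h3'] at h4'
      rcases hb _ h4' with h5 | h5
      · left
        refine ⟨h3, fun j hj => lt_of_le_of_lt ?_ h5⟩
        exact Finset.le_sup (f := fun j => T j s) (Finset.mem_range.2 hj)
      · right
        refine ⟨h3, fun h6 => ?_⟩
        obtain ⟨j, hj, hj'⟩ := Finset.exists_mem_eq_sup (Finset.range (l + 1)) (by simp)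
          (fun j => T j s)
        rw [hj'] at h5
        exact h6.2 j (Finset.mem_range.1 hj) h5
    refine (measureReal_mono hsub).trans ((measureReal_union_le _ _).trans ?_)
    refine add_le_add (hT.measureReal_restricted (Iio b) (l + 1) n).le ?_
    have hDsub : D ⊆ {s | renewalTime T (l + 1) s = n} := fun s hs => hs.1
    rw [measureReal_sdiff hDsub hDm, hT.measureReal_renewalTime,
      hT.measureReal_restricted]
    refine (convPow_sub_le (fun t => indicator_nonneg (fun t _ => hK t) t)
      (fun t => indicator_le_self' (fun _ _ => hK _) t) l n).trans (le_of_eq ?_)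
    congr 1
    refine Finset.sum_congr rfl fun p _ => ?_
    congr 1
    by_cases hp : p.1 ∈ G <;> simp [hp]
  rw [ProbabilityTheory.cond_apply (hT.measurableSet_contactNumber n (l + 1)), h1, h2, ← hc]
  -- In these two degenerate cases the conditioning event is null and the conditional measure
  -- vanishes; otherwise `c` cancels.
  by_cases hc0 : c = 0
  · simp [hc0]
  by_cases hS : P {s | renewalTime T (l + 1) s = n} = 0
  · rw [measure_mono_null inter_subset_left hS]
    simp
  rw [← hT.measureReal_renewalTime, ENNReal.mul_inv (Or.inl hc0) (Or.inl ENNReal.ofReal_ne_top),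
    mul_mul_mul_comm, ENNReal.inv_mul_cancel hc0 ENNReal.ofReal_ne_top, one_mul,
    ENNReal.ofReal_div_of_pos (by
      rw [measureReal_def]; exact ENNReal.toReal_pos hS (measure_ne_top _ _)), mul_comm,
    ofReal_measureReal, ← div_eq_mul_inv]
  refine ENNReal.div_le_div_right ?_ _
  rw [← ofReal_measureReal (μ := P)
    (s := {s | renewalTime T (l + 1) s = n} ∩ {s | maxGap T n s ∈ B})]
  exact ENNReal.ofReal_le_ofReal hnum

end Bridge

/-! ### Laplace transform and mean of the tilted law -/

/-- The moments `∑ t ^ j K(t) e ^ (-φ t)` of the exponentially weighted law. -/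
noncomputable def lap (K : ℕ → ℝ) (j : ℕ) (φ : ℝ) : ℝ :=
  ∑' t : ℕ, (t : ℝ) ^ j * K t * Real.exp (-φ * t)

/-- The mean of the exponentially tilted law. -/
noncomputable def meanGap (K : ℕ → ℝ) (φ : ℝ) : ℝ := lap K 1 φ / lap K 0 φ

/-- Minus the logarithm of the Laplace transform. -/
noncomputable def logLap (K : ℕ → ℝ) (φ : ℝ) : ℝ := -Real.log (lap K 0 φ)

section Laplace

variable {K : ℕ → ℝ} (hK : IsStepLaw K)
include hK

theorem IsStepLaw.summable_lap (j : ℕ) {φ : ℝ} (hφ : 0 < φ) :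
    Summable fun t : ℕ => (t : ℝ) ^ j * K t * Real.exp (-φ * t) := by
  refine (Real.summable_pow_mul_exp_neg_nat_mul j hφ).of_nonneg_of_le
    (fun t => mul_nonneg (mul_nonneg (by positivity) (hK.nonneg t)) (Real.exp_nonneg _))
    fun t => ?_
  refine mul_le_mul_of_nonneg_right ?_ (Real.exp_nonneg _)
  exact mul_le_of_le_one_right (by positivity) (hK.le_one t)

theorem IsStepLaw.hasSum_lap (j : ℕ) {φ : ℝ} (hφ : 0 < φ) :
    HasSum (fun t : ℕ => (t : ℝ) ^ j * K t * Real.exp (-φ * t)) (lap K j φ) :=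
  (hK.summable_lap j hφ).hasSum

theorem IsStepLaw.lap_pos (j : ℕ) {φ : ℝ} (hφ : 0 < φ) : 0 < lap K j φ :=
  (hK.summable_lap j hφ).tsum_pos
    (fun t => mul_nonneg (mul_nonneg (by positivity) (hK.nonneg t)) (Real.exp_nonneg _)) 1
    (by have := hK.pos 1 le_rfl; positivity)

theorem IsStepLaw.summable_lap_zero {φ : ℝ} (hφ : 0 ≤ φ) :
    Summable fun t : ℕ => K t * Real.exp (-φ * t) := by
  refine hK.hasSum.summable.of_nonneg_of_le
    (fun t => mul_nonneg (hK.nonneg t) (Real.exp_nonneg _)) fun t => ?_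
  refine mul_le_of_le_one_right (hK.nonneg t) (Real.exp_le_one_iff.2 ?_)
  have : (0 : ℝ) ≤ φ * t := by positivity
  linarith

omit hK in
theorem lap_zero_eq (φ : ℝ) : lap K 0 φ = ∑' t : ℕ, K t * Real.exp (-φ * t) := by
  simp [lap]

theorem IsStepLaw.lap_zero_zero : lap K 0 0 = 1 := by
  rw [lap_zero_eq]; simpa using hK.hasSum.tsum_eq

/-- Termwise differentiation is justified on `(φ / 2, ∞)`, where the derivatives are dominated by
the summable terms of the next moment at `φ / 2`. -/
theorem IsStepLaw.hasDerivAt_lap (j : ℕ) {φ : ℝ} (hφ : 0 < φ) :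
    HasDerivAt (lap K j) (-lap K (j + 1) φ) φ := by
  have key := hasDerivAt_tsum_of_isPreconnected (𝕜 := ℝ)
    (g := fun (t : ℕ) (y : ℝ) => (t : ℝ) ^ j * K t * Real.exp (-y * t))
    (g' := fun (t : ℕ) (y : ℝ) => -((t : ℝ) ^ (j + 1) * K t * Real.exp (-y * t)))
    (u := fun t : ℕ => (t : ℝ) ^ (j + 1) * K t * Real.exp (-(φ / 2) * t)) (t := Ioi (φ / 2))
    (y₀ := φ) (y := φ) (hK.summable_lap (j + 1) (half_pos hφ)) isOpen_Ioi isPreconnected_Ioi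
    ?_ ?_ (by simpa using hφ) (hK.summable_lap j hφ) (by simpa using hφ)
  · rw [tsum_neg] at key
    exact key
  · intro t y _
    have h1 : HasDerivAt (fun y : ℝ => -y * (t : ℝ)) (-1 * t) y := (hasDerivAt_neg y).mul_const _
    exact (h1.exp.const_mul ((t : ℝ) ^ j * K t)).congr_deriv (by ring)
  · intro t y hy
    have h0 : 0 ≤ (t : ℝ) ^ (j + 1) * K t := mul_nonneg (by positivity) (hK.nonneg t)
    rw [norm_neg, Real.norm_of_nonneg (mul_nonneg h0 (Real.exp_nonneg _))]
    refine mul_le_mul_of_nonneg_left (Real.exp_le_exp.2 ?_) h0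
    have : φ / 2 * t ≤ y * t := mul_le_mul_of_nonneg_right (le_of_lt hy) (by positivity)
    linarith

theorem IsStepLaw.hasDerivAt_logLap {φ : ℝ} (hφ : 0 < φ) :
    HasDerivAt (logLap K) (meanGap K φ) φ := by
  exact ((hK.hasDerivAt_lap 0 hφ).log (hK.lap_pos 0 hφ).ne').neg.congr_deriv
    (by unfold meanGap; ring)

/-- The tilted law has positive variance: it charges both `1` and `2`, and its mean differs from at
least one of them. This makes `meanGap` strictly decreasing. -/
theorem IsStepLaw.sq_lap_lt {φ : ℝ} (hφ : 0 < φ) :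
    lap K 1 φ ^ 2 < lap K 2 φ * lap K 0 φ := by
  set m := meanGap K φ with hm
  have h0 := hK.lap_pos 0 hφ
  have hw : ∀ t : ℕ, 1 ≤ t → 0 < K t * Real.exp (-φ * t) := fun t ht =>
    mul_pos (hK.pos t ht) (Real.exp_pos _)
  have hs : HasSum (fun t : ℕ => ((t : ℝ) - m) ^ 2 * (K t * Real.exp (-φ * t)))
      (lap K 2 φ - 2 * m * lap K 1 φ + m ^ 2 * lap K 0 φ) := by
    refine (((hK.hasSum_lap 2 hφ).sub ((hK.hasSum_lap 1 hφ).mul_left (2 * m))).add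
      ((hK.hasSum_lap 0 hφ).mul_left (m ^ 2))).congr_fun fun t => ?_
    ring
  have hnn : ∀ t : ℕ, 0 ≤ ((t : ℝ) - m) ^ 2 * (K t * Real.exp (-φ * t)) := fun t =>
    mul_nonneg (sq_nonneg _) (mul_nonneg (hK.nonneg t) (Real.exp_nonneg _))
  have hpos : 0 < lap K 2 φ - 2 * m * lap K 1 φ + m ^ 2 * lap K 0 φ := by
    rw [← hs.tsum_eq]
    by_cases h1 : m = 1
    · refine hs.summable.tsum_pos hnn 2 ?_
      have := hw 2 (by norm_num)
      rw [h1]; norm_num at this ⊢; exact this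
    · refine hs.summable.tsum_pos hnn 1 (mul_pos ?_ (hw 1 le_rfl))
      have : (1 : ℝ) - m ≠ 0 := sub_ne_zero.2 (Ne.symm h1)
      push_cast
      positivity
  have e : lap K 1 φ = m * lap K 0 φ := by rw [hm, meanGap]; field_simp
  rw [e] at hpos ⊢
  nlinarith

theorem IsStepLaw.hasDerivAt_meanGap {φ : ℝ} (hφ : 0 < φ) :
    HasDerivAt (meanGap K)
      ((-lap K 2 φ * lap K 0 φ - lap K 1 φ * -lap K 1 φ) / lap K 0 φ ^ 2) φ :=
  (hK.hasDerivAt_lap 1 hφ).div (hK.hasDerivAt_lap 0 hφ) (hK.lap_pos 0 hφ).ne'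

theorem IsStepLaw.strictAntiOn_meanGap : StrictAntiOn (meanGap K) (Ioi 0) := by
  refine strictAntiOn_of_deriv_neg (convex_Ioi 0)
    (fun φ hφ => (hK.hasDerivAt_meanGap hφ).continuousAt.continuousWithinAt) fun φ hφ => ?_
  rw [interior_Ioi] at hφ
  rw [(hK.hasDerivAt_meanGap hφ).deriv]
  have := hK.sq_lap_lt hφ
  have := hK.lap_pos 0 hφ
  exact div_neg_of_neg_of_pos (by nlinarith) (by positivity)

theorem IsStepLaw.one_lt_meanGap {φ : ℝ} (hφ : 0 < φ) : 1 < meanGap K φ := by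
  rw [meanGap, one_lt_div (hK.lap_pos 0 hφ)]
  refine Summable.tsum_lt_tsum (i := 2) (fun t => ?_) ?_ (hK.summable_lap 0 hφ)
    (hK.summable_lap 1 hφ)
  · refine mul_le_mul_of_nonneg_right ?_ (Real.exp_nonneg _)
    rcases Nat.eq_zero_or_pos t with rfl | h
    · simp [hK.zero]
    · refine mul_le_mul_of_nonneg_right ?_ (hK.nonneg t)
      rw [pow_zero, pow_one]; exact Nat.one_le_cast.2 h
  · have := mul_pos (hK.pos 2 (by norm_num)) (Real.exp_pos (-φ * (2 : ℕ)))
    norm_num at this ⊢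
    nlinarith

/-- The term `t = 1` cancels in `lap K 1 φ - lap K 0 φ`, which is therefore `O(e^(-2φ))`, against
`lap K 0 φ ≥ K 1 * e^(-φ)`. This lets the contact density approach `1`. -/
theorem IsStepLaw.tendsto_meanGap_atTop : Tendsto (meanGap K) atTop (𝓝 1) := by
  have hK1 := hK.pos 1 le_rfl
  have hb : ∀ φ : ℝ, 1 ≤ φ → meanGap K φ ≤ 1 + lap K 1 1 * Real.exp 2 / K 1 * Real.exp (-φ) := by
    intro φ h1
    have hφ : 0 < φ := by linarith
    have h0 : K 1 * Real.exp (-φ) ≤ lap K 0 φ := by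
      have := le_hasSum (hK.hasSum_lap 0 hφ) 1 fun t _ =>
        mul_nonneg (mul_nonneg (by positivity) (hK.nonneg t)) (Real.exp_nonneg _)
      simpa using this
    have h2 : lap K 1 φ - lap K 0 φ ≤ Real.exp (-2 * φ) * (Real.exp 2 * lap K 1 1) := by
      rw [lap, lap, ← (hK.summable_lap 1 hφ).tsum_sub (hK.summable_lap 0 hφ), lap,
        ← tsum_mul_left, ← tsum_mul_left]
      refine Summable.tsum_le_tsum (fun t => ?_)
        ((hK.summable_lap 1 hφ).sub (hK.summable_lap 0 hφ))
        (((hK.summable_lap 1 one_pos).mul_left _).mul_left _)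
      rcases Nat.lt_or_ge t 2 with h | h
      · interval_cases t
        · simp [hK.zero]
        · have : 0 ≤ Real.exp (-2 * φ) * (Real.exp 2 * (K 1 * Real.exp (-1))) := by positivity
          simpa using this
      · have ht : (2 : ℝ) ≤ t := by exact_mod_cast h
        have e1 : Real.exp (-φ * t) ≤ Real.exp (-2 * φ) * (Real.exp 2 * Real.exp (-1 * t)) := by
          rw [← Real.exp_add, ← Real.exp_add, Real.exp_le_exp]
          nlinarith
        have e2 := hK.nonneg t
        calc (t : ℝ) ^ 1 * K t * Real.exp (-φ * t) - (t : ℝ) ^ 0 * K t * Real.exp (-φ * t)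
            ≤ (t : ℝ) ^ 1 * K t * Real.exp (-φ * t) := by
              have : 0 ≤ (t : ℝ) ^ 0 * K t * Real.exp (-φ * t) := by positivity
              linarith
          _ ≤ (t : ℝ) ^ 1 * K t * (Real.exp (-2 * φ) * (Real.exp 2 * Real.exp (-1 * t))) :=
              mul_le_mul_of_nonneg_left e1 (by positivity)
          _ = _ := by ring
    have hp := hK.lap_pos 0 hφ
    have h3 := (hK.lap_pos 1 one_pos).le
    have h4 : (lap K 1 φ - lap K 0 φ) / lap K 0 φ ≤
        Real.exp (-2 * φ) * (Real.exp 2 * lap K 1 1) / (K 1 * Real.exp (-φ)) := by gcongr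
    have h5 : Real.exp (-2 * φ) = Real.exp (-φ) * Real.exp (-φ) := by
      rw [← Real.exp_add]; ring_nf
    rw [meanGap]
    calc lap K 1 φ / lap K 0 φ = 1 + (lap K 1 φ - lap K 0 φ) / lap K 0 φ := by
          field_simp; ring
      _ ≤ 1 + Real.exp (-2 * φ) * (Real.exp 2 * lap K 1 1) / (K 1 * Real.exp (-φ)) := by linarith
      _ = _ := by rw [h5]; field_simp
  refine tendsto_of_tendsto_of_tendsto_of_le_of_le' tendsto_const_nhds
    (h := fun φ => 1 + lap K 1 1 * Real.exp 2 / K 1 * Real.exp (-φ)) ?_ ?_ ?_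
  · have := (Real.tendsto_exp_neg_atTop_nhds_zero.const_mul
      (lap K 1 1 * Real.exp 2 / K 1)).const_add 1
    simpa using this
  · filter_upwards [eventually_gt_atTop 0] with φ hφ using (hK.one_lt_meanGap hφ).le
  · filter_upwards [eventually_ge_atTop 1] with φ hφ using hb φ hφ

theorem IsStepLaw.lap_zero_le {φ : ℝ} (hφ : 0 ≤ φ) : lap K 0 φ ≤ Real.exp (-φ) := by
  rw [lap_zero_eq, ← one_mul (Real.exp (-φ)), ← hK.hasSum.tsum_eq, ← tsum_mul_right]
  refine Summable.tsum_le_tsum (fun t => ?_) (hK.summable_lap_zero hφ)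
    (hK.hasSum.summable.mul_right _)
  rcases Nat.eq_zero_or_pos t with rfl | h
  · simp [hK.zero]
  · refine mul_le_mul_of_nonneg_left (Real.exp_le_exp.2 ?_) (hK.nonneg t)
    have : (1 : ℝ) ≤ t := by exact_mod_cast h
    nlinarith

theorem IsStepLaw.continuousOn_lap {j : ℕ} (hs : Summable fun t : ℕ => (t : ℝ) ^ j * K t) :
    ContinuousOn (lap K j) (Ici 0) := by
  unfold lap
  refine continuousOn_tsum (fun t => by fun_prop) hs fun t φ hφ => ?_
  have hφ' : (0 : ℝ) ≤ φ := hφ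
  have h0 : 0 ≤ (t : ℝ) ^ j * K t := mul_nonneg (by positivity) (hK.nonneg t)
  rw [Real.norm_of_nonneg (mul_nonneg h0 (Real.exp_nonneg _))]
  refine mul_le_of_le_one_right h0 (Real.exp_le_one_iff.2 ?_)
  have : (0 : ℝ) ≤ φ * t := by positivity
  linarith

theorem IsStepLaw.continuousOn_lap_zero : ContinuousOn (lap K 0) (Ici 0) :=
  hK.continuousOn_lap (by simpa using hK.hasSum.summable)

theorem IsStepLaw.lap_zero_pos {φ : ℝ} (hφ : 0 ≤ φ) : 0 < lap K 0 φ := by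
  rcases hφ.eq_or_lt with rfl | h
  · rw [hK.lap_zero_zero]; exact one_pos
  · exact hK.lap_pos 0 h

theorem IsStepLaw.le_logLap {φ : ℝ} (hφ : 0 ≤ φ) : φ ≤ logLap K φ := by
  have := Real.log_le_log (hK.lap_zero_pos hφ) (hK.lap_zero_le hφ)
  rw [Real.log_exp] at this
  rw [logLap]; linarith

theorem IsStepLaw.continuousOn_logLap : ContinuousOn (logLap K) (Ici 0) :=
  (hK.continuousOn_lap_zero.log fun _ hφ => (hK.lap_zero_pos hφ).ne').neg

theorem IsStepLaw.strictMonoOn_logLap : StrictMonoOn (logLap K) (Ici 0) := by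
  refine strictMonoOn_of_deriv_pos (convex_Ici 0) hK.continuousOn_logLap fun φ hφ => ?_
  rw [interior_Ici] at hφ
  rw [(hK.hasDerivAt_logLap hφ).deriv]
  exact one_pos.trans (hK.one_lt_meanGap hφ)

theorem IsStepLaw.logLap_zero : logLap K 0 = 0 := by
  rw [logLap, hK.lap_zero_zero, Real.log_one, neg_zero]

theorem IsStepLaw.exists_logLap_eq {h : ℝ} (hh : 0 < h) : ∃ φ, 0 < φ ∧ logLap K φ = h := by
  have := intermediate_value_Icc hh.le (hK.continuousOn_logLap.mono Icc_subset_Ici_self)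
  obtain ⟨φ, hφ, e⟩ := this ⟨by rw [hK.logLap_zero]; exact hh.le, hK.le_logLap hh.le⟩
  refine ⟨φ, lt_of_le_of_ne hφ.1 ?_, e⟩
  rintro rfl
  rw [hK.logLap_zero] at e
  exact hh.ne e

end Laplace

/-! ### Renewal equation and existence of the free energy -/

/-- Regular variation, in the weak form in which it is used. -/
def PolynomiallyRegular (K : ℕ → ℝ) (C : ℝ) (A : ℕ) : Prop :=
  0 < C ∧ ∀ t n : ℕ, 1 ≤ t → t ≤ n →
    K t ≤ C * ((n : ℝ) / t) ^ A * K n ∧ K n ≤ C * ((n : ℝ) / t) ^ A * K t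

/-- The partition function of the pure model with Boltzmann factor `x` per contact. -/
noncomputable def renewalSum (K : ℕ → ℝ) (x : ℝ) (n : ℕ) : ℝ :=
  ∑ l ∈ Finset.range (n + 1), x ^ l * convPow K l n

section Renewal

variable {K : ℕ → ℝ} (hK : IsStepLaw K)
include hK

omit hK in
theorem renewalSum_zero (x : ℝ) : renewalSum K x 0 = 1 := by
  simp [renewalSum, convPow_zero]

/-- Decomposition at the first step; the inductions on `n` below rest on it. -/
theorem IsStepLaw.renewalSum_eq (x : ℝ) {n : ℕ} (hn : 1 ≤ n) :
    renewalSum K x n =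
      x * ∑ p ∈ Finset.HasAntidiagonal.antidiagonal n, K p.1 * renewalSum K x p.2 := by
  have h1 : renewalSum K x n = ∑ l ∈ Finset.range n, x ^ (l + 1) * convPow K (l + 1) n := by
    rw [renewalSum, Finset.sum_range_succ', convPow_zero, if_neg (by omega)]
    simp
  rw [h1, Finset.mul_sum]
  simp only [convPow_succ, Finset.mul_sum]
  rw [Finset.sum_comm]
  refine Finset.sum_congr rfl fun p hp => ?_
  have hp' := Finset.HasAntidiagonal.mem_antidiagonal.1 hp
  rcases Nat.eq_zero_or_pos p.1 with h0 | h0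
  · simp [h0, hK.zero]
  · rw [renewalSum, Finset.mul_sum, Finset.mul_sum]
    symm
    rw [Finset.sum_subset (s₂ := Finset.range n)]
    · exact Finset.sum_congr rfl fun l _ => by ring
    · exact Finset.range_subset_range.2 (by omega)
    · intro l _ hl
      rw [Finset.mem_range, not_lt] at hl
      rw [convPow_eq_zero hK.zero (by omega)]
      ring

theorem IsStepLaw.renewalSum_pos {x : ℝ} (hx : 0 < x) (n : ℕ) : 0 < renewalSum K x n := by
  induction n using Nat.strong_induction_on with
  | _ n ih =>
    rcases Nat.eq_zero_or_pos n with rfl | hn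
    · rw [renewalSum_zero]; exact one_pos
    · rw [hK.renewalSum_eq x hn]
      refine mul_pos hx (Finset.sum_pos' (fun p hp => ?_) ⟨(n, 0), by simp, ?_⟩)
      · have hp' := Finset.HasAntidiagonal.mem_antidiagonal.1 hp
        rcases Nat.eq_zero_or_pos p.1 with h0 | h0
        · simp [h0, hK.zero]
        · exact mul_nonneg (hK.nonneg _) (ih _ (by omega)).le
      · simpa [renewalSum_zero] using hK.pos n hn

theorem IsStepLaw.le_renewalSum {x : ℝ} (hx : 0 < x) {n : ℕ} (hn : 1 ≤ n) :
    x * K n ≤ renewalSum K x n := by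
  rw [hK.renewalSum_eq x hn]
  refine mul_le_mul_of_nonneg_left ?_ hx.le
  have := Finset.single_le_sum (f := fun p : ℕ × ℕ => K p.1 * renewalSum K x p.2)
    (s := Finset.HasAntidiagonal.antidiagonal n)
    (fun p _ => mul_nonneg (hK.nonneg _) (hK.renewalSum_pos hx _).le) (a := (n, 0)) (by simp)
  simpa [renewalSum_zero] using this

/-- Forcing a contact at `m` can only decrease the partition function at `m + n`. This
supermultiplicativity feeds Fekete's lemma. -/
theorem IsStepLaw.renewalSum_mul_le {x : ℝ} (hx : 0 < x) (m n : ℕ) :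
    renewalSum K x m * renewalSum K x n ≤ renewalSum K x (m + n) := by
  induction m using Nat.strong_induction_on with
  | _ m ih =>
    rcases Nat.eq_zero_or_pos m with rfl | hm
    · simp [renewalSum_zero]
    · rw [hK.renewalSum_eq x hm, hK.renewalSum_eq x (show 1 ≤ m + n by omega), mul_assoc,
        Finset.sum_mul]
      refine mul_le_mul_of_nonneg_left ?_ hx.le
      rw [Finset.Nat.sum_antidiagonal_eq_sum_range_succ_mk,
        Finset.Nat.sum_antidiagonal_eq_sum_range_succ_mk]
      refine (Finset.sum_le_sum fun t ht => ?_).trans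
        (Finset.sum_le_sum_of_subset_of_nonneg (Finset.range_subset_range.2 (by omega))
          fun t _ _ => mul_nonneg (hK.nonneg _) (hK.renewalSum_pos hx _).le)
      rw [Finset.mem_range] at ht
      rw [mul_assoc]
      rcases Nat.eq_zero_or_pos t with h0 | h0
      · simp [h0, hK.zero]
      · have := ih (m - t) (by omega)
        rw [show m - t + n = m + n - t by omega] at this
        exact mul_le_mul_of_nonneg_left this (hK.nonneg _)

/-- Under the condition on `φ`, the function `e^(φ n)` is a supersolution of the renewal equation.
-/
theorem IsStepLaw.renewalSum_le {x φ : ℝ} (hx : 0 < x) (hφ : 0 ≤ φ) (h : x * lap K 0 φ ≤ 1)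
    (n : ℕ) : renewalSum K x n ≤ Real.exp (φ * n) := by
  induction n using Nat.strong_induction_on with
  | _ n ih =>
    rcases Nat.eq_zero_or_pos n with rfl | hn
    · simp [renewalSum_zero]
    · rw [hK.renewalSum_eq x hn, Finset.Nat.sum_antidiagonal_eq_sum_range_succ_mk]
      calc x * ∑ t ∈ Finset.range n.succ, K t * renewalSum K x (n - t)
          ≤ x * ∑ t ∈ Finset.range n.succ, K t * Real.exp (-φ * t) * Real.exp (φ * n) := by
            refine mul_le_mul_of_nonneg_left (Finset.sum_le_sum fun t ht => ?_) hx.le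
            rw [Finset.mem_range] at ht
            rw [mul_assoc]
            rcases Nat.eq_zero_or_pos t with h0 | h0
            · simp [h0, hK.zero]
            · refine mul_le_mul_of_nonneg_left ((ih (n - t) (by omega)).trans ?_) (hK.nonneg _)
              rw [← Real.exp_add, Nat.cast_sub (by omega)]
              exact Real.exp_le_exp.2 (by linarith)
        _ ≤ x * (lap K 0 φ * Real.exp (φ * n)) := by
            rw [← Finset.sum_mul, lap_zero_eq]
            gcongr
            exact (hK.summable_lap_zero hφ).sum_le_tsum _ fun t _ =>
              mul_nonneg (hK.nonneg t) (Real.exp_nonneg _)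
        _ ≤ Real.exp (φ * n) := by
            rw [← mul_assoc]
            exact mul_le_of_le_one_left (Real.exp_nonneg _) h

omit hK in
theorem convPow_tilt (x φ : ℝ) (l n : ℕ) :
    convPow (fun t => x * (K t * Real.exp (-φ * t))) l n =
      x ^ l * (convPow K l n * Real.exp (-φ * n)) := by
  have h : ∀ t : ℕ, Real.exp (-φ * t) = Real.exp (-φ) ^ t := fun t => by
    rw [← Real.exp_nat_mul, mul_comm]
  simp only [h]
  rw [convPow_const_mul, convPow_mul_pow]

/-- The free energy cannot be smaller than the solution of `x * lap K 0 φ = 1`. -/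
theorem IsStepLaw.le_of_renewalSum_le {x φ g : ℝ} (hx : 0 < x) (hφ : 0 ≤ φ)
    (h : x * lap K 0 φ = 1) (hg : ∀ n : ℕ, renewalSum K x n ≤ Real.exp (g * n)) : φ ≤ g := by
  by_contra! hlt
  -- The law `q` is a probability, so its first `J` convolution powers have total mass `J`. At `n`
  -- they sum to at most `renewalSum K x n * e^(-φ n) ≤ e^(-(φ - g) n)`, a convergent geometric
  -- series if `g < φ`; letting `J` grow gives a contradiction.
  set q : ℕ → ℝ := fun t => x * (K t * Real.exp (-φ * t)) with hq
  have hq0 : ∀ t, 0 ≤ q t := fun t =>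
    mul_nonneg hx.le (mul_nonneg (hK.nonneg t) (Real.exp_nonneg _))
  have hqs : Summable q := (hK.summable_lap_zero hφ).mul_left x
  have hq1 : ∑' t, q t = 1 := by rw [hq, tsum_mul_left, ← lap_zero_eq, h]
  have hgeo : Summable fun n : ℕ => Real.exp (-(φ - g)) ^ n :=
    summable_geometric_of_lt_one (Real.exp_nonneg _) (Real.exp_lt_one_iff.2 (by linarith))
  have key : ∀ J : ℕ, (J : ℝ) ≤ ∑' n : ℕ, Real.exp (-(φ - g)) ^ n := by
    intro J
    have h1 : HasSum (fun n => ∑ l ∈ Finset.range J, convPow q l n) J := by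
      have := hasSum_sum (s := Finset.range J) fun l _ => hasSum_convPow hq0 hqs l
      simpa [hq1] using this
    refine hasSum_le (fun n => ?_) h1 hgeo.hasSum
    calc ∑ l ∈ Finset.range J, convPow q l n
        ≤ ∑ l ∈ Finset.range (J + (n + 1)), convPow q l n :=
          Finset.sum_le_sum_of_subset_of_nonneg (Finset.range_subset_range.2 (by omega))
            fun l _ _ => convPow_nonneg hq0 l n
      _ = ∑ l ∈ Finset.range (n + 1), convPow q l n := by
          symm
          refine Finset.sum_subset (Finset.range_subset_range.2 (by omega)) fun l _ hl => ?_
          rw [Finset.mem_range, not_lt] at hl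
          exact convPow_eq_zero (by simp [hq, hK.zero]) (by omega)
      _ = renewalSum K x n * Real.exp (-φ * n) := by
          rw [renewalSum, Finset.sum_mul]
          refine Finset.sum_congr rfl fun l _ => ?_
          rw [hq, convPow_tilt, mul_assoc]
      _ ≤ Real.exp (g * n) * Real.exp (-φ * n) :=
          mul_le_mul_of_nonneg_right (hg n) (Real.exp_nonneg _)
      _ = Real.exp (-(φ - g)) ^ n := by
          rw [← Real.exp_add, ← Real.exp_nat_mul]; ring_nf
  obtain ⟨J, hJ⟩ := exists_nat_gt (∑' n : ℕ, Real.exp (-(φ - g)) ^ n)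
  exact absurd (key J) (not_le.2 hJ)

omit hK in
theorem PolynomiallyRegular.le_apply {C : ℝ} {A : ℕ} (h : PolynomiallyRegular K C A) {n : ℕ}
    (hn : 1 ≤ n) : K 1 / C / (n : ℝ) ^ A ≤ K n := by
  have h1 := (h.2 1 n le_rfl hn).1
  have hC := h.1
  have : (0 : ℝ) < n := by exact_mod_cast hn
  rw [div_div, div_le_iff₀ (by positivity)]
  rw [Nat.cast_one, div_one] at h1
  linarith

/-- The free energy exists, it vanishes for `x ≤ 1` and inverts `logLap` for `x > 1`. -/
theorem IsStepLaw.exists_tendsto_log_renewalSum {C : ℝ} {A : ℕ} (hreg : PolynomiallyRegular K C A)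
    (h : ℝ) : ∃ g : ℝ, Tendsto (fun n : ℕ => 1 / (n : ℝ) * Real.log (renewalSum K (Real.exp h) n))
      atTop (𝓝 g) ∧ 0 ≤ g ∧ (h ≤ 0 → g = 0) ∧ (0 < h → 0 < g ∧ logLap K g = h) := by
  set x := Real.exp h with hxdef
  have hx : 0 < x := Real.exp_pos h
  set u := renewalSum K x with hu
  have hpos : ∀ n, 0 < u n := hK.renewalSum_pos hx
  obtain ⟨φ₀, hφ₀, hle⟩ : ∃ φ, 0 ≤ φ ∧ x * lap K 0 φ ≤ 1 := by
    refine ⟨max h 0, le_max_right _ _, ?_⟩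
    calc x * lap K 0 (max h 0) ≤ x * Real.exp (-max h 0) := by
          gcongr; exact hK.lap_zero_le (le_max_right _ _)
      _ ≤ 1 := by
          rw [hxdef, ← Real.exp_add, Real.exp_le_one_iff]
          linarith [le_max_left h 0]
  have hsub : Subadditive fun n => -Real.log (u n) := fun m n => by
    have := Real.log_le_log (mul_pos (hpos m) (hpos n)) (hK.renewalSum_mul_le hx m n)
    rw [Real.log_mul (hpos m).ne' (hpos n).ne'] at this
    linarith
  have hlog_le : ∀ φ, 0 ≤ φ → x * lap K 0 φ ≤ 1 → ∀ n : ℕ, Real.log (u n) ≤ φ * n := by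
    intro φ hφ hle n
    have := Real.log_le_log (hpos n) (hK.renewalSum_le hx hφ hle n)
    rwa [Real.log_exp] at this
  have hbdd : BddBelow (range fun n : ℕ => -Real.log (u n) / n) := by
    refine ⟨-φ₀, ?_⟩
    rintro _ ⟨n, rfl⟩
    rcases Nat.eq_zero_or_pos n with rfl | hn
    · simpa using hφ₀
    · have hn' : (0 : ℝ) < n := by exact_mod_cast hn
      rw [le_div_iff₀ hn']
      linarith [hlog_le φ₀ hφ₀ hle n]
  set g := -hsub.lim with hg
  have htend : Tendsto (fun n : ℕ => 1 / (n : ℝ) * Real.log (u n)) atTop (𝓝 g) := by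
    refine (hsub.tendsto_lim hbdd).neg.congr fun n => ?_
    ring
  -- The Fekete limit is an infimum, so the exponential bound holds at every `n` without a
  -- correction factor.
  have hug : ∀ n : ℕ, u n ≤ Real.exp (g * n) := by
    intro n
    rcases Nat.eq_zero_or_pos n with rfl | hn
    · simp [hu, renewalSum_zero]
    · have hn' : (0 : ℝ) < n := by exact_mod_cast hn
      have := hsub.lim_le_div hbdd (n := n) (by omega)
      rw [le_div_iff₀ hn'] at this
      rw [← Real.log_le_iff_le_exp (hpos n), hg]
      linarith
  have hgle : ∀ φ, 0 ≤ φ → x * lap K 0 φ ≤ 1 → g ≤ φ := by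
    intro φ hφ hle
    refine le_of_tendsto htend ?_
    filter_upwards [eventually_ge_atTop 1] with n hn
    have hn' : (0 : ℝ) < n := by exact_mod_cast hn
    rw [one_div, inv_mul_le_iff₀ hn', mul_comm]
    exact hlog_le φ hφ hle n
  -- A single step of length `n` gives `u n ≥ x * K n`, which decays at most polynomially.
  have hg0 : 0 ≤ g := by
    have hc : 0 < x * (K 1 / C) := mul_pos hx (div_pos (hK.pos 1 le_rfl) hreg.1)
    have hlim : Tendsto (fun n : ℕ => Real.log (x * (K 1 / C)) / (n : ℝ) -
        A * (Real.log n / n)) atTop (𝓝 0) := by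
      have h1 : Tendsto (fun n : ℕ => Real.log n / (n : ℝ)) atTop (𝓝 0) := by
        have := Real.isLittleO_log_id_atTop.tendsto_div_nhds_zero
        exact this.comp tendsto_natCast_atTop_atTop
      simpa using (tendsto_const_div_atTop_nhds_zero_nat (Real.log (x * (K 1 / C)))).sub
        (h1.const_mul (A : ℝ))
    refine le_of_tendsto_of_tendsto hlim htend ?_
    filter_upwards [eventually_ge_atTop 1] with n hn
    have hn' : (0 : ℝ) < n := by exact_mod_cast hn
    have h1 : x * (K 1 / C) / (n : ℝ) ^ A ≤ u n := by
      refine le_trans ?_ (hK.le_renewalSum hx hn)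
      rw [mul_div_assoc]
      exact mul_le_mul_of_nonneg_left (PolynomiallyRegular.le_apply hreg hn) hx.le
    have h2 := Real.log_le_log (by positivity) h1
    rw [Real.log_div hc.ne' (by positivity), Real.log_pow] at h2
    calc Real.log (x * (K 1 / C)) / (n : ℝ) - A * (Real.log n / n)
        = 1 / (n : ℝ) * (Real.log (x * (K 1 / C)) - A * Real.log n) := by ring
      _ ≤ _ := by gcongr
  refine ⟨g, htend, hg0, fun hh => le_antisymm (hgle 0 le_rfl ?_) hg0, fun hh => ?_⟩
  · rw [hK.lap_zero_zero, mul_one]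
    exact Real.exp_le_one_iff.2 hh
  · obtain ⟨φ, hφ, e⟩ := hK.exists_logLap_eq hh
    have hx1 : x * lap K 0 φ = 1 := by
      rw [hxdef, ← e, logLap, Real.exp_neg, Real.exp_log (hK.lap_pos 0 hφ),
        inv_mul_cancel₀ (hK.lap_pos 0 hφ).ne']
    have : g = φ := le_antisymm (hgle φ hφ.le hx1.le) (hK.le_of_renewalSum_le hx hφ.le hx1 hug)
    rw [this]
    exact ⟨hφ, e⟩

end Renewal

/-! ### Critical point, contact density and its inverse -/

section WellDefined

variable {Ω : Type*} [MeasurableSpace Ω] {P : Measure Ω} {T : ℕ → Ω → ℕ} {α : ℝ} {ℓ : ℝ → ℝ}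
  {C : ℝ} {A : ℕ} (hT : InterArrival P T α ℓ) (hreg : PolynomiallyRegular (stepLaw P T) C A)
include hT hreg

theorem InterArrival.freeEnergy_spec (h : ℝ) :
    Tendsto (fun n : ℕ => finiteFreeEnergy P T n h) atTop (𝓝 (freeEnergy P T h)) ∧
      0 ≤ freeEnergy P T h ∧ (h ≤ 0 → freeEnergy P T h = 0) ∧
      (0 < h → 0 < freeEnergy P T h ∧ logLap (stepLaw P T) (freeEnergy P T h) = h) := by
  obtain ⟨g, h1, h2⟩ := hT.isStepLaw.exists_tendsto_log_renewalSum hreg h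
  have h3 : Tendsto (fun n : ℕ => finiteFreeEnergy P T n h) atTop (𝓝 g) := by
    refine h1.congr fun n => ?_
    rw [finiteFreeEnergy, hT.partitionFunction_eq]
    rfl
  have h4 : freeEnergy P T h = g := h3.limUnder_eq
  rw [h4]
  exact ⟨h3, h2⟩

theorem InterArrival.setOf_freeEnergy_pos : {h : ℝ | 0 < freeEnergy P T h} = Ioi 0 := by
  ext h
  obtain ⟨-, -, h1, h2⟩ := hT.freeEnergy_spec hreg h
  refine ⟨fun hh => ?_, fun hh => (h2 hh).1⟩
  by_contra hcon
  exact (ne_of_gt hh) (h1 (not_lt.1 hcon))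

theorem InterArrival.criticalPoint_eq : criticalPoint P T = 0 := by
  rw [criticalPoint, hT.setOf_freeEnergy_pos hreg, csInf_Ioi]

theorem InterArrival.freeEnergy_logLap {φ : ℝ} (hφ : 0 < φ) :
    0 < logLap (stepLaw P T) φ ∧ freeEnergy P T (logLap (stepLaw P T) φ) = φ := by
  have h1 : 0 < logLap (stepLaw P T) φ := hφ.trans_le (hT.isStepLaw.le_logLap hφ.le)
  obtain ⟨h2, h3⟩ := (hT.freeEnergy_spec hreg (logLap (stepLaw P T) φ)).2.2.2 h1
  exact ⟨h1, hT.isStepLaw.strictMonoOn_logLap.injOn h2.le hφ.le h3⟩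

theorem InterArrival.strictMonoOn_freeEnergy : StrictMonoOn (freeEnergy P T) (Ioi 0) := by
  intro a ha b hb hab
  obtain ⟨h1, h2⟩ := (hT.freeEnergy_spec hreg a).2.2.2 ha
  obtain ⟨h3, h4⟩ := (hT.freeEnergy_spec hreg b).2.2.2 hb
  rw [← h2, ← h4] at hab
  exact (hT.isStepLaw.strictMonoOn_logLap.lt_iff_lt h1.le h3.le).1 hab

theorem InterArrival.continuousAt_freeEnergy {h : ℝ} (hh : 0 < h) :
    ContinuousAt (freeEnergy P T) h := by
  refine (hT.strictMonoOn_freeEnergy hreg).continuousAt_of_image_mem_nhds (Ioi_mem_nhds hh) ?_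
  refine mem_of_superset (Ioi_mem_nhds ((hT.freeEnergy_spec hreg h).2.2.2 hh).1) fun φ hφ => ?_
  exact ⟨_, hT.freeEnergy_logLap hreg hφ⟩

/-- Inverse function rule: `logLap` is a left inverse of the free energy near the free energy's
argument, with derivative `meanGap`. -/
theorem InterArrival.hasDerivAt_freeEnergy {h : ℝ} (hh : 0 < h) :
    HasDerivAt (freeEnergy P T) (meanGap (stepLaw P T) (freeEnergy P T h))⁻¹ h := by
  have h1 := ((hT.freeEnergy_spec hreg h).2.2.2 hh).1
  refine HasDerivAt.of_local_left_inverse (hT.continuousAt_freeEnergy hreg hh)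
    (hT.isStepLaw.hasDerivAt_logLap h1) (one_pos.trans (hT.isStepLaw.one_lt_meanGap h1)).ne' ?_
  filter_upwards [Ioi_mem_nhds hh] with y hy
  exact ((hT.freeEnergy_spec hreg y).2.2.2 hy).2

theorem InterArrival.contactDensity_eq {h : ℝ} (hh : 0 < h) :
    contactDensity P T h = (meanGap (stepLaw P T) (freeEnergy P T h))⁻¹ :=
  (hT.hasDerivAt_freeEnergy hreg hh).deriv

theorem InterArrival.strictMonoOn_contactDensity : StrictMonoOn (contactDensity P T) (Ioi 0) := by
  intro a ha b hb hab
  rw [hT.contactDensity_eq hreg ha, hT.contactDensity_eq hreg hb]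
  have h1 := ((hT.freeEnergy_spec hreg a).2.2.2 ha).1
  have h2 := ((hT.freeEnergy_spec hreg b).2.2.2 hb).1
  exact inv_strictAnti₀ (one_pos.trans (hT.isStepLaw.one_lt_meanGap h2))
    (hT.isStepLaw.strictAntiOn_meanGap h1 h2 (hT.strictMonoOn_freeEnergy hreg ha hb hab))

theorem InterArrival.contactDensity_pos {h : ℝ} (hh : 0 < h) : 0 < contactDensity P T h := by
  rw [hT.contactDensity_eq hreg hh]
  exact inv_pos.2 (one_pos.trans
    (hT.isStepLaw.one_lt_meanGap ((hT.freeEnergy_spec hreg h).2.2.2 hh).1))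

theorem InterArrival.tendsto_contactDensity :
    Tendsto (contactDensity P T) (𝓝[>] 0) (𝓝 (criticalDensity P T)) := by
  have hbdd : BddBelow (contactDensity P T '' Ioi 0) := by
    refine ⟨0, ?_⟩
    rintro _ ⟨h, hh, rfl⟩
    exact (hT.contactDensity_pos hreg hh).le
  have := (hT.strictMonoOn_contactDensity hreg).monotoneOn.tendsto_nhdsGT hbdd
  rw [criticalDensity, hT.criticalPoint_eq hreg, this.limUnder_eq]
  exact this

theorem InterArrival.criticalDensity_lt {h : ℝ} (hh : 0 < h) :
    criticalDensity P T < contactDensity P T h := by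
  have h2 : 0 < h / 2 := half_pos hh
  refine lt_of_le_of_lt ?_ (hT.strictMonoOn_contactDensity hreg h2 hh (half_lt_self hh))
  refine le_of_tendsto (hT.tendsto_contactDensity hreg) ?_
  filter_upwards [Ioo_mem_nhdsGT h2] with y hy
  exact ((hT.strictMonoOn_contactDensity hreg).lt_iff_lt hy.1 h2).2 hy.2 |>.le

theorem InterArrival.contactDensity_lt_one {h : ℝ} (hh : 0 < h) : contactDensity P T h < 1 := by
  rw [hT.contactDensity_eq hreg hh]
  exact inv_lt_one_of_one_lt₀
    (hT.isStepLaw.one_lt_meanGap ((hT.freeEnergy_spec hreg h).2.2.2 hh).1)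

/-- Intermediate values: densities close to `ρ_c` come from the limit defining it, densities close
to `1` from `meanGap → 1` at infinity. -/
theorem InterArrival.surjOn_contactDensity :
    SurjOn (contactDensity P T) (Ioi 0) (Ioo (criticalDensity P T) 1) := by
  intro r hr
  have h0 : 0 ≤ criticalDensity P T := by
    refine ge_of_tendsto (hT.tendsto_contactDensity hreg) ?_
    filter_upwards [self_mem_nhdsWithin] with y hy
    exact (hT.contactDensity_pos hreg hy).le
  have hr0 : 0 < r := h0.trans_lt hr.1
  obtain ⟨a, ha, ha'⟩ : ∃ a, 0 < a ∧ contactDensity P T a < r :=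
    ((eventually_mem_nhdsWithin.and
      ((hT.tendsto_contactDensity hreg).eventually_lt_const hr.1)).exists)
  obtain ⟨b, hb, hb'⟩ : ∃ b, 0 < b ∧ r < contactDensity P T b := by
    have h1 : (1 : ℝ) < r⁻¹ := one_lt_inv₀ hr0 |>.2 hr.2
    obtain ⟨φ, hφ, hφ'⟩ := ((eventually_gt_atTop (0 : ℝ)).and
      (hT.isStepLaw.tendsto_meanGap_atTop.eventually_lt_const h1)).exists
    obtain ⟨h2, h3⟩ := hT.freeEnergy_logLap hreg hφ
    refine ⟨_, h2, ?_⟩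
    rw [hT.contactDensity_eq hreg h2, h3]
    exact (lt_inv_comm₀ (one_pos.trans (hT.isStepLaw.one_lt_meanGap hφ)) hr0).1 hφ'
  have hab : a ≤ b :=
    (((hT.strictMonoOn_contactDensity hreg).lt_iff_lt ha hb).1 (ha'.trans hb')).le
  have hcont : ContinuousOn (contactDensity P T) (Icc a b) := by
    have h4 : ContinuousOn (fun h => (meanGap (stepLaw P T) (freeEnergy P T h))⁻¹) (Icc a b) := by
      intro h hh
      have hh0 : 0 < h := lt_of_lt_of_le ha hh.1
      have h5 := ((hT.freeEnergy_spec hreg h).2.2.2 hh0).1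
      exact (((hT.isStepLaw.hasDerivAt_meanGap h5).continuousAt.comp
        (hT.continuousAt_freeEnergy hreg hh0)).inv₀
          (one_pos.trans (hT.isStepLaw.one_lt_meanGap h5)).ne').continuousWithinAt
    exact h4.congr fun h hh => hT.contactDensity_eq hreg (lt_of_lt_of_le ha hh.1)
  obtain ⟨c, hc, hc'⟩ := intermediate_value_Icc hab hcont ⟨ha'.le, hb'.le⟩
  exact ⟨c, lt_of_lt_of_le ha hc.1, hc'⟩

theorem InterArrival.wellDefined : WellDefined P T where
  tendsto_freeEnergy h := (hT.freeEnergy_spec hreg h).1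
  isGLB_criticalPoint := by
    rw [hT.criticalPoint_eq hreg, hT.setOf_freeEnergy_pos hreg]
    exact isGLB_Ioi
  hasDerivAt_freeEnergy h hh := by
    rw [hT.criticalPoint_eq hreg] at hh
    exact (hT.hasDerivAt_freeEnergy hreg hh).differentiableAt.hasDerivAt
  tendsto_contactDensity := by
    rw [hT.criticalPoint_eq hreg]
    exact hT.tendsto_contactDensity hreg
  bijOn_contactDensity := by
    rw [hT.criticalPoint_eq hreg]
    exact ⟨fun h hh => ⟨hT.criticalDensity_lt hreg hh, hT.contactDensity_lt_one hreg hh⟩,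
      (hT.strictMonoOn_contactDensity hreg).injOn, hT.surjOn_contactDensity hreg⟩

/-- This selects the tilt for the dense regime: when `r = l / n`, the tilted sum of `l` steps has
mean exactly `n`. -/
theorem InterArrival.inverseDensity_spec {r : ℝ} (hr : r ∈ Ioo (criticalDensity P T) 1) :
    0 < freeEnergy P T (inverseDensity P T r) ∧
      meanGap (stepLaw P T) (freeEnergy P T (inverseDensity P T r)) = r⁻¹ := by
  have h1 : ∃ h ∈ Ioi 0, contactDensity P T h = r := hT.surjOn_contactDensity hreg hr
  have h2 := Function.invFunOn_mem h1
  have h3 := Function.invFunOn_eq h1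
  rw [inverseDensity, hT.criticalPoint_eq hreg]
  refine ⟨((hT.freeEnergy_spec hreg _).2.2.2 h2).1, ?_⟩
  rw [hT.contactDensity_eq hreg h2] at h3
  exact inv_eq_iff_eq_inv.1 h3

/-- A positive critical density is the reciprocal of the mean of the inter-arrival law. -/
theorem InterArrival.hasSum_mean (hc : 0 < criticalDensity P T) :
    HasSum (fun t : ℕ => (t : ℝ) * stepLaw P T t) (criticalDensity P T)⁻¹ := by
  set K := stepLaw P T with hKdef
  have hK : IsStepLaw K := hT.isStepLaw
  -- Every `1 / meanGap K φ` is a contact density above `h_c`, hence exceeds `ρ_c`. Letting `φ ↓ 0`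
  -- in finite partial sums then gives a finite mean.
  have hbound : ∀ φ, 0 < φ → lap K 1 φ ≤ (criticalDensity P T)⁻¹ := by
    intro φ hφ
    obtain ⟨h2, h3⟩ := hT.freeEnergy_logLap hreg hφ
    have h4 := (hT.criticalDensity_lt hreg h2).le
    rw [hT.contactDensity_eq hreg h2, h3] at h4
    have hm := one_pos.trans (hK.one_lt_meanGap hφ)
    have h5 : meanGap K φ ≤ (criticalDensity P T)⁻¹ := (le_inv_comm₀ hc hm).1 h4
    have h6 : lap K 0 φ ≤ 1 := (hK.lap_zero_le hφ.le).trans (Real.exp_le_one_iff.2 (by linarith))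
    refine le_trans ?_ h5
    exact le_div_self (hK.lap_pos 1 hφ).le (hK.lap_pos 0 hφ) h6
  have hnn : ∀ t : ℕ, 0 ≤ (t : ℝ) ^ 1 * K t := fun t => mul_nonneg (by positivity) (hK.nonneg t)
  have hs : Summable fun t : ℕ => (t : ℝ) ^ 1 * K t := by
    refine summable_of_sum_le hnn (c := (criticalDensity P T)⁻¹) fun s => ?_
    have hlim : Tendsto (fun φ : ℝ => ∑ t ∈ s, (t : ℝ) ^ 1 * K t * Real.exp (-φ * t)) (𝓝[>] 0)
        (𝓝 (∑ t ∈ s, (t : ℝ) ^ 1 * K t)) := by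
      have : Continuous fun φ : ℝ => ∑ t ∈ s, (t : ℝ) ^ 1 * K t * Real.exp (-φ * t) := by fun_prop
      have := (this.tendsto 0).mono_left (nhdsWithin_le_nhds (s := Ioi 0))
      simpa using this
    refine le_of_tendsto hlim ?_
    filter_upwards [self_mem_nhdsWithin] with φ hφ
    exact (sum_le_hasSum s (fun t _ => mul_nonneg (hnn t) (Real.exp_nonneg _))
      (hK.hasSum_lap 1 hφ)).trans (hbound φ hφ)
  have hle : 𝓝[>] (0 : ℝ) ≤ 𝓝[≥] 0 := nhdsWithin_mono _ Ioi_subset_Ici_self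
  -- The mean is identified by computing the limit of `meanGap` at `0` twice: by continuity of the
  -- moments here, through the definition of `ρ_c` in `h2`.
  have h1 : Tendsto (meanGap K) (𝓝[>] 0) (𝓝 (∑' t : ℕ, (t : ℝ) ^ 1 * K t)) := by
    have ha := ((hK.continuousOn_lap hs) 0 (by simp)).tendsto.mono_left hle
    have hb := (hK.continuousOn_lap_zero 0 (by simp)).tendsto.mono_left hle
    rw [hK.lap_zero_zero] at hb
    have e : lap K 1 0 = ∑' t : ℕ, (t : ℝ) ^ 1 * K t := by simp [lap]
    have := ha.div hb one_ne_zero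
    rw [e, div_one] at this
    exact this
  have h2 : Tendsto (meanGap K) (𝓝[>] 0) (𝓝 (criticalDensity P T)⁻¹) := by
    have hl : Tendsto (logLap K) (𝓝[>] 0) (𝓝[>] 0) := by
      refine tendsto_nhdsWithin_iff.2 ⟨?_, ?_⟩
      · have := (hK.continuousOn_logLap 0 (by simp)).tendsto.mono_left hle
        rwa [hK.logLap_zero] at this
      · filter_upwards [self_mem_nhdsWithin] with φ hφ using (hT.freeEnergy_logLap hreg hφ).1
    refine (((hT.tendsto_contactDensity hreg).comp hl).inv₀ hc.ne').congr' ?_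
    filter_upwards [self_mem_nhdsWithin] with φ hφ
    obtain ⟨h3, h4⟩ := hT.freeEnergy_logLap hreg hφ
    rw [Function.comp_apply, hT.contactDensity_eq hreg h3, h4, inv_inv]
  have h3 := hs.hasSum
  rw [tendsto_nhds_unique h1 h2] at h3
  simpa using h3

end WellDefined

/-! ### Fourier inversion and decay of characteristic functions -/

/-- The characteristic function of a law on the naturals. -/
noncomputable def charf (q : ℕ → ℝ) (θ : ℝ) : ℂ :=
  ∑' t : ℕ, (q t : ℂ) * Complex.exp (θ * Complex.I) ^ t

theorem integral_cos_intCast_mul {k : ℤ} (hk : k ≠ 0) :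
    ∫ θ in (-Real.pi)..Real.pi, Real.cos (k * θ) = 0 := by
  have hk' : (k : ℝ) ≠ 0 := Int.cast_ne_zero.2 hk
  rw [intervalIntegral.integral_comp_mul_left (fun x => Real.cos x) hk', integral_cos]
  rw [show (k : ℝ) * -Real.pi = -(k * Real.pi) by ring, Real.sin_neg, Real.sin_int_mul_pi]
  simp

section Fourier

variable {q : ℕ → ℝ} (hq : ∀ t, 0 ≤ q t) (hq1 : HasSum q 1)
include hq hq1

theorem re_charf_pow (l n : ℕ) (θ : ℝ) :
    HasSum (fun m : ℕ => convPow q l m * Real.cos ((m - n : ℤ) * θ))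
      (charf q θ ^ l * Complex.exp (-(n * θ : ℝ) * Complex.I)).re := by
  obtain ⟨h1, h2⟩ := hasSum_convPow_mul_pow hq hq1.summable (z := Complex.exp (θ * Complex.I))
    (by rw [Complex.norm_exp_ofReal_mul_I]) l
  have h3 := h1.of_norm.hasSum.mul_right (Complex.exp (-(n * θ : ℝ) * Complex.I))
  rw [h2] at h3
  refine (Complex.hasSum_re h3).congr_fun fun m => ?_
  rw [← Complex.exp_nat_mul, mul_assoc, ← Complex.exp_add, Complex.re_ofReal_mul,
    ← Complex.exp_ofReal_mul_I_re]
  congr 3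
  push_cast
  ring

theorem integral_charf_pow (l n : ℕ) :
    ∫ θ in (-Real.pi)..Real.pi, (charf q θ ^ l * Complex.exp (-(n * θ : ℝ) * Complex.I)).re =
      2 * Real.pi * convPow q l n := by
  have hs := hasSum_convPow hq hq1.summable l
  have h1 := intervalIntegral.hasSum_integral_of_dominated_convergence (μ := volume)
    (a := -Real.pi) (b := Real.pi)
    (F := fun (m : ℕ) (θ : ℝ) => convPow q l m * Real.cos ((m - n : ℤ) * θ))
    (f := fun θ => (charf q θ ^ l * Complex.exp (-(n * θ : ℝ) * Complex.I)).re)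
    (fun m _ => convPow q l m) (fun m => by
      refine Continuous.aestronglyMeasurable ?_
      fun_prop) (fun m => Eventually.of_forall fun θ _ => by
      rw [norm_mul, Real.norm_of_nonneg (convPow_nonneg hq _ _)]
      exact mul_le_of_le_one_right (convPow_nonneg hq _ _) (Real.abs_cos_le_one _))
    (Eventually.of_forall fun θ _ => hs.summable) (by simp)
    (Eventually.of_forall fun θ _ => re_charf_pow hq hq1 l n θ)
  rw [← h1.tsum_eq, tsum_eq_single n]
  · have e : ∀ θ : ℝ, convPow q l n * Real.cos ((n - n : ℤ) * θ) = convPow q l n := by simp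
    simp only [e, intervalIntegral.integral_const, smul_eq_mul]
    ring
  · intro m hm
    rw [intervalIntegral.integral_const_mul, integral_cos_intCast_mul, mul_zero]
    omega

/-- Split off mass `c` at each of `1` and `2`. These two atoms contribute modulus `2 c cos(θ / 2)`
and the rest at most `1 - 2 c`; the quadratic bound on the cosine gives Gaussian decay on all of
`[-π, π]`. -/
theorem norm_charf_le {c : ℝ} (hc1 : c ≤ q 1) (hc2 : c ≤ q 2) (hc0 : 0 < c) {θ : ℝ}
    (hθ : |θ| ≤ Real.pi) : ‖charf q θ‖ ≤ Real.exp (-(c / Real.pi ^ 2) * θ ^ 2) := by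
  set z := Complex.exp (θ * Complex.I) with hz
  have hz1 : ‖z‖ = 1 := Complex.norm_exp_ofReal_mul_I θ
  set r : ℕ → ℝ := fun t => q t - (({1, 2} : Set ℕ).indicator (fun _ => c) t) with hr
  have hr0 : ∀ t, 0 ≤ r t := by
    intro t
    by_cases h1 : t = 1
    · simp [hr, h1, hc1]
    · by_cases h2 : t = 2
      · simp [hr, h2, hc2]
      · simp [hr, h1, h2, hq t]
  have hind : ∀ w : ℂ, HasSum (fun t => ((({1, 2} : Set ℕ).indicator (fun _ => c) t : ℝ) : ℂ) * w ^ t)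
      (c * w + c * w ^ 2) := by
    intro w
    have := hasSum_sum_of_ne_finset_zero (L := .unconditional ℕ)
      (f := fun t => ((({1, 2} : Set ℕ).indicator (fun _ => c) t : ℝ) : ℂ) * w ^ t)
      (s := ({1, 2} : Finset ℕ)) (by
        intro t ht
        have : t ∉ ({1, 2} : Set ℕ) := by simpa using ht
        simp [indicator_of_notMem this])
    simpa using this
  have hqs : Summable fun t => (q t : ℂ) * z ^ t := by
    refine Summable.of_norm_bounded hq1.summable fun t => ?_
    rw [norm_mul, norm_pow, hz1, one_pow, mul_one, Complex.norm_real, Real.norm_of_nonneg (hq t)]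
  have hrz : HasSum (fun t => (r t : ℂ) * z ^ t) (charf q θ - (c * z + c * z ^ 2)) := by
    refine (hqs.hasSum.sub (hind z)).congr_fun fun t => ?_
    rw [hr]; push_cast; ring
  have hr1 : HasSum r (1 - (c + c)) := by
    have h1 := hind 1
    simp only [one_pow, mul_one] at h1
    have h2 : HasSum (({1, 2} : Set ℕ).indicator (fun _ => c)) (c + c) := by
      rw [← Complex.hasSum_ofReal]; push_cast; exact h1
    exact hq1.sub h2
  have hnr : ‖charf q θ - (c * z + c * z ^ 2)‖ ≤ 1 - (c + c) := by
    rw [← hrz.tsum_eq]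
    refine tsum_of_norm_bounded hr1 fun t => ?_
    rw [norm_mul, norm_pow, hz1, one_pow, mul_one, Complex.norm_real, Real.norm_of_nonneg (hr0 t)]
  have hcos : ‖(c : ℂ) * z + c * z ^ 2‖ = 2 * c * Real.cos (θ / 2) := by
    have e1 : (c : ℂ) * z + c * z ^ 2 = c * (2 * Complex.cos (θ / 2)) *
        Complex.exp ((3 * θ / 2 : ℝ) * Complex.I) := by
      rw [Complex.two_cos, mul_assoc, add_mul, ← Complex.exp_add, ← Complex.exp_add, hz,
        ← Complex.exp_nat_mul, ← mul_add, add_comm]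
      push_cast
      ring_nf
    have hpos : 0 ≤ Real.cos (θ / 2) := Real.cos_nonneg_of_mem_Icc (by
      have := abs_le.1 hθ
      constructor <;> linarith)
    rw [e1, norm_mul, Complex.norm_exp_ofReal_mul_I, mul_one, norm_mul, norm_mul,
      show (θ : ℂ) / 2 = ((θ / 2 : ℝ) : ℂ) by push_cast; rfl, ← Complex.ofReal_cos,
      Complex.norm_real, Complex.norm_real, Real.norm_of_nonneg hc0.le, Real.norm_of_nonneg hpos]
    simp; ring
  have hcl := Real.cos_le_one_sub_mul_cos_sq (x := θ / 2) (by
    rw [abs_div, abs_two]; linarith [abs_nonneg θ])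
  calc ‖charf q θ‖ = ‖(charf q θ - (c * z + c * z ^ 2)) + (c * z + c * z ^ 2)‖ := by
        rw [sub_add_cancel]
    _ ≤ (1 - (c + c)) + 2 * c * Real.cos (θ / 2) := by
        rw [← hcos]; exact (norm_add_le _ _).trans (add_le_add_left hnr _)
    _ ≤ (1 - (c + c)) + 2 * c * (1 - 2 / Real.pi ^ 2 * (θ / 2) ^ 2) := by gcongr
    _ = -(c / Real.pi ^ 2) * θ ^ 2 + 1 := by field_simp; ring
    _ ≤ _ := Real.add_one_le_exp _

end Fourier

/-! ### Uniform local limit bounds -/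

theorem norm_exp_mul_I_sub_le (x : ℝ) :
    ‖Complex.exp (x * Complex.I) - (1 + x * Complex.I - x ^ 2 / 2)‖ ≤ 4 * |x| ^ 3 := by
  rcases le_total |x| 1 with h | h
  · have h1 : ‖(x : ℂ) * Complex.I‖ = |x| := by simp
    have h2 := Complex.exp_bound (x := (x : ℂ) * Complex.I) (by rw [h1]; exact h) (n := 3)
      (by norm_num)
    rw [h1] at h2
    have e : ∑ m ∈ Finset.range 3, ((x : ℂ) * Complex.I) ^ m / (m.factorial : ℂ) =
        1 + x * Complex.I - x ^ 2 / 2 := by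
      simp [Finset.sum_range_succ, mul_pow, Complex.I_sq]
      ring
    rw [e] at h2
    refine h2.trans ?_
    norm_num [Nat.factorial]
    nlinarith [pow_nonneg (abs_nonneg x) 3]
  · have h1 : ‖Complex.exp (x * Complex.I) - (1 + x * Complex.I - x ^ 2 / 2)‖ ≤
        1 + (1 + |x| + |x| ^ 2 / 2) := by
      refine (norm_sub_le _ _).trans ?_
      rw [Complex.norm_exp_ofReal_mul_I]
      gcongr
      refine (norm_sub_le _ _).trans ?_
      gcongr
      · refine (norm_add_le _ _).trans ?_
        simp
      · simp
    refine h1.trans ?_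
    nlinarith [pow_le_pow_left₀ zero_le_one h 2, pow_le_pow_left₀ zero_le_one h 3,
      mul_nonneg (abs_nonneg x) (sub_nonneg.2 h), mul_nonneg (sq_nonneg |x|) (sub_nonneg.2 h)]

theorem norm_pow_sub_pow_le_mul {a b : ℂ} (ha : ‖a‖ ≤ 1) (hb : ‖b‖ ≤ 1) (l : ℕ) :
    ‖a ^ l - b ^ l‖ ≤ l * ‖a - b‖ := by
  induction l with
  | zero => simp
  | succ l ih =>
    have e : a ^ (l + 1) - b ^ (l + 1) = (a - b) * a ^ l + b * (a ^ l - b ^ l) := by ring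
    rw [e]
    refine (norm_add_le _ _).trans ?_
    rw [norm_mul, norm_mul, norm_pow]
    have h1 : ‖a - b‖ * ‖a‖ ^ l ≤ ‖a - b‖ :=
      mul_le_of_le_one_right (norm_nonneg _) (pow_le_one₀ (norm_nonneg _) ha)
    have h2 : ‖b‖ * ‖a ^ l - b ^ l‖ ≤ ‖a ^ l - b ^ l‖ :=
      mul_le_of_le_one_left (norm_nonneg _) hb
    push_cast
    linarith

/-- A law with mean `m`, third absolute central moment at most `V` and at least `c` of mass on
each of `1` and `2`. -/
structure IsControlledLaw (c V : ℝ) (q : ℕ → ℝ) (m : ℝ) : Prop where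
  nonneg : ∀ t, 0 ≤ q t
  hasSum : HasSum q 1
  one : c ≤ q 1
  two : c ≤ q 2
  mean : HasSum (fun t : ℕ => q t * ((t : ℝ) - m)) 0
  third : ∃ v ≤ V, HasSum (fun t : ℕ => q t * |(t : ℝ) - m| ^ 3) v

section LocalLimit

variable {c V : ℝ} {q : ℕ → ℝ} {m : ℝ}

theorem IsControlledLaw.exists_variance (h : IsControlledLaw c V q m) :
    ∃ s, 0 ≤ s ∧ s ≤ 1 + V ∧ HasSum (fun t : ℕ => q t * ((t : ℝ) - m) ^ 2) s := by
  obtain ⟨v, hv, hs⟩ := h.third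
  have hle : ∀ t : ℕ, q t * ((t : ℝ) - m) ^ 2 ≤ q t + q t * |(t : ℝ) - m| ^ 3 := by
    intro t
    rw [← mul_one_add, ← sq_abs]
    refine mul_le_mul_of_nonneg_left ?_ (h.nonneg t)
    rcases le_total |(t : ℝ) - m| 1 with h1 | h1
    · nlinarith [abs_nonneg ((t : ℝ) - m), pow_nonneg (abs_nonneg ((t : ℝ) - m)) 3]
    · nlinarith [mul_nonneg (sq_nonneg |(t : ℝ) - m|) (sub_nonneg.2 h1)]
  have hnn : ∀ t : ℕ, 0 ≤ q t * ((t : ℝ) - m) ^ 2 := fun t => mul_nonneg (h.nonneg t) (sq_nonneg _)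
  have hsum := (h.hasSum.add hs).summable.of_nonneg_of_le hnn hle
  refine ⟨_, hsum.hasSum.nonneg hnn, ?_, hsum.hasSum⟩
  exact (hasSum_le hle hsum.hasSum (h.hasSum.add hs)).trans (by linarith)

/-- Taylor expansion under the sum: centring kills the linear term, and the cubic remainder is paid
for by the third absolute moment. -/
theorem IsControlledLaw.norm_centered_sub_le (h : IsControlledLaw c V q m) {s : ℝ}
    (hs : HasSum (fun t : ℕ => q t * ((t : ℝ) - m) ^ 2) s) (θ : ℝ) :
    ‖charf q θ * Complex.exp (-(m * θ : ℝ) * Complex.I) - ((1 - s * θ ^ 2 / 2 : ℝ) : ℂ)‖ ≤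
      4 * V * |θ| ^ 3 := by
  obtain ⟨v, hv, hthird⟩ := h.third
  have hqs : Summable fun t => (q t : ℂ) * Complex.exp (θ * Complex.I) ^ t := by
    refine Summable.of_norm_bounded h.hasSum.summable fun t => ?_
    rw [norm_mul, norm_pow, Complex.norm_exp_ofReal_mul_I, one_pow, mul_one, Complex.norm_real,
      Real.norm_of_nonneg (h.nonneg t)]
  have h1 : HasSum (fun t : ℕ => (q t : ℂ) * Complex.exp ((((t : ℝ) - m) * θ : ℝ) * Complex.I))
      (charf q θ * Complex.exp (-(m * θ : ℝ) * Complex.I)) := by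
    refine (hqs.hasSum.mul_right _).congr_fun fun t => ?_
    rw [← Complex.exp_nat_mul, mul_assoc, ← Complex.exp_add]
    congr 2
    push_cast
    ring
  have h2 : HasSum (fun t : ℕ => (q t : ℂ) * (1 + (((t : ℝ) - m) * θ : ℝ) * Complex.I -
      ((((t : ℝ) - m) * θ : ℝ) : ℂ) ^ 2 / 2)) ((1 - s * θ ^ 2 / 2 : ℝ) : ℂ) := by
    have ha := Complex.hasSum_ofReal.2 h.hasSum
    have hb := (Complex.hasSum_ofReal.2 h.mean).mul_right (θ * Complex.I)
    have hc := (Complex.hasSum_ofReal.2 hs).mul_right ((θ : ℂ) ^ 2 / 2)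
    have hd := (ha.add hb).sub hc
    have e : ((1 : ℝ) : ℂ) + ((0 : ℝ) : ℂ) * (θ * Complex.I) - (s : ℂ) * ((θ : ℂ) ^ 2 / 2) =
        ((1 - s * θ ^ 2 / 2 : ℝ) : ℂ) := by push_cast; ring
    rw [e] at hd
    refine hd.congr_fun fun t => ?_
    push_cast
    ring
  have h3 := h1.sub h2
  rw [← h3.tsum_eq]
  have h4 : HasSum (fun t : ℕ => q t * |(t : ℝ) - m| ^ 3 * (4 * |θ| ^ 3)) (v * (4 * |θ| ^ 3)) :=
    hthird.mul_right _
  refine (tsum_of_norm_bounded h4 fun t => ?_).trans ?_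
  · rw [← mul_sub, norm_mul, Complex.norm_real, Real.norm_of_nonneg (h.nonneg t), mul_assoc]
    refine mul_le_mul_of_nonneg_left ?_ (h.nonneg t)
    refine (norm_exp_mul_I_sub_le _).trans (le_of_eq ?_)
    rw [abs_mul, mul_pow]; ring
  · have : 0 ≤ 4 * |θ| ^ 3 := by positivity
    nlinarith

theorem integral_exp_neg_mul_sq_le {b : ℝ} (hb : 0 < b) :
    ∫ θ in (-Real.pi)..Real.pi, Real.exp (-b * θ ^ 2) ≤ √(Real.pi / b) := by
  rw [intervalIntegral.integral_of_le (by linarith [Real.pi_pos]), ← integral_gaussian]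
  exact setIntegral_le_integral (integrable_exp_neg_mul_sq hb)
    (Eventually.of_forall fun θ => Real.exp_nonneg _)

theorem intervalIntegrable_indicator_Icc (b k x y : ℝ) :
    IntervalIntegrable ((Icc (-b) b).indicator fun _ => k) volume x y :=
  intervalIntegrable_iff.2 (IntegrableOn.indicator (integrableOn_const (by simp))
    measurableSet_Icc)

theorem integral_indicator_Icc {b k : ℝ} (hb : 0 ≤ b) (hb' : b < Real.pi) :
    ∫ θ in (-Real.pi)..Real.pi, (Icc (-b) b).indicator (fun _ => k) θ = 2 * b * k := by
  have hsub : Icc (-b) b ⊆ Ioc (-Real.pi) Real.pi := fun x hx =>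
    ⟨by linarith [hx.1], by linarith [hx.2]⟩
  rw [intervalIntegral.integral_of_le (by linarith [Real.pi_pos]),
    integral_indicator_const _ measurableSet_Icc, measureReal_restrict_apply measurableSet_Icc,
    inter_eq_left.2 hsub,
    Real.volume_real_Icc_of_le (by linarith), smul_eq_mul]
  ring

theorem IsControlledLaw.continuous_charf (h : IsControlledLaw c V q m) : Continuous (charf q) := by
  unfold charf
  refine continuous_tsum (fun t => by fun_prop) h.hasSum.summable fun t θ => ?_
  rw [norm_mul, norm_pow, Complex.norm_exp_ofReal_mul_I, one_pow, mul_one, Complex.norm_real,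
    Real.norm_of_nonneg (h.nonneg t)]

theorem IsControlledLaw.norm_charf_pow_le (h : IsControlledLaw c V q m) (hc : 0 < c) (l : ℕ)
    {θ : ℝ} (hθ : |θ| ≤ Real.pi) :
    ‖charf q θ ^ l‖ ≤ Real.exp (-(c / Real.pi ^ 2 * l) * θ ^ 2) := by
  rw [norm_pow]
  refine (pow_le_pow_left₀ (norm_nonneg _) (norm_charf_le h.nonneg h.hasSum h.one h.two hc hθ)
    l).trans (le_of_eq ?_)
  rw [← Real.exp_nat_mul]
  ring_nf

theorem IsControlledLaw.two_pi_mul_convPow_le (h : IsControlledLaw c V q m) (hc : 0 < c) {l : ℕ}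
    (hl : 1 ≤ l) (n : ℕ) :
    2 * Real.pi * convPow q l n ≤ √(Real.pi / (c / Real.pi ^ 2)) / √l := by
  have hcont := h.continuous_charf
  rw [← integral_charf_pow h.nonneg h.hasSum l n, ← Real.sqrt_div' _ (Nat.cast_nonneg l), div_div]
  have hl' : (0 : ℝ) < l := by exact_mod_cast hl
  refine le_trans ?_ (integral_exp_neg_mul_sq_le (b := c / Real.pi ^ 2 * l) (by positivity))
  refine intervalIntegral.integral_mono_on (by linarith [Real.pi_pos])
    (Continuous.intervalIntegrable (by fun_prop) _ _)
    (Continuous.intervalIntegrable (by fun_prop) _ _) fun θ hθ => ?_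
  refine (Complex.re_le_norm _).trans ?_
  rw [norm_mul, ← Complex.ofReal_neg, Complex.norm_exp_ofReal_mul_I, mul_one]
  exact h.norm_charf_pow_le hc l (abs_le.2 hθ)

/-- The Fourier lower bound at the mean, for frequency cut-offs `b ≤ a`. -/
theorem IsControlledLaw.le_two_pi_mul_convPow (h : IsControlledLaw c V q m) (hc : 0 < c)
    (hV : 0 ≤ V) {l n : ℕ} (hl : 1 ≤ l) (hn : (n : ℝ) = l * m) {a b : ℝ} (hb : 0 ≤ b) (hba : b ≤ a)
    (ha : a < Real.pi) (ha' : (1 + V) * a ^ 2 ≤ 2) (hb' : l * ((1 + V) * b ^ 2) ≤ 1) :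
    b - 2 * a * (l * (4 * V * a ^ 3)) -
      Real.exp (-(c / Real.pi ^ 2 / 2 * l) * a ^ 2) *
        (√(Real.pi / (c / Real.pi ^ 2 / 2)) / √l) ≤ 2 * Real.pi * convPow q l n := by
  have hl' : (0 : ℝ) < l := by exact_mod_cast hl
  have hcont := h.continuous_charf
  obtain ⟨s, hs0, hsV, hs⟩ := h.exists_variance
  rw [← integral_charf_pow h.nonneg h.hasSum l n, ← Real.sqrt_div' _ (Nat.cast_nonneg l)]
  -- Half of the Gaussian exponent provides smallness beyond the cut-off `a`, the other half is
  -- integrated.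
  set κ := c / Real.pi ^ 2 / 2 with hκ
  have hκ0 : 0 < κ := by positivity
  have hI1 := intervalIntegrable_indicator_Icc b (1 / 2) (-Real.pi) Real.pi
  have hI2 := intervalIntegrable_indicator_Icc a (l * (4 * V * a ^ 3)) (-Real.pi) Real.pi
  have hI3 : IntervalIntegrable (fun θ : ℝ => Real.exp (-(κ * l) * a ^ 2) *
      Real.exp (-(κ * l) * θ ^ 2)) volume (-Real.pi) Real.pi :=
    Continuous.intervalIntegrable (by fun_prop) _ _
  have hmono : ∫ θ in (-Real.pi)..Real.pi, ((Icc (-b) b).indicator (fun _ => (1 / 2 : ℝ)) θ -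
      (Icc (-a) a).indicator (fun _ => (l * (4 * V * a ^ 3) : ℝ)) θ -
      Real.exp (-(κ * l) * a ^ 2) * Real.exp (-(κ * l) * θ ^ 2)) ≤
      ∫ θ in (-Real.pi)..Real.pi, (charf q θ ^ l * Complex.exp (-(n * θ : ℝ) * Complex.I)).re := by
    refine intervalIntegral.integral_mono_on (by linarith [Real.pi_pos]) ((hI1.sub hI2).sub hI3)
      (Continuous.intervalIntegrable (by fun_prop) _ _) fun θ hθ => ?_
    have hθ' : |θ| ≤ Real.pi := abs_le.2 hθ
    have hexp : 0 ≤ Real.exp (-(κ * l) * a ^ 2) * Real.exp (-(κ * l) * θ ^ 2) := by positivity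
    -- For `|θ| ≤ a` the integrand is the real part of the `l`-th power of the centred
    -- characteristic function, since `n = l * m`. That power is close to `(1 - s θ² / 2) ^ l`,
    -- which is nonnegative, and at least `1 / 2` for `|θ| ≤ b` by Bernoulli's inequality.
    by_cases hθa : |θ| ≤ a
    · rw [indicator_of_mem (show θ ∈ Icc (-a) a from abs_le.1 hθa)]
      have hsq : θ ^ 2 ≤ a ^ 2 := by rw [← sq_abs]; gcongr
      have hy0 : 0 ≤ s * θ ^ 2 / 2 := by positivity
      have hy1 : s * θ ^ 2 / 2 ≤ 1 := by
        have : s * θ ^ 2 ≤ (1 + V) * a ^ 2 := by gcongr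
        linarith
      have hpow : charf q θ ^ l * Complex.exp (-(n * θ : ℝ) * Complex.I) =
          (charf q θ * Complex.exp (-(m * θ : ℝ) * Complex.I)) ^ l := by
        rw [mul_pow, ← Complex.exp_nat_mul, hn]
        congr 2
        push_cast
        ring
      rw [hpow]
      set g := charf q θ * Complex.exp (-(m * θ : ℝ) * Complex.I) with hg
      have hg1 : ‖g‖ ≤ 1 := by
        rw [hg, norm_mul, ← Complex.ofReal_neg, Complex.norm_exp_ofReal_mul_I, mul_one]
        refine (norm_charf_le h.nonneg h.hasSum h.one h.two hc hθ').trans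
          (Real.exp_le_one_iff.2 ?_)
        have : 0 ≤ c / Real.pi ^ 2 * θ ^ 2 := by positivity
        linarith
      have hy2 : ‖((1 - s * θ ^ 2 / 2 : ℝ) : ℂ)‖ ≤ 1 := by
        rw [Complex.norm_real, Real.norm_eq_abs, abs_le]
        constructor <;> linarith
      have hd := (norm_pow_sub_pow_le_mul hg1 hy2 l).trans
        (mul_le_mul_of_nonneg_left (h.norm_centered_sub_le hs θ) hl'.le)
      have hd' : (l : ℝ) * (4 * V * |θ| ^ 3) ≤ l * (4 * V * a ^ 3) := by gcongr
      have hre := (Complex.abs_re_le_norm _).trans (hd.trans hd')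
      rw [Complex.sub_re, ← Complex.ofReal_pow, Complex.ofReal_re] at hre
      have hre' := (abs_le.1 hre).1
      have hind : (Icc (-b) b).indicator (fun _ => (1 / 2 : ℝ)) θ ≤ (1 - s * θ ^ 2 / 2) ^ l := by
        by_cases hθb : θ ∈ Icc (-b) b
        · rw [indicator_of_mem hθb]
          have hber := one_add_mul_le_pow (a := -(s * θ ^ 2 / 2)) (by linarith) l
          have hsb : θ ^ 2 ≤ b ^ 2 := by exact sq_le_sq.2 ((abs_le.2 hθb).trans (le_abs_self b))
          have : (l : ℝ) * (s * θ ^ 2) ≤ l * ((1 + V) * b ^ 2) := by gcongr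
          rw [← sub_eq_add_neg] at hber
          linarith
        · rw [indicator_of_notMem hθb]
          exact pow_nonneg (by linarith) l
      linarith
    · have hθa' : θ ∉ Icc (-a) a := fun hh => hθa (abs_le.2 hh)
      have hθb' : θ ∉ Icc (-b) b := fun hh => hθa ((abs_le.2 hh).trans hba)
      rw [indicator_of_notMem hθa', indicator_of_notMem hθb']
      have h0 : ‖charf q θ ^ l * Complex.exp (-(n * θ : ℝ) * Complex.I)‖ ≤
          Real.exp (-(c / Real.pi ^ 2 * l) * θ ^ 2) := by
        rw [norm_mul, ← Complex.ofReal_neg, Complex.norm_exp_ofReal_mul_I, mul_one]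
        exact h.norm_charf_pow_le hc l hθ'
      have h1 := neg_le_of_abs_le ((Complex.abs_re_le_norm _).trans h0)
      have h2 : Real.exp (-(c / Real.pi ^ 2 * l) * θ ^ 2) ≤
          Real.exp (-(κ * l) * a ^ 2) * Real.exp (-(κ * l) * θ ^ 2) := by
        rw [← Real.exp_add, Real.exp_le_exp]
        have hsq : a ^ 2 ≤ θ ^ 2 := by
          rw [← sq_abs θ]
          exact pow_le_pow_left₀ (hb.trans hba) (not_le.1 hθa).le 2
        have : κ * l * a ^ 2 ≤ κ * l * θ ^ 2 := by gcongr
        have e : c / Real.pi ^ 2 = κ + κ := by rw [hκ]; ring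
        rw [e]
        linarith
      linarith
  refine le_trans ?_ hmono
  rw [intervalIntegral.integral_sub (hI1.sub hI2) hI3, intervalIntegral.integral_sub hI1 hI2,
    integral_indicator_Icc hb (by linarith), integral_indicator_Icc (hb.trans hba) ha,
    intervalIntegral.integral_const_mul]
  have := mul_le_mul_of_nonneg_left (integral_exp_neg_mul_sq_le (b := κ * l) (by positivity))
    (Real.exp_nonneg (-(κ * l) * a ^ 2))
  rw [← div_div] at this
  linarith

/-- Local limit bounds, uniform over controlled laws. -/
theorem exists_local_limit_bounds (hc : 0 < c) (hV : 0 ≤ V) : ∃ D : ℝ, 0 < D ∧ ∃ l₀ : ℕ,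
    ∀ (q : ℕ → ℝ) (m : ℝ), IsControlledLaw c V q m →
      (∀ l n : ℕ, 1 ≤ l → convPow q l n ≤ D / √l) ∧
      (∀ l n : ℕ, 1 ≤ l → l₀ ≤ l → (n : ℝ) = l * m → 1 / (D * √l) ≤ convPow q l n) := by
  set κ := c / Real.pi ^ 2 / 2 with hκ
  have hκ0 : 0 < κ := by positivity
  set B : ℝ := 1 / (1 + V) with hB
  have hB0 : 0 < B := by positivity
  have hB1 : B ≤ 1 := by rw [hB, div_le_one (by positivity)]; linarith
  set G := √(Real.pi / κ) with hG
  -- The cut-offs are `a = M / √l` and `b = B / √l`. The main term is `B / √l`; `M` is chosen so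
  -- that the frequencies beyond `a` cost at most a quarter of it, and `l₀` so that the Taylor error
  -- costs at most another quarter.
  obtain ⟨M, hM1, hM2⟩ : ∃ M : ℝ, 1 ≤ M ∧ Real.exp (-κ * M ^ 2) * G ≤ B / 4 := by
    have h1 : Tendsto (fun M : ℝ => Real.exp (-κ * M ^ 2) * G) atTop (𝓝 (0 * G)) := by
      refine Tendsto.mul_const _ (Real.tendsto_exp_atBot.comp ?_)
      exact (tendsto_pow_atTop two_ne_zero).const_mul_atTop_of_neg (neg_lt_zero.2 hκ0)
    rw [zero_mul] at h1
    exact ((eventually_ge_atTop 1).and (h1.eventually_le_const (by positivity))).exists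
  have hsq : Tendsto (fun l : ℕ => √(l : ℝ)) atTop atTop :=
    Real.tendsto_sqrt_atTop.comp tendsto_natCast_atTop_atTop
  obtain ⟨l₀, hl₀⟩ := eventually_atTop.1 ((hsq.eventually_ge_atTop
    (max (M + (1 + V) * M) (32 * V * M ^ 4 / B))))
  set D := max (√(Real.pi / (c / Real.pi ^ 2)) / (2 * Real.pi)) (4 * Real.pi / B) with hD
  have hD0 : 0 < D := lt_of_lt_of_le (by positivity) (le_max_right _ _)
  refine ⟨D, hD0, l₀, fun q m h => ⟨fun l n hl => ?_, fun l n hl hll hn => ?_⟩⟩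
  · have h1 := h.two_pi_mul_convPow_le hc hl n
    have hl' : 0 < √(l : ℝ) := Real.sqrt_pos.2 (by exact_mod_cast hl)
    have h2 : convPow q l n ≤ √(Real.pi / (c / Real.pi ^ 2)) / (2 * Real.pi) / √l := by
      rw [div_div, mul_comm (2 * Real.pi), ← div_div, le_div_iff₀ (by positivity)]
      linarith
    exact h2.trans (div_le_div_of_nonneg_right (le_max_left _ _) hl'.le)
  · have hl' : (0 : ℝ) < l := by exact_mod_cast hl
    set r := √(l : ℝ) with hr
    have hr0 : 0 < r := Real.sqrt_pos.2 hl'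
    have hrr : r ^ 2 = l := Real.sq_sqrt hl'.le
    have hlarge := hl₀ l hll
    have hr1 : M + (1 + V) * M ≤ r := (le_max_left _ _).trans hlarge
    have hr2 : 32 * V * M ^ 4 / B ≤ r := (le_max_right _ _).trans hlarge
    have hMr : M / r ≤ 1 := by rw [div_le_one hr0]; nlinarith
    have key := h.le_two_pi_mul_convPow hc hV hl hn (a := M / r) (b := B / r) (by positivity)
      (div_le_div_of_nonneg_right (hB1.trans hM1) hr0.le)
      (by linarith [Real.pi_gt_three]) ?_ ?_
    · rw [← hκ, ← hG, ← hr] at key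
      have e1 : -(κ * l) * (M / r) ^ 2 = -κ * M ^ 2 := by
        rw [← hrr]; field_simp
      have e2 : 2 * (M / r) * (l * (4 * V * (M / r) ^ 3)) = 8 * V * M ^ 4 / r / r := by
        rw [← hrr]; field_simp; ring
      rw [e1, e2] at key
      have h3 : 8 * V * M ^ 4 / r / r ≤ B / 4 / r := by
        refine div_le_div_of_nonneg_right ?_ hr0.le
        rw [div_le_iff₀ hB0] at hr2
        rw [div_le_iff₀ hr0]
        linarith
      have h4 : Real.exp (-κ * M ^ 2) * (G / r) ≤ B / 4 / r := by
        rw [← mul_div_assoc]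
        exact div_le_div_of_nonneg_right hM2 hr0.le
      have h5 : B / 2 / r ≤ 2 * Real.pi * convPow q l n := by
        have : B / 2 / r = B / r - B / 4 / r - B / 4 / r := by ring
        linarith
      have h6 : 1 / (D * r) ≤ 1 / (4 * Real.pi / B * r) := by
        refine one_div_le_one_div_of_le (by positivity) ?_
        exact mul_le_mul_of_nonneg_right (le_max_right _ _) hr0.le
      refine h6.trans ?_
      have h7 : 1 / (4 * Real.pi / B * r) = B / 2 / r / (2 * Real.pi) := by field_simp; ring
      rw [h7, div_le_iff₀ (by positivity)]
      linarith
    · have : (1 + V) * (M / r) ^ 2 = ((1 + V) * M / r) * (M / r) := by ring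
      rw [this]
      have h8 : (1 + V) * M / r ≤ 1 := by rw [div_le_one hr0]; linarith
      have : (1 + V) * M / r * (M / r) ≤ 1 * 1 := by gcongr
      linarith
    · rw [div_pow, hrr, hB]
      field_simp
      linarith

end LocalLimit

/-! ### Tilting invariance and uniform control of tilted laws -/

/-- The exponentially tilted law. -/
noncomputable def tiltLaw (K : ℕ → ℝ) (φ : ℝ) (t : ℕ) : ℝ :=
  (lap K 0 φ)⁻¹ * (K t * Real.exp (-φ * t))

/-- The union bound for the probability that the largest of `l + 1` steps with sum `n` is less than
`b` or lies in `G`. -/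
noncomputable def exceptionalRatio (K : ℕ → ℝ) (b : ℕ) (G : Set ℕ) (l n : ℕ) : ℝ :=
  (convPow ((Iio b).indicator K) (l + 1) n + (l + 1) *
    ∑ p ∈ Finset.HasAntidiagonal.antidiagonal n, G.indicator K p.1 * convPow K l p.2) /
      convPow K (l + 1) n

section Tilt

variable {K : ℕ → ℝ} (hK : IsStepLaw K)
include hK

omit hK in
theorem convPow_tiltLaw (φ : ℝ) (l n : ℕ) :
    convPow (tiltLaw K φ) l n = (lap K 0 φ)⁻¹ ^ l * (convPow K l n * Real.exp (-φ * n)) :=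
  convPow_tilt _ _ _ _

/-- Each term in numerator and denominator involves `l + 1` steps of total length `n`, so tilting
multiplies all of them by the same factor. -/
theorem IsStepLaw.exceptionalRatio_tiltLaw {φ : ℝ} (hφ : 0 < φ) (b : ℕ) (G : Set ℕ) (l n : ℕ) :
    exceptionalRatio (tiltLaw K φ) b G l n = exceptionalRatio K b G l n := by
  have hL := hK.lap_pos 0 hφ
  have hind : ∀ H : Set ℕ, H.indicator (tiltLaw K φ) =
      fun t : ℕ => (lap K 0 φ)⁻¹ * (H.indicator K t * Real.exp (-φ * t)) := fun H => by
    ext t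
    by_cases ht : t ∈ H <;> simp [ht, tiltLaw]
  set y := (lap K 0 φ)⁻¹ ^ (l + 1) * Real.exp (-φ * n) with hy
  have hy0 : y ≠ 0 := by positivity
  have h1 : convPow ((Iio b).indicator (tiltLaw K φ)) (l + 1) n =
      y * convPow ((Iio b).indicator K) (l + 1) n := by
    rw [hind, convPow_tilt]; ring
  have h2 : ∑ p ∈ Finset.HasAntidiagonal.antidiagonal n,
      G.indicator (tiltLaw K φ) p.1 * convPow (tiltLaw K φ) l p.2 =
      y * ∑ p ∈ Finset.HasAntidiagonal.antidiagonal n, G.indicator K p.1 * convPow K l p.2 := by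
    rw [Finset.mul_sum]
    refine Finset.sum_congr rfl fun p hp => ?_
    have hp' : (n : ℝ) = p.1 + p.2 := by
      exact_mod_cast (Finset.HasAntidiagonal.mem_antidiagonal.1 hp).symm
    rw [convPow_tiltLaw, hind, hy, hp', mul_add, Real.exp_add]
    ring
  have h3 : convPow (tiltLaw K φ) (l + 1) n = y * convPow K (l + 1) n := by
    rw [convPow_tiltLaw]; ring
  rw [exceptionalRatio, exceptionalRatio, h1, h2, h3]
  rw [mul_left_comm, ← mul_add, mul_div_mul_left _ _ hy0]

theorem IsStepLaw.lap_anti (j : ℕ) {a b : ℝ} (ha : 0 < a) (hab : a ≤ b) :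
    lap K j b ≤ lap K j a := by
  refine Summable.tsum_le_tsum (fun t => ?_) (hK.summable_lap j (ha.trans_le hab))
    (hK.summable_lap j ha)
  refine mul_le_mul_of_nonneg_left (Real.exp_le_exp.2 ?_)
    (mul_nonneg (by positivity) (hK.nonneg t))
  have : a * t ≤ b * t := by gcongr
  linarith

theorem IsStepLaw.tiltLaw_nonneg {φ : ℝ} (hφ : 0 < φ) (t : ℕ) : 0 ≤ tiltLaw K φ t :=
  mul_nonneg (inv_nonneg.2 (hK.lap_pos 0 hφ).le) (mul_nonneg (hK.nonneg t) (Real.exp_nonneg _))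

theorem IsStepLaw.hasSum_tiltLaw {φ : ℝ} (hφ : 0 < φ) : HasSum (tiltLaw K φ) 1 := by
  have := (hK.hasSum_lap 0 hφ).mul_left (lap K 0 φ)⁻¹
  rw [inv_mul_cancel₀ (hK.lap_pos 0 hφ).ne'] at this
  exact this.congr_fun fun t => by simp [tiltLaw]

theorem IsStepLaw.le_tiltLaw {φ : ℝ} (hφ : 0 < φ) (t : ℕ) :
    K t * Real.exp (-φ * t) ≤ tiltLaw K φ t := by
  have h1 : lap K 0 φ ≤ 1 := (hK.lap_zero_le hφ.le).trans (Real.exp_le_one_iff.2 (by linarith))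
  exact le_mul_of_one_le_left (mul_nonneg (hK.nonneg t) (Real.exp_nonneg _))
    ((one_le_inv₀ (hK.lap_pos 0 hφ)).2 h1)

/-- Monotonicity in `φ` gives uniform constants: the masses at `1` and `2` are bounded below using
`φ₂`, the third moment above using `φ₁` in the numerator and `φ₂` in the normalisation. -/
theorem IsStepLaw.exists_isControlledLaw {φ₁ φ₂ : ℝ} (h1 : 0 < φ₁) :
    ∃ c V : ℝ, 0 < c ∧ 0 ≤ V ∧ ∀ φ, φ₁ ≤ φ → φ ≤ φ₂ →
      IsControlledLaw c V (tiltLaw K φ) (meanGap K φ) := by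
  rcases lt_or_ge φ₂ φ₁ with h12 | h12
  · exact ⟨1, 0, one_pos, le_rfl, fun φ ha hb => absurd (ha.trans hb) (not_le.2 h12)⟩
  have h2 := h1.trans_le h12
  set M := meanGap K φ₁ with hM
  have hM1 := hK.one_lt_meanGap h1
  have hL2 := hK.lap_pos 0 h2
  have hL3 := hK.lap_pos 3 h1
  refine ⟨min (K 1 * Real.exp (-φ₂ * (1 : ℕ))) (K 2 * Real.exp (-φ₂ * (2 : ℕ))),
    (1 + M) ^ 3 * (lap K 3 φ₁ / lap K 0 φ₂), ?_, by positivity, fun φ ha hb => ?_⟩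
  · have := hK.pos 1 le_rfl
    have := hK.pos 2 (by norm_num)
    positivity
  have hφ := h1.trans_le ha
  have hq := hK.tiltLaw_nonneg hφ
  have hL := hK.lap_pos 0 hφ
  have hlow : ∀ t : ℕ, K t * Real.exp (-φ₂ * t) ≤ tiltLaw K φ t := fun t => by
    refine le_trans (mul_le_mul_of_nonneg_left (Real.exp_le_exp.2 ?_) (hK.nonneg t))
      (hK.le_tiltLaw hφ t)
    have : φ * t ≤ φ₂ * t := by gcongr
    linarith
  have hm1 : 1 < meanGap K φ := hK.one_lt_meanGap hφ
  have hmM : meanGap K φ ≤ M := hK.strictAntiOn_meanGap.antitoneOn h1 hφ ha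
  have h3 : HasSum (fun t : ℕ => (1 + M) ^ 3 * (tiltLaw K φ t * (t : ℝ) ^ 3))
      ((1 + M) ^ 3 * ((lap K 0 φ)⁻¹ * lap K 3 φ)) := by
    refine ((((hK.hasSum_lap 3 hφ).mul_left (lap K 0 φ)⁻¹)).mul_left ((1 + M) ^ 3)).congr_fun
      fun t => ?_
    rw [tiltLaw]; ring
  have hle : ∀ t : ℕ, tiltLaw K φ t * |(t : ℝ) - meanGap K φ| ^ 3 ≤
      (1 + M) ^ 3 * (tiltLaw K φ t * (t : ℝ) ^ 3) := by
    intro t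
    rcases Nat.eq_zero_or_pos t with rfl | ht
    · simp [tiltLaw, hK.zero]
    · have ht' : (1 : ℝ) ≤ t := by exact_mod_cast ht
      have h4 : |(t : ℝ) - meanGap K φ| ≤ (1 + M) * t := by
        rw [abs_le]; constructor <;> nlinarith
      calc tiltLaw K φ t * |(t : ℝ) - meanGap K φ| ^ 3
          ≤ tiltLaw K φ t * ((1 + M) * t) ^ 3 :=
            mul_le_mul_of_nonneg_left (pow_le_pow_left₀ (abs_nonneg _) h4 3) (hq t)
        _ = _ := by ring
  have hs := h3.summable.of_nonneg_of_le
    (fun t => mul_nonneg (hq t) (pow_nonneg (abs_nonneg _) 3)) hle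
  refine ⟨hq, hK.hasSum_tiltLaw hφ, (min_le_left _ _).trans (hlow 1),
    (min_le_right _ _).trans (hlow 2), ?_, _, ?_, hs.hasSum⟩
  · have := ((hK.hasSum_lap 1 hφ).mul_left (lap K 0 φ)⁻¹).sub
      ((hK.hasSum_tiltLaw hφ).mul_right (meanGap K φ))
    have e : (lap K 0 φ)⁻¹ * lap K 1 φ - 1 * meanGap K φ = 0 := by
      unfold meanGap; ring
    rw [e] at this
    refine this.congr_fun fun t => ?_
    rw [tiltLaw]; ring
  · refine (hasSum_le hle hs.hasSum h3).trans ?_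
    rw [inv_mul_eq_div]
    have := hK.lap_anti 3 h1 ha
    have := hK.lap_anti 0 hφ hb
    gcongr

theorem IsStepLaw.sum_tiltLaw_le {φ x : ℝ} (hφ : 0 < φ) {G : Set ℕ} (hG : ∀ t ∈ G, x ≤ (t : ℝ))
    (s : Finset ℕ) :
    ∑ t ∈ s, G.indicator (tiltLaw K φ) t ≤ (lap K 0 φ)⁻¹ * Real.exp (-φ * x) := by
  have hL := hK.lap_pos 0 hφ
  have h1 : ∀ t, G.indicator (tiltLaw K φ) t ≤ K t * ((lap K 0 φ)⁻¹ * Real.exp (-φ * x)) := by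
    intro t
    have := hK.nonneg t
    by_cases ht : t ∈ G
    · rw [indicator_of_mem ht, tiltLaw, mul_left_comm]
      refine mul_le_mul_of_nonneg_left (mul_le_mul_of_nonneg_left (Real.exp_le_exp.2 ?_)
        (by positivity)) this
      have : φ * x ≤ φ * t := mul_le_mul_of_nonneg_left (hG t ht) hφ.le
      linarith
    · rw [indicator_of_notMem ht]
      positivity
  refine (Finset.sum_le_sum fun t _ => h1 t).trans ?_
  have := sum_le_hasSum s (fun t _ => mul_nonneg (hK.nonneg t) (by positivity))
    (hK.hasSum.mul_right ((lap K 0 φ)⁻¹ * Real.exp (-φ * x)))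
  rwa [one_mul] at this

omit hK in
/-- The convolution powers of a law restricted below `b` are exponentially small. -/
theorem convPow_Iio_le {q : ℕ → ℝ} (hq : ∀ t, 0 ≤ q t) (hq1 : HasSum q 1) (b l n : ℕ) :
    convPow ((Iio b).indicator q) l n ≤ Real.exp (-(l * q b)) := by
  have h0 : ∀ t, 0 ≤ (Iio b).indicator q t := fun t => indicator_nonneg (fun t _ => hq t) t
  have hs : Summable ((Iio b).indicator q) := hq1.summable.indicator _
  have h1 : ∑' t, (Iio b).indicator q t ≤ 1 - q b := by
    have h2 : HasSum (({b} : Set ℕ).indicator q) (q b) := by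
      have := hasSum_single (f := ({b} : Set ℕ).indicator q) b fun t ht => by simp [ht]
      simpa using this
    refine hasSum_le (fun t => ?_) hs.hasSum (hq1.sub h2)
    by_cases ht : t < b
    · have : t ≠ b := ht.ne
      simp [ht, this]
    · by_cases htb : t = b
      · simp [htb]
      · simp [ht, htb, hq t]
  calc convPow ((Iio b).indicator q) l n ≤ (∑' t, (Iio b).indicator q t) ^ l := convPow_le h0 hs l n
    _ ≤ Real.exp (-q b) ^ l := by
        refine pow_le_pow_left₀ (tsum_nonneg h0) (h1.trans ?_) l
        linarith [Real.add_one_le_exp (-q b)]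
    _ = _ := by rw [← Real.exp_nat_mul]; ring_nf

end Tilt

/-! ### Largest step under the tilted law -/

section Logarithmic

variable {K : ℕ → ℝ} (hK : IsStepLaw K)
include hK

omit hK in
theorem convPow_Iio_zero (q : ℕ → ℝ) (l n : ℕ) :
    convPow ((Iio 0).indicator q) (l + 1) n = 0 := by
  rw [convPow_succ]
  exact Finset.sum_eq_zero fun p _ => by simp

/-- Below the mean gap at criticality, the largest gap is of order `log n / φ`, uniformly for `φ` in
a compact set. -/
theorem IsStepLaw.exists_exceptionalRatio_le {C : ℝ} {A : ℕ} (hreg : PolynomiallyRegular K C A)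
    {φ₁ φ₂ ε : ℝ} (h1 : 0 < φ₁) (h12 : φ₁ ≤ φ₂) (hε : 0 < ε) :
    ∃ err : ℕ → ℝ, Tendsto err atTop (𝓝 0) ∧ ∀ᶠ n : ℕ in atTop, ∀ (l : ℕ) (φ : ℝ),
      φ₁ ≤ φ → φ ≤ φ₂ → (n : ℝ) = ((l + 1 : ℕ) : ℝ) * meanGap K φ →
      exceptionalRatio K ⌈(1 / φ - ε) * Real.log n⌉₊ {t : ℕ | (1 / φ + ε) * Real.log n < t} l n
        ≤ err n := by
  obtain ⟨c, V, hc, hV, hctrl⟩ := hK.exists_isControlledLaw (φ₂ := φ₂) h1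
  obtain ⟨D, hD, l₀, hloc⟩ := exists_local_limit_bounds hc hV
  have h2 := h1.trans_le h12
  set M := meanGap K φ₁ with hM
  have hM1 : 1 < M := hK.one_lt_meanGap h1
  have hM0 : 0 < M := by linarith
  have hL2 := hK.lap_pos 0 h2
  have hK1 := hK.pos 1 le_rfl
  have hC := hreg.1
  set δ := ε * φ₁ with hδ
  have hδ0 : 0 < δ := by positivity
  set k := K 1 / C * Real.exp (-φ₂) / (M * (1 / φ₁ + 1) ^ A) with hk
  have hk0 : 0 < k := by positivity
  have hlogt : Tendsto (fun n : ℕ => Real.log n) atTop atTop :=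
    Real.tendsto_log_atTop.comp tendsto_natCast_atTop_atTop
  refine ⟨fun n => D / √n + 2 * D ^ 2 * (lap K 0 φ₂)⁻¹ * Real.exp (-δ * Real.log n), ?_, ?_⟩
  · have ha : Tendsto (fun n : ℕ => D / √(n : ℝ)) atTop (𝓝 0) :=
      tendsto_const_nhds.div_atTop (Real.tendsto_sqrt_atTop.comp tendsto_natCast_atTop_atTop)
    have hb : Tendsto (fun n : ℕ => Real.exp (-δ * Real.log n)) atTop (𝓝 0) :=
      Real.tendsto_exp_atBot.comp (hlogt.const_mul_atTop_of_neg (neg_lt_zero.2 hδ0))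
    simpa using ha.add (hb.const_mul (2 * D ^ 2 * (lap K 0 φ₂)⁻¹))
  have hasym : ∀ᶠ n : ℕ in atTop, Real.log n ^ (A + 1) ≤ k * Real.exp (δ * Real.log n) := by
    have := (isLittleO_pow_exp_pos_mul_atTop (k := A + 1) hδ0).bound hk0
    filter_upwards [hlogt.eventually this, hlogt.eventually_ge_atTop 0] with n hn hn0
    rwa [Real.norm_of_nonneg (by positivity), Real.norm_of_nonneg (by positivity)] at hn
  filter_upwards [hasym, hlogt.eventually_ge_atTop 1, eventually_ge_atTop 1,
    tendsto_natCast_atTop_atTop.eventually_ge_atTop ((l₀ + 2 : ℝ) * M)]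
    with n hasymn hX hn1 hnl l φ ha hb hnm
  have hn0 : (0 : ℝ) < n := by exact_mod_cast hn1
  have hφ := h1.trans_le ha
  have hq := hctrl φ ha hb
  have hm1 : 1 < meanGap K φ := hK.one_lt_meanGap hφ
  have hmM : meanGap K φ ≤ M := hK.strictAntiOn_meanGap.antitoneOn h1 hφ ha
  set X := Real.log n with hXdef
  have hexpX : Real.exp X = n := Real.exp_log hn0
  have hln : ((l + 1 : ℕ) : ℝ) ≤ n := by
    rw [hnm]; exact le_mul_of_one_le_right (Nat.cast_nonneg _) hm1.le
  have hnl' : (n : ℝ) ≤ ((l + 1 : ℕ) : ℝ) * M := by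
    rw [hnm]; exact mul_le_mul_of_nonneg_left hmM (Nat.cast_nonneg _)
  have hl2 : l₀ + 2 ≤ l + 1 := by
    have := le_of_mul_le_mul_right (hnl.trans hnl') hM0
    exact_mod_cast this
  set q := tiltLaw K φ with hqdef
  set s := √((l + 1 : ℕ) : ℝ) with hs
  have hs0 : 0 < s := Real.sqrt_pos.2 (by positivity)
  have hlow := (hloc q _ hq).2 (l + 1) n (by omega) (by omega) hnm
  have hlow0 : 0 < 1 / (D * s) := by positivity
  have hcq : 0 < convPow q (l + 1) n := hlow0.trans_le hlow
  have hinv : (convPow q (l + 1) n)⁻¹ ≤ D * s := by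
    rw [← one_div, one_div_le hcq (by positivity)]
    exact hlow
  have hssq : s ^ 2 = ((l + 1 : ℕ) : ℝ) := Real.sq_sqrt (Nat.cast_nonneg _)
  have hsn : s ≤ √(n : ℝ) := Real.sqrt_le_sqrt hln
  rw [← hK.exceptionalRatio_tiltLaw hφ, exceptionalRatio, ← hqdef, add_div]
  refine add_le_add ?_ ?_
  · set b := ⌈(1 / φ - ε) * X⌉₊ with hbdef
    -- The natural ceiling is `0` when `1 / φ ≤ ε`, and then no step can lie below `b`.
    rcases Nat.eq_zero_or_pos b with hb0 | hb0
    · rw [hb0, convPow_Iio_zero, zero_div]; positivity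
    have hbpos : 0 < (1 / φ - ε) * X := Nat.ceil_pos.1 hb0
    have hb0' : (0 : ℝ) < b := by exact_mod_cast hb0
    have hblt : (b : ℝ) ≤ (1 / φ - ε) * X + 1 := (Nat.ceil_lt_add_one hbpos.le).le
    have hbX : (b : ℝ) ≤ (1 / φ₁ + 1) * X := by
      have h3 : 1 / φ ≤ 1 / φ₁ := one_div_le_one_div_of_le h1 ha
      have h4 : (1 / φ - ε) * X ≤ 1 / φ₁ * X := by
        refine mul_le_mul_of_nonneg_right ?_ (by linarith)
        linarith
      linarith
    have hφb : φ * b ≤ X - δ * X + φ₂ := by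
      have h3 : φ * b ≤ φ * ((1 / φ - ε) * X + 1) := mul_le_mul_of_nonneg_left hblt hφ.le
      have h4 : φ * ((1 / φ - ε) * X + 1) = X - ε * φ * X + φ := by field_simp
      have h5 : δ * X ≤ ε * φ * X := by rw [hδ]; gcongr
      linarith
    -- The single value `b` already has tilted mass at least of order `n^(-1+δ)` up to logarithms.
    -- Hence all steps stay below `b` with probability at most `1 / n`, which beats the factor `√n`
    -- from the local lower bound.
    have hqb : X ≤ ((l + 1 : ℕ) : ℝ) * q b := by
      have h3 : K 1 / C / ((1 / φ₁ + 1) * X) ^ A * Real.exp (-(X - δ * X + φ₂)) ≤ q b := by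
        refine le_trans ?_ (hK.le_tiltLaw hφ b)
        refine mul_le_mul ?_ (Real.exp_le_exp.2 (by linarith)) (Real.exp_nonneg _) (hK.nonneg b)
        refine le_trans ?_ (hreg.le_apply hb0)
        gcongr
      have h4 : (n : ℝ) / M ≤ ((l + 1 : ℕ) : ℝ) := by rwa [div_le_iff₀ hM0]
      have h5 : (n : ℝ) / M * (K 1 / C / ((1 / φ₁ + 1) * X) ^ A *
          Real.exp (-(X - δ * X + φ₂))) = k * Real.exp (δ * X) / X ^ A := by
        rw [show -(X - δ * X + φ₂) = -X + (δ * X + -φ₂) by ring, Real.exp_add, Real.exp_add,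
          Real.exp_neg X, hexpX, hk, mul_pow]
        field_simp
      have h6 : X ≤ k * Real.exp (δ * X) / X ^ A := by
        rw [le_div_iff₀ (by positivity), ← pow_succ']
        exact hasymn
      refine h6.trans (h5.symm.le.trans ?_)
      exact mul_le_mul h4 h3 (by positivity) (Nat.cast_nonneg _)
    have hpow := (convPow_Iio_le hq.nonneg hq.hasSum b (l + 1) n).trans
      (Real.exp_le_exp.2 (neg_le_neg hqb))
    rw [Real.exp_neg, hexpX] at hpow
    calc convPow ((Iio b).indicator q) (l + 1) n / convPow q (l + 1) n
        ≤ (n : ℝ)⁻¹ * (D * s) := by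
          rw [div_eq_mul_inv]
          exact mul_le_mul hpow hinv (inv_nonneg.2 hcq.le) (by positivity)
      _ ≤ (n : ℝ)⁻¹ * (D * √(n : ℝ)) := by gcongr
      _ = D / √n := by
          have h7 : √(n : ℝ) ^ 2 = n := Real.sq_sqrt hn0.le
          have h8 : √(n : ℝ) ≠ 0 := (Real.sqrt_pos.2 hn0).ne'
          nth_rw 1 [← h7]
          field_simp
  · set G := {t : ℕ | (1 / φ + ε) * X < t} with hG
    set r := √(l : ℝ) with hr
    have hl1 : 1 ≤ l := by omega
    have hr0 : 0 < r := Real.sqrt_pos.2 (by exact_mod_cast hl1)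
    have hsr : s ≤ 2 * r := by
      have h3 : s ^ 2 ≤ (2 * r) ^ 2 := by
        rw [hssq, mul_pow, hr, Real.sq_sqrt (Nat.cast_nonneg _)]
        have : (1 : ℝ) ≤ l := by exact_mod_cast hl1
        push_cast
        linarith
      exact (pow_le_pow_iff_left₀ hs0.le (by positivity) two_ne_zero).1 h3
    have hGq : ∀ t, 0 ≤ G.indicator q t := fun t => indicator_nonneg (fun t _ => hq.nonneg t) t
    -- A step in `G` has mass at most of order `n^(-1-δ)`. There are at most `n` positions for it,
    -- and the factor `1 / √l` from the other steps offsets the `√(l + 1)` from the denominator.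
    have hsum : ∑ p ∈ Finset.HasAntidiagonal.antidiagonal n, G.indicator q p.1 * convPow q l p.2 ≤
        (lap K 0 φ₂)⁻¹ * Real.exp (-(X + δ * X)) * (D / r) := by
      have h3 : ∑ p ∈ Finset.HasAntidiagonal.antidiagonal n, G.indicator q p.1 * convPow q l p.2 ≤
          ∑ p ∈ Finset.HasAntidiagonal.antidiagonal n, G.indicator q p.1 * (D / r) :=
        Finset.sum_le_sum fun p _ =>
          mul_le_mul_of_nonneg_left ((hloc q _ hq).1 l p.2 hl1) (hGq _)
      refine h3.trans ?_
      rw [← Finset.sum_mul]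
      refine mul_le_mul_of_nonneg_right ?_ (by positivity)
      rw [Finset.Nat.sum_antidiagonal_eq_sum_range_succ_mk]
      refine (hK.sum_tiltLaw_le hφ (x := (1 / φ + ε) * X) (fun t ht => le_of_lt ht) _).trans ?_
      refine mul_le_mul (inv_anti₀ hL2 (hK.lap_anti 0 hφ hb)) (Real.exp_le_exp.2 ?_)
        (Real.exp_nonneg _) (inv_nonneg.2 hL2.le)
      have h4 : φ * ((1 / φ + ε) * X) = X + ε * φ * X := by field_simp
      have h5 : δ * X ≤ ε * φ * X := by rw [hδ]; gcongr
      linarith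
    have hcast : ((l : ℝ) + 1) = s ^ 2 := by rw [hssq]; push_cast; ring
    calc ((l : ℝ) + 1) * (∑ p ∈ Finset.HasAntidiagonal.antidiagonal n,
          G.indicator q p.1 * convPow q l p.2) / convPow q (l + 1) n
        ≤ ((l : ℝ) + 1) * ((lap K 0 φ₂)⁻¹ * Real.exp (-(X + δ * X)) * (D / r)) * (D * s) := by
          rw [div_eq_mul_inv]
          refine mul_le_mul (mul_le_mul_of_nonneg_left hsum (by positivity)) hinv
            (inv_nonneg.2 hcq.le) (by positivity)
      _ = (lap K 0 φ₂)⁻¹ * Real.exp (-(X + δ * X)) * D ^ 2 * (s / r) * s ^ 2 := by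
          rw [hcast]; ring
      _ ≤ (lap K 0 φ₂)⁻¹ * Real.exp (-(X + δ * X)) * D ^ 2 * 2 * n := by
          have h6 : s / r ≤ 2 := by rwa [div_le_iff₀ hr0]
          have h7 : s ^ 2 ≤ n := by rw [hssq]; exact hln
          gcongr
      _ = 2 * D ^ 2 * (lap K 0 φ₂)⁻¹ * Real.exp (-δ * X) := by
          rw [show -(X + δ * X) = -X + -δ * X by ring, Real.exp_add, Real.exp_neg X, hexpX]
          field_simp

end Logarithmic

/-! ### Logarithmic gaps of the conditioned model -/

section PartOne

variable {Ω : Type*} [MeasurableSpace Ω] {P : Measure Ω} {T : ℕ → Ω → ℕ} {α : ℝ} {ℓ : ℝ → ℝ}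
  {C : ℝ} {A : ℕ}

theorem tendsto_iSup_of_eventually_le {R : Set ℝ} {F : ℕ → ℕ → ENNReal} {err : ℕ → ℝ}
    (herr : Tendsto err atTop (𝓝 0))
    (h : ∀ᶠ n : ℕ in atTop, ∀ l, (l + 1 : ℕ) ∈ scaledNat n R → F n (l + 1) ≤ ENNReal.ofReal (err n)) :
    Tendsto (fun n : ℕ => ⨆ l ∈ scaledNat n R, F n l) atTop (𝓝 0) := by
  have h1 : Tendsto (fun n => ENNReal.ofReal (err n)) atTop (𝓝 0) := by
    simpa using ENNReal.tendsto_ofReal herr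
  refine tendsto_of_tendsto_of_tendsto_of_le_of_le' tendsto_const_nhds h1
    (Eventually.of_forall fun _ => bot_le) ?_
  filter_upwards [h] with n hn
  refine iSup₂_le fun l hl => ?_
  obtain ⟨j, rfl⟩ : ∃ j, l = j + 1 := ⟨l - 1, by have := hl.1; omega⟩
  exact hn j hl

/-- A closed `R` inside a bounded interval is compact and contains its extreme points. Their tilts
bound the tilts of all densities in `R`, keeping these in a compact subset of `(0, ∞)`. -/
theorem InterArrival.tendsto_maxGap_div_log (hT : InterArrival P T α ℓ)
    (hreg : PolynomiallyRegular (stepLaw P T) C A) (h : ℝ) {R : Set ℝ} {ε : ℝ} (hR : IsClosed R)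
    (hsub : R ⊆ Ioo (criticalDensity P T) 1) (hε : 0 < ε) :
    Tendsto (fun n : ℕ => ⨆ l ∈ scaledNat n R,
        (ProbabilityTheory.cond (pinningMeasure P T n h 0)
          {s | contactNumber T n s = l})
          {s | ε < |(maxGap T n s : ℝ) / Real.log n
            - 1 / freeEnergy P T (inverseDensity P T ((l : ℝ) / n))|})
        atTop (𝓝 0) := by
  set K := stepLaw P T with hKdef
  have hK : IsStepLaw K := hT.isStepLaw
  rcases R.eq_empty_or_nonempty with rfl | hne
  · simp [scaledNat]
  have hcomp : IsCompact R := Metric.isCompact_of_isClosed_isBounded hR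
    ((Metric.isBounded_Ioo _ _).subset hsub)
  have hmin := hcomp.sInf_mem hne
  have hmax := hcomp.sSup_mem hne
  set F : ℝ → ℝ := fun r => freeEnergy P T (inverseDensity P T r) with hF
  have hspec : ∀ r ∈ R, 0 < F r ∧ meanGap K (F r) = r⁻¹ := fun r hr =>
    hT.inverseDensity_spec hreg (hsub hr)
  have hpos : ∀ r ∈ R, 0 < r := fun r hr => by
    obtain ⟨h1, h2⟩ := hspec r hr
    rw [← inv_pos, ← h2]
    exact one_pos.trans (hK.one_lt_meanGap h1)
  have hmono : ∀ r ∈ R, ∀ r' ∈ R, r ≤ r' → F r ≤ F r' := fun r hr r' hr' hle => by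
    obtain ⟨h1, h2⟩ := hspec r hr
    obtain ⟨h3, h4⟩ := hspec r' hr'
    refine (hK.strictAntiOn_meanGap.le_iff_ge h3 h1).1 ?_
    rw [h2, h4]
    exact inv_anti₀ (hpos r hr) hle
  obtain ⟨err, herr, hev⟩ := hK.exists_exceptionalRatio_le hreg (hspec _ hmin).1
    (hmono _ hmin _ hmax (csInf_le_csSup hne hcomp.bddBelow hcomp.bddAbove)) hε
  refine tendsto_iSup_of_eventually_le (F := fun n l =>
    (ProbabilityTheory.cond (pinningMeasure P T n h 0) {s | contactNumber T n s = l})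
      {s | ε < |(maxGap T n s : ℝ) / Real.log n
        - 1 / freeEnergy P T (inverseDensity P T ((l : ℝ) / n))|}) herr ?_
  filter_upwards [hev, eventually_ge_atTop 3] with n hn hn3 l hl
  obtain ⟨-, r, hr, hlr⟩ := hl
  have hn0 : (0 : ℝ) < n := by exact_mod_cast (by omega : 0 < n)
  have hlog : 0 < Real.log n := Real.log_pos (by exact_mod_cast (by omega : 1 < n))
  have hrl : ((l + 1 : ℕ) : ℝ) / n = r := by rw [hlr]; field_simp
  obtain ⟨h1, h2⟩ := hspec r hr
  have h3 := hn l (F r) (hmono _ hmin _ hr (csInf_le hcomp.bddBelow hr))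
    (hmono _ hr _ hmax (le_csSup hcomp.bddAbove hr)) (by
      have := (hpos r hr).ne'
      rw [h2, hlr]; field_simp)
  rw [hrl]
  refine le_trans (hT.cond_pinningMeasure_le n l h
    (B := {m : ℕ | ε < |(m : ℝ) / Real.log n - 1 / F r|})
    (b := ⌈(1 / F r - ε) * Real.log n⌉₊)
    (G := {t : ℕ | (1 / F r + ε) * Real.log n < t}) fun m hm => ?_) (ENNReal.ofReal_le_ofReal h3)
  have hm' : ε < |(m : ℝ) / Real.log n - 1 / F r| := hm
  rcases lt_abs.1 hm' with h4 | h4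
  · right
    have : 1 / F r + ε < (m : ℝ) / Real.log n := by linarith
    exact (lt_div_iff₀ hlog).1 this
  · left
    rw [Nat.lt_ceil, ← div_lt_iff₀ hlog]
    linarith

end PartOne

/-! ### Uniform convergence and Potter bounds for slowly varying functions -/

section SlowVariation

/-- The sets on the right increase with `N` and exhaust `[0, 2]` by pointwise convergence, so their
measures tend to `2`. -/
theorem exists_measure_uniform_set {h : ℝ → ℝ}
    (hlim : ∀ v, Tendsto (fun u => h (u + v) - h u) atTop (𝓝 0)) {a : ℕ → ℝ}
    (ha : Tendsto a atTop atTop) :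
    ∀ᶠ N : ℕ in atTop, ENNReal.ofReal (3 / 2) <
      volume {v ∈ Icc (0 : ℝ) 2 | ∀ n ≥ N, |h (a n + v) - h (a n)| ≤ 1 / 2} := by
  set E : ℕ → Set ℝ := fun N => {v ∈ Icc (0 : ℝ) 2 | ∀ n ≥ N, |h (a n + v) - h (a n)| ≤ 1 / 2}
    with hE
  have hmono : Monotone E := fun M N hMN v hv => ⟨hv.1, fun n hn => hv.2 n (hMN.trans hn)⟩
  have hunion : ⋃ N, E N = Icc 0 2 := by
    refine Subset.antisymm (iUnion_subset fun N v hv => hv.1) fun v hv => ?_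
    have h1 := ((hlim v).comp ha).abs
    rw [abs_zero] at h1
    obtain ⟨N, hN⟩ := eventually_atTop.1 (h1.eventually_le_const (show (0 : ℝ) < 1 / 2 by norm_num))
    exact mem_iUnion.2 ⟨N, hv, hN⟩
  have ht := tendsto_measure_iUnion_atTop (μ := volume) hmono
  rw [hunion, Real.volume_Icc, sub_zero] at ht
  exact ht.eventually_const_lt ((ENNReal.ofReal_lt_ofReal_iff (by norm_num)).2 (by norm_num))

/-- Pointwise convergence of the increments of a measurable function is locally uniform. -/
theorem exists_forall_increment_le {h : ℝ → ℝ} (hm : Measurable h)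
    (hlim : ∀ v, Tendsto (fun u => h (u + v) - h u) atTop (𝓝 0)) :
    ∃ U : ℝ, ∀ u, U ≤ u → ∀ v ∈ Icc (0 : ℝ) 1, |h (u + v) - h u| ≤ 1 := by
  by_contra! hcon
  choose a ha v hv hlt using fun n : ℕ => hcon n
  have hat : Tendsto a atTop atTop := tendsto_atTop_mono ha tendsto_natCast_atTop_atTop
  have hbt : Tendsto (fun n => a n + v n) atTop atTop :=
    tendsto_atTop_mono (fun n => by linarith [(hv n).1]) hat
  obtain ⟨N, h1, h2⟩ := ((exists_measure_uniform_set hlim hat).and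
    (exists_measure_uniform_set hlim hbt)).exists
  set E := {w ∈ Icc (0 : ℝ) 2 | ∀ n ≥ N, |h (a n + w) - h (a n)| ≤ 1 / 2}
  set F := {w ∈ Icc (0 : ℝ) 2 | ∀ n ≥ N, |h (a n + v n + w) - h (a n + v n)| ≤ 1 / 2}
  set F' := (fun x => -v N + x) ⁻¹' F with hF'
  have hvF : volume F' = volume F := measure_preimage_add volume (-v N) F
  have hFm : MeasurableSet F := by
    have : F = Icc 0 2 ∩ ⋂ n, ⋂ (_ : n ≥ N),
        {w | |h (a n + v n + w) - h (a n + v n)| ≤ 1 / 2} := by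
      ext w; simp [F]
    rw [this]
    refine measurableSet_Icc.inter (MeasurableSet.iInter fun n => MeasurableSet.iInter fun _ => ?_)
    exact measurableSet_le (by fun_prop) measurable_const
  have hF'm : MeasurableSet F' := hFm.preimage (by fun_prop)
  -- Both `E` and the translate `F'` of `F` by `v N` have measure above `3 / 2` and lie in `[0, 3]`.
  -- At a common point `w`, the value `h (a N + w)` is within `1 / 2` of both `h (a N)` and `h (a N
  -- + v N)`.
  have hdisj : ¬ Disjoint E F' := by
    intro hd
    have h3 : volume (E ∪ F') = volume E + volume F' := measure_union hd hF'm
    have h4 : E ∪ F' ⊆ Icc 0 3 := by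
      have hvN := hv N
      rintro w (hw | hw)
      · have := hw.1
        exact ⟨this.1, by linarith [this.2]⟩
      · have := hw.1
        exact ⟨by linarith [this.1, hvN.1], by linarith [this.2, hvN.2]⟩
    have h5 := measure_mono (μ := volume) h4
    rw [h3, hvF, Real.volume_Icc] at h5
    have h6 := (ENNReal.add_lt_add h1 h2).trans_le h5
    rw [← ENNReal.ofReal_add (by norm_num) (by norm_num)] at h6
    norm_num at h6
  obtain ⟨w, hwE, hwF⟩ := not_disjoint_iff.1 hdisj
  have h7 := abs_le.1 (hwE.2 N le_rfl)
  have h8 := abs_le.1 (hwF.2 N le_rfl)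
  rw [show a N + v N + (-v N + w) = a N + w by ring] at h8
  refine absurd (hlt N) (not_lt.2 (abs_le.2 ⟨?_, ?_⟩)) <;> linarith [h7.1, h7.2, h8.1, h8.2]

theorem exists_forall_increment_le_add_one {h : ℝ → ℝ} (hm : Measurable h)
    (hlim : ∀ v, Tendsto (fun u => h (u + v) - h u) atTop (𝓝 0)) :
    ∃ U : ℝ, ∀ u, U ≤ u → ∀ v, 0 ≤ v → |h (u + v) - h u| ≤ v + 1 := by
  obtain ⟨U, hU⟩ := exists_forall_increment_le hm hlim
  have key : ∀ k : ℕ, ∀ u, U ≤ u → ∀ v : ℝ, 0 ≤ v → v ≤ k → |h (u + v) - h u| ≤ k := by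
    intro k
    induction k with
    | zero =>
      intro u _ v hv0 hv1
      have : v = 0 := le_antisymm (by simpa using hv1) hv0
      simp [this]
    | succ k ih =>
      intro u hu v hv0 hv1
      push_cast at hv1 ⊢
      rcases le_total v 1 with h1 | h1
      · exact (hU u hu v ⟨hv0, h1⟩).trans (by linarith [(Nat.cast_nonneg k : (0 : ℝ) ≤ k)])
      · have h2 := hU u hu 1 ⟨zero_le_one, le_rfl⟩
        have h3 := ih (u + 1) (by linarith) (v - 1) (by linarith) (by linarith)
        rw [show u + 1 + (v - 1) = u + v by ring] at h3
        have h4 := abs_add_le (h (u + v) - h (u + 1)) (h (u + 1) - h u)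
        rw [sub_add_sub_cancel] at h4
        linarith
  refine ⟨U, fun u hu v hv => ?_⟩
  exact (key ⌈v⌉₊ u hu v hv (Nat.le_ceil v)).trans (Nat.ceil_lt_add_one hv).le

/-- Potter's bound with exponent one: the increments of `u ↦ log ℓ(e^u)` over length `v` are at most
`v + 1`. -/
theorem SlowlyVarying.exists_ratio_le {ℓ : ℝ → ℝ} (h : SlowlyVarying ℓ) :
    ∃ X : ℝ, 1 ≤ X ∧ ∀ x y, X ≤ x → x ≤ y → 0 < ℓ x ∧ 0 < ℓ y ∧
      ℓ x ≤ Real.exp 1 * (y / x) * ℓ y ∧ ℓ y ≤ Real.exp 1 * (y / x) * ℓ x := by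
  obtain ⟨hmeas, hpos, hlim⟩ := h
  -- Measurability of `ℓ` is known only on `[1, ∞)`; this extension is measurable on the line.
  set L : ℝ → ℝ := fun z => ℓ (max z 1) with hL
  have hLm : Measurable L := by
    have : Measurable fun z : ℝ => (⟨max z 1, le_max_right z 1⟩ : Ici (1 : ℝ)) :=
      Measurable.subtype_mk (by fun_prop)
    exact hmeas.comp this
  have hLeq : ∀ z, 1 ≤ z → L z = ℓ z := fun z hz => by rw [hL]; simp [max_eq_left hz]
  set g : ℝ → ℝ := fun u => Real.log (L (Real.exp u)) with hg
  have hgm : Measurable g := Real.measurable_log.comp (hLm.comp Real.measurable_exp)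
  obtain ⟨Y, hY⟩ := eventually_atTop.1 hpos
  have hg_eq : ∀ u, 0 ≤ u → g u = Real.log (ℓ (Real.exp u)) := fun u hu => by
    rw [hg]; simp only; rw [hLeq _ (Real.one_le_exp hu)]
  have hglim : ∀ v, Tendsto (fun u => g (u + v) - g u) atTop (𝓝 0) := by
    intro v
    have h1 := (hlim (Real.exp v) (Real.exp_pos v)).comp Real.tendsto_exp_atTop
    have h2 := ((Real.continuousAt_log one_ne_zero).tendsto).comp h1
    rw [Real.log_one] at h2
    refine h2.congr' ?_
    have hexp := Real.tendsto_exp_atTop.eventually_ge_atTop Y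
    have hexp2 := (Real.tendsto_exp_atTop.comp
      (tendsto_atTop_add_const_right atTop v tendsto_id)).eventually_ge_atTop Y
    filter_upwards [hexp, hexp2, eventually_ge_atTop 0, eventually_ge_atTop (-v)]
      with u h3 h4 h5 h6
    have h4' : Y ≤ Real.exp (u + v) := h4
    rw [hg_eq u h5, hg_eq (u + v) (by linarith), Function.comp_apply, Function.comp_apply,
      ← Real.exp_add, add_comm v u, Real.log_div (hY _ h4').ne' (hY _ h3).ne']
  obtain ⟨U, hU⟩ := exists_forall_increment_le_add_one hgm hglim
  refine ⟨max (max 1 Y) (Real.exp U), (le_max_left _ _).trans (le_max_left _ _),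
    fun x y hx hxy => ?_⟩
  have hx1 : 1 ≤ x := ((le_max_left _ _).trans (le_max_left _ _)).trans hx
  have hxY : Y ≤ x := ((le_max_right _ _).trans (le_max_left _ _)).trans hx
  have hxU : Real.exp U ≤ x := (le_max_right _ _).trans hx
  have hx0 : 0 < x := by linarith
  have hy0 : 0 < y := by linarith
  have hlx := hY x hxY
  have hly := hY y (hxY.trans hxy)
  have hyx : Real.log (y / x) = Real.log y - Real.log x := Real.log_div hy0.ne' hx0.ne'
  have hv0 : 0 ≤ Real.log (y / x) := Real.log_nonneg ((one_le_div hx0).2 hxy)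
  have h1 := hU (Real.log x) ((Real.le_log_iff_exp_le hx0).2 hxU) (Real.log (y / x)) hv0
  rw [hg_eq _ (Real.log_nonneg hx1), hg_eq _ (by linarith [Real.log_nonneg hx1]),
    show Real.log x + Real.log (y / x) = Real.log y by rw [hyx]; ring, Real.exp_log hx0,
    Real.exp_log hy0] at h1
  have h2 := abs_le.1 h1
  have e : Real.exp 1 * (y / x) = Real.exp (Real.log (y / x) + 1) := by
    rw [Real.exp_add, Real.exp_log (by positivity), mul_comm]
  refine ⟨hlx, hly, ?_, ?_⟩
  · rw [e, ← Real.log_le_log_iff hlx (by positivity), Real.log_mul (Real.exp_pos _).ne' hly.ne',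
      Real.log_exp]
    linarith [h2.1]
  · rw [e, ← Real.log_le_log_iff hly (by positivity), Real.log_mul (Real.exp_pos _).ne' hlx.ne',
      Real.log_exp]
    linarith [h2.2]

end SlowVariation

/-! ### Polynomial regularity of the step law -/

section Regular

variable {Ω : Type*} [MeasurableSpace Ω] {P : Measure Ω} {T : ℕ → Ω → ℕ} {α : ℝ} {ℓ : ℝ → ℝ}

/-- The finitely many indices up to `N` are absorbed into the constant, `K` being positive there and
at most one everywhere. For `t ≤ N ≤ n` the comparison passes through `N`. -/
theorem IsStepLaw.exists_polynomiallyRegular {K : ℕ → ℝ} (hK : IsStepLaw K) {C₀ : ℝ} {A N : ℕ}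
    (hC₀ : 1 ≤ C₀) (hN : 1 ≤ N)
    (h : ∀ t n : ℕ, N ≤ t → t ≤ n →
      K t ≤ C₀ * ((n : ℝ) / t) ^ A * K n ∧ K n ≤ C₀ * ((n : ℝ) / t) ^ A * K t) :
    ∃ C, PolynomiallyRegular K C A := by
  obtain ⟨t₀, ht₀, hmin⟩ := (Finset.Icc 1 N).exists_min_image K ⟨1, by simpa using hN⟩
  have ht₀' := Finset.mem_Icc.1 ht₀
  have hk0 := hK.pos t₀ ht₀'.1
  set M := (K t₀)⁻¹ with hM
  have hM1 : 1 ≤ M := (one_le_inv₀ hk0).2 (hK.le_one _)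
  have hsmall : ∀ s t : ℕ, 1 ≤ t → t ≤ N → K s ≤ M * K t := by
    intro s t h1 h2
    refine (hK.le_one s).trans ?_
    rw [hM, inv_mul_eq_div, one_le_div hk0]
    exact hmin t (Finset.mem_Icc.2 ⟨h1, h2⟩)
  refine ⟨M * C₀, by positivity, fun t n ht htn => ?_⟩
  have ht0 : (0 : ℝ) < t := by exact_mod_cast ht
  have htn' : (t : ℝ) ≤ n := by exact_mod_cast htn
  have hr : 1 ≤ (n : ℝ) / t := (one_le_div ht0).2 htn'
  have hrA : 1 ≤ ((n : ℝ) / t) ^ A := one_le_pow₀ hr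
  have hKt := hK.nonneg t
  have hKn := hK.nonneg n
  rcases le_total N t with h1 | h1
  · obtain ⟨h2, h3⟩ := h t n h1 htn
    refine ⟨h2.trans ?_, h3.trans ?_⟩ <;>
    · rw [mul_assoc, mul_assoc, mul_assoc]
      exact le_mul_of_one_le_left (by positivity) hM1
  · rcases le_total n N with h2 | h2
    · have h3 : M ≤ M * C₀ * ((n : ℝ) / t) ^ A := by
        rw [mul_assoc]
        exact le_mul_of_one_le_right (by positivity) (one_le_mul_of_one_le_of_one_le hC₀ hrA)
      exact ⟨(hsmall t n (ht.trans htn) h2).trans (mul_le_mul_of_nonneg_right h3 hKn),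
        (hsmall n t ht h1).trans (mul_le_mul_of_nonneg_right h3 hKt)⟩
    · obtain ⟨h3, h4⟩ := h N n le_rfl h2
      have hN0 : (0 : ℝ) < N := by exact_mod_cast hN
      have h5 : ((n : ℝ) / N) ^ A ≤ ((n : ℝ) / t) ^ A := by
        have : (t : ℝ) ≤ N := by exact_mod_cast h1
        gcongr
      have hM0 : 0 ≤ M := by linarith
      have hC0 : 0 ≤ C₀ := by linarith
      constructor
      · calc K t ≤ M * K N := hsmall t N hN le_rfl
          _ ≤ M * (C₀ * ((n : ℝ) / N) ^ A * K n) := by gcongr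
          _ ≤ M * (C₀ * ((n : ℝ) / t) ^ A * K n) := by gcongr
          _ = _ := by ring
      · calc K n ≤ C₀ * ((n : ℝ) / N) ^ A * K N := h4
          _ ≤ C₀ * ((n : ℝ) / t) ^ A * (M * K t) := by
            have := hsmall N t ht h1
            have := hK.nonneg N
            gcongr
          _ = _ := by ring

theorem InterArrival.exists_polynomiallyRegular (hT : InterArrival P T α ℓ) :
    ∃ C A, PolynomiallyRegular (stepLaw P T) C A := by
  obtain ⟨X, hX1, hX⟩ := hT.slowlyVarying.exists_ratio_le
  have hα := hT.one_le_alpha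
  -- The power law accounts for `α + 1`, the Potter bound for the remaining `1`.
  set A := ⌈α + 2⌉₊ with hA
  have hAα : α + 2 ≤ A := Nat.le_ceil _
  have hX0 : 1 ≤ ⌈X⌉₊ := Nat.one_le_ceil_iff.2 (by linarith)
  obtain ⟨C, hC⟩ := hT.isStepLaw.exists_polynomiallyRegular (C₀ := Real.exp 1) (A := A)
    (Real.one_le_exp zero_le_one) hX0 fun t n ht htn => by
      have htX : X ≤ t := Nat.ceil_le.1 ht
      have ht1 : 1 ≤ t := hX0.trans ht
      have ht0 : (0 : ℝ) < t := by exact_mod_cast ht1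
      have htn' : (t : ℝ) ≤ n := by exact_mod_cast htn
      have hn0 : (0 : ℝ) < n := ht0.trans_le htn'
      obtain ⟨h1, h2, h3, h4⟩ := hX t n htX htn'
      have hr : 1 ≤ (n : ℝ) / t := (one_le_div ht0).2 htn'
      have et : stepLaw P T t = ℓ t / (t : ℝ) ^ (α + 1) := hT.law t ht1
      have en : stepLaw P T n = ℓ n / (n : ℝ) ^ (α + 1) := hT.law n (ht1.trans htn)
      have hta : 0 < (t : ℝ) ^ (α + 1) := Real.rpow_pos_of_pos ht0 _
      have hna : 0 < (n : ℝ) ^ (α + 1) := Real.rpow_pos_of_pos hn0 _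
      have hle : (t : ℝ) ^ (α + 1) ≤ (n : ℝ) ^ (α + 1) :=
        Real.rpow_le_rpow ht0.le htn' (by linarith)
      have hpow : (n : ℝ) / t * ((n : ℝ) ^ (α + 1) / (t : ℝ) ^ (α + 1)) ≤ ((n : ℝ) / t) ^ A := by
        rw [← Real.div_rpow hn0.le ht0.le, ← Real.rpow_one_add' (by positivity) (by linarith),
          ← Real.rpow_natCast]
        exact Real.rpow_le_rpow_of_exponent_le hr (by linarith)
      have hpow' : (n : ℝ) / t ≤ ((n : ℝ) / t) ^ A :=
        le_self_pow₀ hr (by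
          have : 0 < A := Nat.ceil_pos.2 (by linarith)
          omega)
      rw [et, en]
      constructor
      · calc ℓ t / (t : ℝ) ^ (α + 1)
            ≤ Real.exp 1 * ((n : ℝ) / t) * ℓ n / (t : ℝ) ^ (α + 1) := by gcongr
          _ = Real.exp 1 * ((n : ℝ) / t * ((n : ℝ) ^ (α + 1) / (t : ℝ) ^ (α + 1))) *
                (ℓ n / (n : ℝ) ^ (α + 1)) := by field_simp
          _ ≤ _ := by gcongr
      · calc ℓ n / (n : ℝ) ^ (α + 1)
            ≤ Real.exp 1 * ((n : ℝ) / t) * ℓ t / (t : ℝ) ^ (α + 1) := by gcongr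
          _ = Real.exp 1 * ((n : ℝ) / t) * (ℓ t / (t : ℝ) ^ (α + 1)) := by ring
          _ ≤ _ := by gcongr
  exact ⟨C, A, hC⟩

end Regular

/-! ### Truncation, exponential moments and the weak law -/

/-- The tail of the mean of a law. -/
noncomputable def tailMean (K : ℕ → ℝ) (x : ℝ) : ℝ :=
  ∑' t : ℕ, {t : ℕ | x ≤ t}.indicator (fun t : ℕ => (t : ℝ) * K t) t

/-- The probability that `l` steps of law `w` have their sum in `s`. -/
noncomputable def sumMass (w : ℕ → ℝ) (l : ℕ) (s : Set ℕ) : ℝ := ∑' m, s.indicator (convPow w l) m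

/-- The total `n` determines one coordinate from the other. A uniform bound on the large step thus
factors out, leaving the mass of the positions of the remaining sum. -/
theorem sum_antidiagonal_le {f g : ℕ → ℝ} {k : ℝ} {s : Set ℕ} {n : ℕ} (hk : 0 ≤ k)
    (hg : ∀ m, 0 ≤ g m) (hgs : Summable g)
    (hf : ∀ t m, t + m = n → f t ≤ s.indicator (fun _ => k) m) :
    ∑ p ∈ Finset.HasAntidiagonal.antidiagonal n, f p.1 * g p.2 ≤ k * ∑' m, s.indicator g m := by
  have h1 : ∑ p ∈ Finset.HasAntidiagonal.antidiagonal n, f p.1 * g p.2 ≤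
      ∑ p ∈ Finset.HasAntidiagonal.antidiagonal n, k * s.indicator g p.2 := by
    refine Finset.sum_le_sum fun p hp => ?_
    have := mul_le_mul_of_nonneg_right
      (hf p.1 p.2 (Finset.HasAntidiagonal.mem_antidiagonal.1 hp)) (hg p.2)
    refine this.trans (le_of_eq ?_)
    by_cases hm : p.2 ∈ s <;> simp [hm]
  refine h1.trans ?_
  rw [← Finset.mul_sum]
  refine mul_le_mul_of_nonneg_left ?_ hk
  rw [← Finset.sum_image (f := s.indicator g) (g := fun p : ℕ × ℕ => p.2)]
  · exact (hgs.indicator s).sum_le_tsum _ fun m _ => indicator_nonneg (fun m _ => hg m) m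
  · intro p hp p' hp' h
    have e1 := Finset.HasAntidiagonal.mem_antidiagonal.1 hp
    have e2 := Finset.HasAntidiagonal.mem_antidiagonal.1 hp'
    have h' : p.2 = p'.2 := h
    exact Prod.ext (by omega) h'

theorem le_sum_antidiagonal {f g : ℕ → ℝ} {k : ℝ} {s : Set ℕ} {n : ℕ} (hs : ∀ m ∈ s, m ≤ n)
    (hf0 : ∀ t, 0 ≤ f t) (hg : ∀ m, 0 ≤ g m)
    (hf : ∀ t m, t + m = n → m ∈ s → k ≤ f t) :
    k * ∑' m, s.indicator g m ≤ ∑ p ∈ Finset.HasAntidiagonal.antidiagonal n, f p.1 * g p.2 := by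
  have h0 : ∑' m, s.indicator g m = ∑ m ∈ Finset.range (n + 1), s.indicator g m :=
    tsum_eq_sum fun m hm => indicator_of_notMem (fun h => hm (Finset.mem_range.2
      (Nat.lt_succ_of_le (hs m h)))) _
  rw [h0, Finset.mul_sum, ← Finset.Nat.sum_antidiagonal_swap,
    Finset.Nat.sum_antidiagonal_eq_sum_range_succ_mk]
  refine Finset.sum_le_sum fun m hm => ?_
  rw [Finset.mem_range] at hm
  by_cases h : m ∈ s
  · rw [indicator_of_mem h]
    exact mul_le_mul_of_nonneg_right (hf _ _ (by simp; omega) h) (hg m)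
  · rw [indicator_of_notMem h, mul_zero]
    exact mul_nonneg (hf0 _) (hg _)

section Tail

variable {K : ℕ → ℝ} {μ : ℝ}

theorem tendsto_tailMean (hK : ∀ t, 0 ≤ K t) (hμ : HasSum (fun t : ℕ => (t : ℝ) * K t) μ) :
    Tendsto (tailMean K) atTop (𝓝 0) := by
  have := tendsto_tsum_of_dominated_convergence (𝓕 := (atTop : Filter ℝ))
    (f := fun (x : ℝ) (t : ℕ) => {t : ℕ | x ≤ t}.indicator (fun t : ℕ => (t : ℝ) * K t) t)
    (g := fun _ => 0) (bound := fun t : ℕ => (t : ℝ) * K t) hμ.summable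
    (fun t => by
      refine tendsto_const_nhds.congr' ?_
      filter_upwards [eventually_gt_atTop (t : ℝ)] with x hx
      have : t ∉ {t : ℕ | x ≤ t} := not_le.2 hx
      rw [indicator_of_notMem this])
    (Eventually.of_forall fun x t => by
      have h0 : 0 ≤ (t : ℝ) * K t := mul_nonneg (Nat.cast_nonneg t) (hK t)
      rw [Real.norm_of_nonneg (indicator_nonneg (fun t _ => mul_nonneg (Nat.cast_nonneg t) (hK t)) t)]
      exact indicator_apply_le' (fun _ => le_rfl) fun _ => h0)
  rw [tsum_zero] at this
  exact this

theorem one_sub_tsum_Iio_le (hK : ∀ t, 0 ≤ K t) (hK1 : HasSum K 1)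
    (hμ : HasSum (fun t : ℕ => (t : ℝ) * K t) μ) {x : ℝ} (hx : 0 < x) :
    1 - tailMean K x / x ≤ ∑' t, {t : ℕ | (t : ℝ) < x}.indicator K t := by
  have hs1 : Summable ({t : ℕ | (t : ℝ) < x}.indicator K) := hK1.summable.indicator _
  have hs2 : Summable ({t : ℕ | x ≤ t}.indicator (fun t : ℕ => (t : ℝ) * K t)) :=
    hμ.summable.indicator _
  have h := hasSum_le (fun t => ?_) hK1 (hs1.hasSum.add (hs2.hasSum.div_const x))
  · unfold tailMean
    linarith
  · rcases lt_or_ge (t : ℝ) x with ht | ht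
    · have h2 : t ∉ {t : ℕ | x ≤ t} := not_le.2 ht
      rw [indicator_of_mem (show t ∈ {t : ℕ | (t : ℝ) < x} from ht), indicator_of_notMem h2]
      simp
    · have h2 : t ∉ {t : ℕ | (t : ℝ) < x} := not_lt.2 ht
      rw [indicator_of_mem (show t ∈ {t : ℕ | x ≤ t} from ht), indicator_of_notMem h2, zero_add,
        le_div_iff₀ hx, mul_comm]
      exact mul_le_mul_of_nonneg_right ht (hK t)

/-- The exponential moment at `1 / b` of the law restricted below `b`. -/
theorem tsum_Iio_mul_exp_le (hK : ∀ t, 0 ≤ K t) (hK1 : HasSum K 1)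
    (hμ : HasSum (fun t : ℕ => (t : ℝ) * K t) μ) {b : ℕ} (hb : 0 < b) {η : ℝ} (hη : 0 ≤ η) :
    ∑' t, (Iio b).indicator K t * Real.exp (1 / b) ^ t ≤
      1 + ((1 + η) * μ + tailMean K (η * b)) / b := by
  have hb' : (0 : ℝ) < b := by exact_mod_cast hb
  have hs2 : Summable ({t : ℕ | η * b ≤ t}.indicator (fun t : ℕ => (t : ℝ) * K t)) :=
    hμ.summable.indicator _
  have h1 : HasSum (fun t => K t + ((1 + η) * ((t : ℝ) * K t) +
      {t : ℕ | η * b ≤ t}.indicator (fun t : ℕ => (t : ℝ) * K t) t) / b)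
      (1 + ((1 + η) * μ + tailMean K (η * b)) / b) :=
    hK1.add (((hμ.mul_left (1 + η)).add hs2.hasSum).div_const _)
  have hle : ∀ t, (Iio b).indicator K t * Real.exp (1 / b) ^ t ≤
      K t + ((1 + η) * ((t : ℝ) * K t) +
      {t : ℕ | η * b ≤ t}.indicator (fun t : ℕ => (t : ℝ) * K t) t) / b := by
    intro t
    have hKt := hK t
    have hi0 : 0 ≤ {t : ℕ | η * b ≤ t}.indicator (fun t : ℕ => (t : ℝ) * K t) t :=
      indicator_apply_nonneg fun _ => by positivity
    by_cases ht : t < b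
    · rw [indicator_of_mem (show t ∈ Iio b from ht), ← Real.exp_nat_mul, mul_one_div]
      set x := (t : ℝ) / b with hx
      have hx0 : 0 ≤ x := by positivity
      have hx1 : x ≤ 1 := by rw [hx, div_le_one hb']; exact_mod_cast ht.le
      have hexp : Real.exp x ≤ 1 + x + x ^ 2 := by
        have := (abs_le.1 (Real.abs_exp_sub_one_sub_id_le (x := x) (by rwa [abs_of_nonneg hx0]))).2
        linarith
      -- The quadratic part of `e^x ≤ 1 + x + x²` is small for two reasons: `x ≤ η` when `t < η b`,
      -- while larger `t` are charged to the tail of the mean, using `x ≤ 1`.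
      have hxi : x ^ 2 * K t ≤ η * x * K t +
          {t : ℕ | η * b ≤ t}.indicator (fun t : ℕ => (t : ℝ) * K t) t / b := by
        rcases lt_or_ge (t : ℝ) (η * b) with h | h
        · have h2 : t ∉ {t : ℕ | η * b ≤ t} := not_le.2 h
          rw [indicator_of_notMem h2, zero_div, add_zero]
          have : x ≤ η := by rw [hx, div_le_iff₀ hb']; exact h.le
          rw [sq]
          gcongr
        · rw [indicator_of_mem (show t ∈ {t : ℕ | η * b ≤ t} from h)]
          have e : (t : ℝ) * K t / b = x * K t := by rw [hx]; ring
          rw [e]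
          have h3 : x ^ 2 * K t ≤ x * K t := by
            refine mul_le_mul_of_nonneg_right ?_ hKt
            nlinarith
          have : 0 ≤ η * x * K t := by positivity
          linarith
      calc K t * Real.exp x ≤ K t * (1 + x + x ^ 2) := by gcongr
        _ = K t + x * K t + x ^ 2 * K t := by ring
        _ ≤ K t + x * K t + (η * x * K t +
          {t : ℕ | η * b ≤ t}.indicator (fun t : ℕ => (t : ℝ) * K t) t / b) := by linarith
        _ = _ := by rw [hx]; ring
    · rw [indicator_of_notMem (show t ∉ Iio b from ht), zero_mul]
      positivity
  refine hasSum_le hle (Summable.hasSum ?_) h1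
  refine Summable.of_nonneg_of_le (fun t => mul_nonneg (indicator_nonneg (fun t _ => hK t) t)
    (by positivity)) hle h1.summable

/-- Chernoff bound for the sum of steps restricted below `b`. -/
theorem sumMass_Iio_le (hK : ∀ t, 0 ≤ K t) {b : ℕ} {y S : ℝ}
    (hS : ∑' t, (Iio b).indicator K t * Real.exp (1 / b) ^ t ≤ 1 + S / b) (l : ℕ) :
    sumMass ((Iio b).indicator K) l {m : ℕ | y ≤ m} ≤ Real.exp ((l * S - y) / b) := by
  set w : ℕ → ℝ := fun t => (Iio b).indicator K t * Real.exp (1 / b) ^ t with hw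
  have hw0 : ∀ t, 0 ≤ w t := fun t => mul_nonneg (indicator_nonneg (fun t _ => hK t) t)
    (by positivity)
  have hws : Summable w := summable_of_ne_finset_zero (s := Finset.range b) fun t ht => by
    have : t ∉ Iio b := fun h => ht (Finset.mem_range.2 h)
    simp [hw, this]
  have h1 : HasSum (fun m => convPow w l m * Real.exp (-y / b)) ((∑' t, w t) ^ l * Real.exp (-y / b)) :=
    (hasSum_convPow hw0 hws l).mul_right _
  have hle : ∀ m, {m : ℕ | y ≤ m}.indicator (convPow ((Iio b).indicator K) l) m ≤
      convPow w l m * Real.exp (-y / b) := by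
    intro m
    have h0 : 0 ≤ convPow ((Iio b).indicator K) l m :=
      convPow_nonneg (fun t => indicator_nonneg (fun t _ => hK t) t) l m
    refine indicator_apply_le' (fun hm => ?_) fun _ =>
      mul_nonneg (convPow_nonneg hw0 l m) (Real.exp_nonneg _)
    have hm' : y ≤ (m : ℝ) := hm
    rw [hw, convPow_mul_pow, mul_assoc, ← Real.exp_nat_mul, ← Real.exp_add]
    refine le_mul_of_one_le_right h0 (Real.one_le_exp ?_)
    rw [mul_one_div, ← add_div]
    exact div_nonneg (by linarith) (Nat.cast_nonneg b)
  have hsum := Summable.of_nonneg_of_le (fun m => indicator_nonneg (fun m _ =>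
    convPow_nonneg (fun t => indicator_nonneg (fun t _ => hK t) t) l m) m) hle h1.summable
  refine (hasSum_le hle hsum.hasSum h1).trans ?_
  calc (∑' t, w t) ^ l * Real.exp (-y / b) ≤ Real.exp (S / b) ^ l * Real.exp (-y / b) := by
        refine mul_le_mul_of_nonneg_right (pow_le_pow_left₀ (tsum_nonneg hw0)
          (hS.trans ?_) l) (Real.exp_nonneg _)
        linarith [Real.add_one_le_exp (S / b)]
    _ = _ := by
        rw [← Real.exp_nat_mul, ← Real.exp_add]
        congr 1
        ring

end Tail

section LawOfLargeNumbers

variable {Ω : Type*} [MeasurableSpace Ω] {P : Measure Ω} {T : ℕ → Ω → ℕ} {α : ℝ} {ℓ : ℝ → ℝ}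

theorem InterArrival.integrable_integral (hT : InterArrival P T α ℓ) {μ : ℝ}
    (hμ : HasSum (fun t : ℕ => (t : ℝ) * stepLaw P T t) μ) :
    Integrable (fun s => (T 0 s : ℝ)) P ∧ ∫ s, (T 0 s : ℝ) ∂P = μ := by
  have := hT.isProbability
  have hm : Measurable (T 0) := hT.measurable 0
  have hsing : ∀ t, (P.map (T 0)).real {t} = stepLaw P T t := fun t => by
    rw [map_measureReal_apply hm (measurableSet_singleton t)]; rfl
  have hint : Integrable (fun t : ℕ => (t : ℝ)) (P.map (T 0)) := by
    refine ⟨by fun_prop, ?_⟩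
    rw [HasFiniteIntegral, lintegral_countable']
    have h1 : ∀ t : ℕ, ‖(t : ℝ)‖ₑ * (P.map (T 0)) {t} =
        ENNReal.ofReal ((t : ℝ) * stepLaw P T t) := fun t => by
      rw [← hsing, ENNReal.ofReal_mul (Nat.cast_nonneg t), ofReal_measureReal,
        Real.enorm_of_nonneg (Nat.cast_nonneg t)]
    simp_rw [h1]
    exact hμ.summable.tsum_ofReal_lt_top
  have hint' : Integrable (fun s => (T 0 s : ℝ)) P := hint.comp_measurable hm
  refine ⟨hint', ?_⟩
  rw [← integral_map (φ := T 0) (f := fun t : ℕ => (t : ℝ)) hm.aemeasurable (by fun_prop),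
    integral_countable hint, ← hμ.tsum_eq]
  exact tsum_congr fun t => by rw [hsing, smul_eq_mul, mul_comm]

/-- The weak law of large numbers, for the convolution powers of the inter-arrival law. -/
theorem InterArrival.exists_sumMass_le (hT : InterArrival P T α ℓ) {μ : ℝ}
    (hμ : HasSum (fun t : ℕ => (t : ℝ) * stepLaw P T t) μ) {η : ℝ} (hη : 0 < η) :
    ∃ e : ℕ → ℝ, Tendsto e atTop (𝓝 0) ∧ ∀ (l : ℕ) (s : Set ℕ), 1 ≤ l →
      (∀ m ∈ s, η * l ≤ |(m : ℝ) - l * μ|) → sumMass (stepLaw P T) l s ≤ e l := by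
  have := hT.isProbability
  obtain ⟨hint, hE⟩ := hT.integrable_integral hμ
  have hmeas : ∀ i, Measurable fun s => (T i s : ℝ) := fun i =>
    (measurable_from_top (f := fun t : ℕ => (t : ℝ))).comp (hT.measurable i)
  have hslln := strong_law_ae_real (μ := P) (fun i s => (T i s : ℝ)) hint
    (fun i j hij => (hT.indep.indepFun hij).comp (φ := fun t : ℕ => (t : ℝ))
      (ψ := fun t : ℕ => (t : ℝ)) measurable_from_top measurable_from_top)
    (fun i => (hT.identDistrib i).comp (u := fun t : ℕ => (t : ℝ)) measurable_from_top)
  rw [hE] at hslln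
  have hprob := tendstoInMeasure_of_tendsto_ae (μ := P)
    (f := fun n s => (∑ i ∈ Finset.range n, (T i s : ℝ)) / n) (g := fun _ => μ)
    (fun n => ((Finset.measurable_fun_sum _ fun i _ => hmeas i).div_const _).aestronglyMeasurable)
    hslln
  rw [tendstoInMeasure_iff_measureReal_norm] at hprob
  refine ⟨_, hprob η hη, fun l s hl hs => ?_⟩
  have hl0 : (0 : ℝ) < l := by exact_mod_cast hl
  refine Real.tsum_le_of_sum_le (fun m => indicator_nonneg (fun m _ =>
    convPow_nonneg hT.isStepLaw.nonneg l m) m) fun F => ?_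
  have h1 : ∑ m ∈ F, s.indicator (convPow (stepLaw P T) l) m =
      ∑ m ∈ F, P.real ({x | renewalTime T l x = m} ∩ {_x | m ∈ s}) := by
    refine Finset.sum_congr rfl fun m _ => ?_
    by_cases hm : m ∈ s
    · simp [hm, hT.measureReal_renewalTime]
    · simp [hm]
  rw [h1, ← measureReal_biUnion_finset]
  · refine measureReal_mono (iUnion₂_subset fun m _ => ?_)
    rintro x ⟨hx, hm⟩
    have hx' : renewalTime T l x = m := hx
    have h2 := hs m hm
    rw [← hx'] at h2
    have h3 : (∑ i ∈ Finset.range l, (T i x : ℝ)) / l - μ =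
        ((renewalTime T l x : ℝ) - l * μ) / l := by
      rw [renewalTime]; push_cast; field_simp
    change η ≤ ‖(∑ i ∈ Finset.range l, (T i x : ℝ)) / l - μ‖
    rw [h3, norm_div, Real.norm_eq_abs, Real.norm_of_nonneg hl0.le, le_div_iff₀ hl0]
    exact h2
  · intro m _ m' _ hmm
    refine Set.disjoint_left.2 fun x hx hx' => hmm ?_
    have e1 : renewalTime T l x = m := hx.1
    have e2 : renewalTime T l x = m' := hx'.1
    exact e1.symm.trans e2
  · intro m _
    refine (measurable_renewalTime hT.measurable l (measurableSet_singleton m)).inter ?_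
    exact MeasurableSet.const _

end LawOfLargeNumbers

/-! ### One big jump -/

/-- The convolution powers of `K` satisfy the weak law of large numbers with mean `μ`. -/
def WeakLaw (K : ℕ → ℝ) (μ : ℝ) : Prop :=
  ∀ η : ℝ, 0 < η → ∃ e : ℕ → ℝ, Tendsto e atTop (𝓝 0) ∧ ∀ (l : ℕ) (s : Set ℕ), 1 ≤ l →
    (∀ m ∈ s, η * l ≤ |(m : ℝ) - l * μ|) → sumMass K l s ≤ e l

theorem eventually_forall_le_of_tendsto {e : ℕ → ℝ} (he : Tendsto e atTop (𝓝 0)) {r ε : ℝ}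
    (hr : 0 < r) (hε : 0 < ε) :
    ∀ᶠ n : ℕ in atTop, ∀ l : ℕ, r * n ≤ l + 1 → 1 ≤ l ∧ e l ≤ ε := by
  obtain ⟨N, hN⟩ := eventually_atTop.1 (he.eventually_le_const hε)
  filter_upwards [tendsto_natCast_atTop_atTop.eventually_ge_atTop ((N + 2 : ℝ) / r)] with n hn l hl
  rw [div_le_iff₀ hr, mul_comm] at hn
  have : (N + 2 : ℝ) ≤ l + 1 := hn.trans hl
  have : N + 2 ≤ l + 1 := by exact_mod_cast this
  exact ⟨by omega, hN l (by omega)⟩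

theorem pow_mul_exp_neg_le (m : ℕ) {k x : ℝ} (hk : 0 < k) (hx : 0 ≤ x) :
    x ^ m * Real.exp (-(k * x)) ≤ m.factorial / k ^ m := by
  have h := Real.pow_div_factorial_le_exp (k * x) (by positivity) m
  rw [div_le_iff₀ (by positivity), mul_pow] at h
  rw [Real.exp_neg, ← div_eq_mul_inv, div_le_div_iff₀ (Real.exp_pos _) (by positivity)]
  linarith

section BigJump

variable {K : ℕ → ℝ} {μ C : ℝ} {A : ℕ} (hK : IsStepLaw K) (hreg : PolynomiallyRegular K C A)
  (hμ : HasSum (fun t : ℕ => (t : ℝ) * K t) μ)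

include hK in
theorem summable_convPow_indicator (s : Set ℕ) (l : ℕ) : Summable (convPow (s.indicator K) l) :=
  (hasSum_convPow (fun t => indicator_nonneg (fun t _ => hK.nonneg t) t)
    (hK.hasSum.summable.indicator s) l).summable

include hK hμ in
theorem IsStepLaw.one_le_mean : 1 ≤ μ := by
  refine hasSum_le (fun t => ?_) hK.hasSum hμ
  rcases Nat.eq_zero_or_pos t with rfl | ht
  · simp [hK.zero]
  · exact le_mul_of_one_le_left (hK.nonneg t) (by exact_mod_cast ht)

include hK hμ in
theorem IsStepLaw.le_of_mul_mean_le {l n : ℕ} {κ : ℝ} (hκ : 0 ≤ κ)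
    (h : ((l : ℝ) + 1) * μ ≤ (1 - κ) * n) : (l : ℝ) + 1 ≤ n := by
  have := hK.one_le_mean hμ
  have h1 : ((l : ℝ) + 1) * 1 ≤ ((l : ℝ) + 1) * μ := by gcongr
  have h2 : (0 : ℝ) ≤ κ * n := by positivity
  linarith

include hK hreg in
theorem PolynomiallyRegular.le_of_mul_le {δ : ℝ} (hδ : 0 < δ) {t n : ℕ} (ht : 1 ≤ t) (htn : t ≤ n)
    (h : δ * n ≤ t) : K t ≤ C * (1 / δ) ^ A * K n ∧ K n ≤ C * (1 / δ) ^ A * K t := by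
  have ht0 : (0 : ℝ) < t := by exact_mod_cast ht
  have h1 : (n : ℝ) / t ≤ 1 / δ := by
    rw [div_le_div_iff₀ ht0 hδ]; linarith
  have hC := hreg.1
  have hKt := hK.nonneg t
  have hKn := hK.nonneg n
  obtain ⟨h2, h3⟩ := hreg.2 t n ht htn
  refine ⟨h2.trans ?_, h3.trans ?_⟩ <;> gcongr

include hK hreg hμ in
/-- One big jump gives a lower bound for the probability of an atypically large sum. -/
theorem IsStepLaw.exists_le_convPow (hw : WeakLaw K μ) {κ r : ℝ} (hκ : 0 < κ)
    (hr : 0 < r) : ∃ c, 0 < c ∧ ∀ᶠ n : ℕ in atTop, ∀ l : ℕ, r * n ≤ l + 1 →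
      ((l : ℝ) + 1) * μ ≤ (1 - κ) * n → c * (n * K n) ≤ convPow K (l + 1) n := by
  have hC := hreg.1
  -- The excess of `n` over the mean is at least `κ n`; half of it is left to the big step, the
  -- other half absorbs fluctuations.
  set θ := κ / 2 with hθ
  have hθ0 : 0 < θ := by positivity
  obtain ⟨e, he, hle⟩ := hw θ hθ0
  refine ⟨r * (θ ^ A / C) / 2, by positivity, ?_⟩
  have htail := (tendsto_tailMean hK.nonneg hμ).comp
    (tendsto_natCast_atTop_atTop.const_mul_atTop hθ0 : Tendsto (fun n : ℕ => θ * n) atTop atTop)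
  filter_upwards [eventually_forall_le_of_tendsto he hr (show (0 : ℝ) < 1 / 4 by norm_num),
    htail.eventually_le_const (show (0 : ℝ) < θ / 4 by positivity), eventually_ge_atTop 1]
    with n hn htn hn1 l hl hlμ
  obtain ⟨hl1, hel⟩ := hn l hl
  have hn0 : (0 : ℝ) < n := by exact_mod_cast hn1
  have hn1' : (1 : ℝ) ≤ n := by exact_mod_cast hn1
  have hln := hK.le_of_mul_mean_le hμ hκ.le hlμ
  have hKn := hK.nonneg n
  have hμ1 := hK.one_le_mean hμ
  -- Keeping the other `l` steps below `θ n` makes the big step unique, as `le_convPow` requires.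
  -- They do so with probability at least `3 / 4`, and their sum is too large with probability at
  -- most `1 / 4`.
  set B : Set ℕ := {t : ℕ | (t : ℝ) < θ * n} with hB
  set w := B.indicator K with hwdef
  have hw0 : ∀ t, 0 ≤ w t := fun t => indicator_nonneg (fun t _ => hK.nonneg t) t
  have hwK : ∀ t, w t ≤ K t := fun t => indicator_le_self' (fun _ _ => hK.nonneg _) t
  set s : Set ℕ := {m : ℕ | (m : ℝ) ≤ (1 - θ) * n} with hs
  set k := θ ^ A / C * K n with hk
  have h1 : k * ∑' m, s.indicator (convPow w l) m ≤
      ∑ p ∈ Finset.HasAntidiagonal.antidiagonal n, (K p.1 - w p.1) * convPow w l p.2 := by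
    refine le_sum_antidiagonal (f := fun t => K t - w t) (fun m hm => ?_)
      (fun t => sub_nonneg.2 (hwK t)) (fun m => convPow_nonneg hw0 l m) fun t m htm hm => ?_
    · have hm' : (m : ℝ) ≤ (1 - θ) * n := hm
      have : (m : ℝ) ≤ n := by nlinarith
      exact_mod_cast this
    · have hm' : (m : ℝ) ≤ (1 - θ) * n := hm
      have htm' : (t : ℝ) + m = n := by exact_mod_cast htm
      have ht : θ * n ≤ t := by linarith
      have ht1 : 1 ≤ t := by
        have : (0 : ℝ) < t := lt_of_lt_of_le (by positivity) ht
        exact_mod_cast this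
      have htB : t ∉ B := not_lt.2 ht
      rw [hwdef, indicator_of_notMem htB, sub_zero]
      have := (PolynomiallyRegular.le_of_mul_le hK hreg hθ0 ht1 (by omega) ht).2
      rw [hk, div_mul_eq_mul_div, div_le_iff₀ hC]
      calc θ ^ A * K n ≤ θ ^ A * (C * (1 / θ) ^ A * K t) := by gcongr
        _ = K t * C := by rw [one_div, inv_pow]; field_simp
  have hws : Summable (convPow w l) := summable_convPow_indicator hK B l
  have h2 : (∑' t, w t) ^ l ≤ (∑' m, s.indicator (convPow w l) m) + sumMass K l sᶜ := by
    have hKs : Summable (convPow K l) := (hasSum_convPow hK.nonneg hK.hasSum.summable l).summable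
    refine hasSum_le (fun m => ?_) (hasSum_convPow hw0 (hK.hasSum.summable.indicator B) l)
      ((hws.indicator s).hasSum.add (hKs.indicator sᶜ).hasSum)
    by_cases hm : m ∈ s
    · simp [hm, hwdef]
    · simpa [hm] using convPow_mono hw0 hwK l m
  have h3 : sumMass K l sᶜ ≤ 1 / 4 := by
    refine (hle l sᶜ hl1 fun m hm => ?_).trans hel
    have hm' : (1 - θ) * n < m := not_le.1 hm
    refine le_trans ?_ (le_abs_self _)
    have e1 : θ * l ≤ θ * n := by
      refine mul_le_mul_of_nonneg_left ?_ hθ0.le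
      linarith
    have e2 : (l : ℝ) * μ ≤ (1 - κ) * n := by nlinarith
    have e3 : κ = 2 * θ := by rw [hθ]; ring
    rw [e3] at e2
    linarith
  have h4 : 3 / 4 ≤ (∑' t, w t) ^ l := by
    have ha := one_sub_tsum_Iio_le hK.nonneg hK.hasSum hμ (x := θ * n) (by positivity)
    set τ := tailMean K (θ * n) with hτ
    have hτ' : τ ≤ θ / 4 := htn
    have hq : τ / (θ * n) ≤ 1 / (4 * n) := by
      rw [div_le_div_iff₀ (by positivity) (by positivity)]
      nlinarith
    have hq1 : 1 / (4 * (n : ℝ)) ≤ 1 / 4 := by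
      refine one_div_le_one_div_of_le (by norm_num) (by linarith)
    have hb : 1 + (l : ℝ) * (-(1 / (4 * n))) ≤ (1 + -(1 / (4 * (n : ℝ)))) ^ l :=
      one_add_mul_le_pow (by linarith) l
    have hc : (1 + -(1 / (4 * (n : ℝ)))) ^ l ≤ (∑' t, w t) ^ l := by
      refine pow_le_pow_left₀ (by linarith) ?_ l
      linarith
    have hd : (l : ℝ) * (1 / (4 * n)) ≤ 1 / 4 := by
      rw [mul_one_div, div_le_div_iff₀ (by positivity) (by norm_num)]
      linarith
    linarith
  have h5 := le_convPow hw0 hwK l n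
  have hk0 : 0 ≤ k := by positivity
  calc r * (θ ^ A / C) / 2 * (n * K n) = (r * n) * (k * (1 / 2)) := by rw [hk]; ring
    _ ≤ ((l : ℝ) + 1) * (k * ∑' m, s.indicator (convPow w l) m) := by
        gcongr
        linarith
    _ ≤ ((l : ℝ) + 1) * ∑ p ∈ Finset.HasAntidiagonal.antidiagonal n,
          (K p.1 - w p.1) * convPow w l p.2 := by gcongr
    _ ≤ _ := h5

include hK hreg hμ in
/-- A macroscopic step whose size is not the excess of the sum is unlikely. -/
theorem IsStepLaw.eventually_wrong_jump_le (hw : WeakLaw K μ) {κ r ε δ ε' : ℝ} (hκ : 0 < κ)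
    (hr : 0 < r) (hε : 0 < ε) (hδ : 0 < δ) (hε' : 0 < ε') :
    ∀ᶠ n : ℕ in atTop, ∀ l : ℕ, r * n ≤ l + 1 → ((l : ℝ) + 1) * μ ≤ (1 - κ) * n →
      ((l : ℝ) + 1) * ∑ p ∈ Finset.HasAntidiagonal.antidiagonal n,
        {t : ℕ | δ * n ≤ t ∧ ε * n < |(t : ℝ) - (n - (l + 1) * μ)|}.indicator K p.1 *
          convPow K l p.2 ≤ ε' * (n * K n) := by
  have hC := hreg.1
  obtain ⟨e, he, hle⟩ := hw (ε / 2) (by positivity)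
  filter_upwards [eventually_forall_le_of_tendsto he hr
      (show (0 : ℝ) < ε' / (C * (1 / δ) ^ A) by positivity), eventually_ge_atTop 1,
    tendsto_natCast_atTop_atTop.eventually_ge_atTop (2 * μ / ε)] with n hn hn1 hnμ l hl hlμ
  obtain ⟨hl1, hel⟩ := hn l hl
  have hn0 : (0 : ℝ) < n := by exact_mod_cast hn1
  have hln := hK.le_of_mul_mean_le hμ hκ.le hlμ
  have hKn := hK.nonneg n
  have hμ1 := hK.one_le_mean hμ
  rw [div_le_iff₀ hε] at hnμ
  set G := {t : ℕ | δ * n ≤ t ∧ ε * n < |(t : ℝ) - (n - (l + 1) * μ)|} with hG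
  set k := C * (1 / δ) ^ A * K n with hk
  have hk0 : 0 ≤ k := by positivity
  have h1 := sum_antidiagonal_le (f := G.indicator K) (g := convPow K l) (k := k) (n := n)
    (s := {m : ℕ | ε / 2 * l ≤ |(m : ℝ) - l * μ|}) hk0 (fun m => convPow_nonneg hK.nonneg l m)
    (hasSum_convPow hK.nonneg hK.hasSum.summable l).summable fun t m htm => by
      by_cases ht : t ∈ G
      · have htm' : (t : ℝ) + m = n := by exact_mod_cast htm
        obtain ⟨h2, h3⟩ := ht
        have ht1 : 1 ≤ t := by
          have : (0 : ℝ) < t := lt_of_lt_of_le (by positivity) h2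
          exact_mod_cast this
        -- Since `t + m = n`, a wrong size of the step forces the other `l` steps off their mean by
        -- more than `ε n - μ`, and `n ≥ 2 μ / ε`.
        have hm : m ∈ {m : ℕ | ε / 2 * l ≤ |(m : ℝ) - l * μ|} := by
          have e1 : (t : ℝ) - (n - (l + 1) * μ) = -((m : ℝ) - l * μ) + μ := by
            rw [← htm']; ring
          rw [e1] at h3
          have h4 := h3.trans_le (abs_add_le _ _)
          rw [abs_neg, abs_of_nonneg (by linarith : (0 : ℝ) ≤ μ)] at h4
          have h5 : ε / 2 * l ≤ ε / 2 * n := by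
            refine mul_le_mul_of_nonneg_left ?_ (by positivity)
            linarith
          show ε / 2 * l ≤ |(m : ℝ) - l * μ|
          linarith
        rw [indicator_of_mem hm, indicator_of_mem (show t ∈ G from ⟨h2, h3⟩)]
        exact (PolynomiallyRegular.le_of_mul_le hK hreg hδ ht1 (by omega) h2).1
      · rw [indicator_of_notMem ht]
        exact indicator_apply_nonneg fun _ => hk0
  have h2 := (hle l {m : ℕ | ε / 2 * l ≤ |(m : ℝ) - l * μ|} hl1 fun m hm => hm).trans hel
  calc ((l : ℝ) + 1) * ∑ p ∈ Finset.HasAntidiagonal.antidiagonal n,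
        G.indicator K p.1 * convPow K l p.2
      ≤ n * (k * (ε' / (C * (1 / δ) ^ A))) := by
        refine mul_le_mul hln (h1.trans (mul_le_mul_of_nonneg_left h2 hk0)) ?_ hn0.le
        exact Finset.sum_nonneg fun p _ => mul_nonneg
          (indicator_nonneg (fun t _ => hK.nonneg t) _) (convPow_nonneg hK.nonneg l _)
    _ = ε' * (n * K n) := by rw [hk]; field_simp

include hK hreg hμ in
/-- Without macroscopic steps an atypically large sum is unlikely, by a dyadic decomposition
according to the size of the largest step. -/
theorem IsStepLaw.exists_small_jumps_le {κ ε' : ℝ} (hκ : 0 < κ) (hε' : 0 < ε') :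
    ∃ δ, 0 < δ ∧ ∀ᶠ n : ℕ in atTop, ∀ l : ℕ, ((l : ℝ) + 1) * μ ≤ (1 - κ) * n →
      convPow ((Iio ⌈δ * (n : ℝ)⌉₊).indicator K) (l + 1) n ≤ ε' * (n * K n) := by
  have hC := hreg.1
  have hμ1 := hK.one_le_mean hμ
  have htail := (tendsto_tailMean hK.nonneg hμ).comp
    (tendsto_natCast_atTop_atTop.const_mul_atTop (show (0 : ℝ) < κ / 4 by positivity) :
      Tendsto (fun b : ℕ => κ / 4 * b) atTop atTop)
  -- Beyond `b₀` the tail costs at most `κ μ / 4`, so truncated steps behave in the Chernoff bound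
  -- as if their mean were `(1 + κ / 2) μ`; and `(1 + κ / 2) (1 - κ) ≤ 1 - κ / 2`.
  obtain ⟨b₀, hb₀⟩ := eventually_atTop.1 ((htail.eventually_le_const
    (show (0 : ℝ) < κ / 4 * μ by positivity)).and (eventually_ge_atTop 1))
  have hb01 : 1 ≤ b₀ := (hb₀ b₀ le_rfl).2
  have hb0r : (0 : ℝ) < b₀ := by exact_mod_cast hb01
  have hw0 : ∀ b t, 0 ≤ (Iio b).indicator K t := fun b t =>
    indicator_nonneg (fun t _ => hK.nonneg t) t
  have hchern : ∀ b, b₀ ≤ b → ∀ (n l N : ℕ) (y : ℝ), ((l : ℝ) + 1) * μ ≤ (1 - κ) * n →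
      (N : ℝ) ≤ l + 1 → sumMass ((Iio b).indicator K) N {m : ℕ | y ≤ m} ≤
        Real.exp (((1 - κ / 2) * n - y) / b) := by
    intro b hb n l N y hlμ hN
    have hb1 : 0 < b := by omega
    have hbr : (0 : ℝ) < b := by exact_mod_cast hb1
    have htb : tailMean K (κ / 4 * b) ≤ κ / 4 * μ := (hb₀ b hb).1
    have h1 : ∑' t, (Iio b).indicator K t * Real.exp (1 / b) ^ t ≤ 1 + (1 + κ / 2) * μ / b := by
      refine (tsum_Iio_mul_exp_le hK.nonneg hK.hasSum hμ hb1
        (show (0 : ℝ) ≤ κ / 4 by positivity)).trans ?_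
      gcongr
      linarith
    refine (sumMass_Iio_le hK.nonneg h1 N).trans (Real.exp_le_exp.2 ?_)
    refine div_le_div_of_nonneg_right ?_ hbr.le
    have h2 : (N : ℝ) * ((1 + κ / 2) * μ) ≤ ((l : ℝ) + 1) * ((1 + κ / 2) * μ) := by gcongr
    have h3 : (1 + κ / 2) * (((l : ℝ) + 1) * μ) ≤ (1 + κ / 2) * ((1 - κ) * n) := by gcongr
    have h4 : (0 : ℝ) ≤ κ ^ 2 * n := by positivity
    nlinarith
  set C₃ := Real.exp 1 * ((A + 1).factorial / (κ / 4) ^ (A + 1)) with hC3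
  have hC30 : 0 < C₃ := by positivity
  -- Doubling the cut-off admits a step in `[b, 2b)`, of probability at most `C (n / b)^A K(n)`. The
  -- others must still reach `n - 2 b`, at Chernoff cost `e^(1 - κ n / (4 b))`, which absorbs `(n /
  -- b)^(A + 1)` and leaves a term linear in `b`.
  have hstep : ∀ b, b₀ ≤ b → ∀ n l : ℕ, b ≤ n → ((l : ℝ) + 1) * μ ≤ (1 - κ) * n →
      convPow ((Iio (2 * b)).indicator K) (l + 1) n ≤
        convPow ((Iio b).indicator K) (l + 1) n + C * C₃ * K n * b := by
    intro b hb n l hbn hlμ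
    have hb1 : 0 < b := by omega
    have hbr : (0 : ℝ) < b := by exact_mod_cast hb1
    have hnr : (0 : ℝ) < n := by exact_mod_cast hb1.trans_le hbn
    have hKn := hK.nonneg n
    have hln := hK.le_of_mul_mean_le hμ hκ.le hlμ
    have hmono : ∀ t, (Iio b).indicator K t ≤ (Iio (2 * b)).indicator K t := fun t =>
      indicator_le_indicator_of_subset (Iio_subset_Iio (by omega)) (fun t => hK.nonneg t) t
    have h1 := convPow_sub_le (hw0 b) hmono l n
    set k := C * ((n : ℝ) / b) ^ A * K n with hk
    have hk0 : 0 ≤ k := by positivity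
    have h2 := sum_antidiagonal_le (n := n) (k := k)
      (f := fun t => (Iio (2 * b)).indicator K t - (Iio b).indicator K t)
      (g := convPow ((Iio (2 * b)).indicator K) l) (s := {m : ℕ | (n : ℝ) - 2 * b ≤ m}) hk0
      (fun m => convPow_nonneg (hw0 (2 * b)) l m) (summable_convPow_indicator hK _ l)
      fun t m htm => by
        have hz : 0 ≤ {m : ℕ | (n : ℝ) - 2 * b ≤ m}.indicator (fun _ => k) m :=
          indicator_apply_nonneg fun _ => hk0
        rcases lt_or_ge t b with ht | ht
        · rw [indicator_of_mem (show t ∈ Iio (2 * b) from by rw [mem_Iio]; omega),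
            indicator_of_mem (show t ∈ Iio b from ht), sub_self]
          exact hz
        · have ht' : t ∉ Iio b := not_lt.2 ht
          rw [indicator_of_notMem ht', sub_zero]
          rcases lt_or_ge t (2 * b) with ht2 | ht2
          · have hm : m ∈ {m : ℕ | (n : ℝ) - 2 * b ≤ m} := by
              have e1 : (t : ℝ) + m = n := by exact_mod_cast htm
              have e2 : (t : ℝ) ≤ 2 * b := by exact_mod_cast ht2.le
              show (n : ℝ) - 2 * b ≤ m
              linarith
            rw [indicator_of_mem (show t ∈ Iio (2 * b) from ht2), indicator_of_mem hm]
            refine (hreg.2 t n (by omega) (by omega)).1.trans ?_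
            have : (b : ℝ) ≤ t := by exact_mod_cast ht
            rw [hk]
            gcongr
          · have ht2' : t ∉ Iio (2 * b) := not_lt.2 ht2
            rw [indicator_of_notMem ht2']
            exact hz
    have h3 := hchern (2 * b) (by omega) n l l (n - 2 * b) hlμ (by linarith)
    have e1 : ((1 - κ / 2) * n - (n - 2 * b)) / ((2 * b : ℕ) : ℝ) =
        1 + -(κ / 4 * ((n : ℝ) / b)) := by push_cast; field_simp; ring
    rw [e1, Real.exp_add] at h3
    have h4 := pow_mul_exp_neg_le (A + 1) (show (0 : ℝ) < κ / 4 by positivity)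
      (show (0 : ℝ) ≤ (n : ℝ) / b by positivity)
    have h5 : ((l : ℝ) + 1) * ∑ p ∈ Finset.HasAntidiagonal.antidiagonal n,
        ((Iio (2 * b)).indicator K p.1 - (Iio b).indicator K p.1) *
          convPow ((Iio (2 * b)).indicator K) l p.2 ≤ C * C₃ * K n * b := by
      calc _ ≤ (n : ℝ) * (k * (Real.exp 1 * Real.exp (-(κ / 4 * ((n : ℝ) / b))))) := by
            refine mul_le_mul hln (h2.trans (mul_le_mul_of_nonneg_left h3 hk0)) ?_ hnr.le
            exact Finset.sum_nonneg fun p _ => mul_nonneg (sub_nonneg.2 (hmono _))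
              (convPow_nonneg (hw0 (2 * b)) l _)
        _ = C * K n * b * Real.exp 1 *
              (((n : ℝ) / b) ^ (A + 1) * Real.exp (-(κ / 4 * ((n : ℝ) / b)))) := by
            rw [hk, pow_succ]; field_simp
        _ ≤ C * K n * b * Real.exp 1 * ((A + 1).factorial / (κ / 4) ^ (A + 1)) := by gcongr
        _ = _ := by rw [hC3]; ring
    linarith
  -- The linear errors form a geometric sum dominated by the final cut-off, which will be at most `2
  -- δ n`; this dictates `δ`.
  have hiter : ∀ J n l : ℕ, b₀ * 2 ^ J ≤ 2 * n → ((l : ℝ) + 1) * μ ≤ (1 - κ) * n →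
      convPow ((Iio (b₀ * 2 ^ J)).indicator K) (l + 1) n ≤
        convPow ((Iio b₀).indicator K) (l + 1) n + C * C₃ * K n * (b₀ * 2 ^ J : ℕ) := by
    intro J n l
    induction J with
    | zero =>
      intro _ _
      have := hK.nonneg n
      rw [pow_zero, mul_one]
      exact le_add_of_nonneg_right (by positivity)
    | succ J ih =>
      intro hJ hlμ
      have e1 : b₀ * 2 ^ (J + 1) = 2 * (b₀ * 2 ^ J) := by ring
      rw [e1] at hJ ⊢
      have h1 := ih (by omega) hlμ
      have h2 := hstep (b₀ * 2 ^ J) (Nat.le_mul_of_pos_right _ (by positivity)) n l (by omega) hlμ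
      push_cast at h1 h2 ⊢
      linarith
  refine ⟨min 1 (ε' / (4 * (C * C₃))), by positivity, ?_⟩
  set δ := min 1 (ε' / (4 * (C * C₃))) with hδ
  have hδ0 : 0 < δ := by positivity
  have hδ1 : δ ≤ 1 := min_le_left _ _
  have hδ2 : C * C₃ * (2 * δ) ≤ ε' / 2 := by
    have : δ ≤ ε' / (4 * (C * C₃)) := min_le_right _ _
    rw [le_div_iff₀ (by positivity)] at this
    linarith
  set k := κ / 2 / b₀ with hk
  have hk0 : 0 < k := by positivity
  have hK1 := hK.pos 1 le_rfl
  have hdecay : ∀ᶠ n : ℕ in atTop, (n : ℝ) ^ A ≤ ε' / 2 * (K 1 / C) * Real.exp (k * n) := by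
    have := (isLittleO_pow_exp_pos_mul_atTop (k := A) hk0).bound
      (show 0 < ε' / 2 * (K 1 / C) by positivity)
    filter_upwards [tendsto_natCast_atTop_atTop.eventually this] with n hn
    rwa [Real.norm_of_nonneg (by positivity), Real.norm_of_nonneg (by positivity)] at hn
  filter_upwards [hdecay, eventually_ge_atTop 1,
    tendsto_natCast_atTop_atTop.eventually_ge_atTop ((b₀ : ℝ) / δ)] with n hn hn1 hnb l hlμ
  have hnr : (0 : ℝ) < n := by exact_mod_cast hn1
  have hn1' : (1 : ℝ) ≤ n := by exact_mod_cast hn1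
  have hKn := hK.nonneg n
  rw [div_le_iff₀ hδ0] at hnb
  obtain ⟨J, hJ1, hJ2⟩ := exists_nat_pow_near (x := δ * n / b₀) (y := 2)
    ((one_le_div hb0r).2 (by linarith)) one_lt_two
  rw [le_div_iff₀ hb0r] at hJ1
  rw [div_lt_iff₀ hb0r] at hJ2
  have hJ3 : ((b₀ * 2 ^ (J + 1) : ℕ) : ℝ) ≤ 2 * δ * n := by
    push_cast; rw [pow_succ]; linarith
  have hJ4 : b₀ * 2 ^ (J + 1) ≤ 2 * n := by
    have : ((b₀ * 2 ^ (J + 1) : ℕ) : ℝ) ≤ ((2 * n : ℕ) : ℝ) := by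
      refine hJ3.trans ?_
      push_cast
      nlinarith
    exact_mod_cast this
  have hceil : ⌈δ * (n : ℝ)⌉₊ ≤ b₀ * 2 ^ (J + 1) := by
    rw [Nat.ceil_le]; push_cast; linarith
  -- With a fixed cut-off the Chernoff bound is exponentially small in `n`, whereas `K n` decays at
  -- most polynomially.
  have hbase : convPow ((Iio b₀).indicator K) (l + 1) n ≤ ε' / 2 * (n * K n) := by
    have h1 : convPow ((Iio b₀).indicator K) (l + 1) n ≤
        sumMass ((Iio b₀).indicator K) (l + 1) {m : ℕ | (n : ℝ) ≤ m} := by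
      have := ((summable_convPow_indicator hK (Iio b₀) (l + 1)).indicator
        {m : ℕ | (n : ℝ) ≤ m}).le_tsum n fun m _ => indicator_nonneg
          (fun m _ => convPow_nonneg (hw0 b₀) (l + 1) m) m
      have hmem : n ∈ {m : ℕ | (n : ℝ) ≤ m} := by
        show (n : ℝ) ≤ n
        exact le_rfl
      rwa [indicator_of_mem hmem] at this
    have h2 := hchern b₀ le_rfl n l (l + 1) n hlμ (by push_cast; linarith)
    have e1 : ((1 - κ / 2) * n - n) / (b₀ : ℝ) = -(k * n) := by rw [hk]; field_simp; ring
    rw [e1, Real.exp_neg] at h2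
    refine (h1.trans h2).trans ?_
    have h3 := hreg.le_apply hn1
    calc (Real.exp (k * n))⁻¹ ≤ ε' / 2 * (K 1 / C / (n : ℝ) ^ A) := by
          rw [inv_le_iff_one_le_mul₀ (Real.exp_pos _)]
          have : ε' / 2 * (K 1 / C / (n : ℝ) ^ A) * Real.exp (k * n) =
              ε' / 2 * (K 1 / C) * Real.exp (k * n) / (n : ℝ) ^ A := by ring
          rw [this, one_le_div (by positivity)]
          exact hn
      _ ≤ ε' / 2 * K n := by gcongr
      _ ≤ ε' / 2 * (n * K n) := by
          gcongr
          exact le_mul_of_one_le_left hKn hn1'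
  calc convPow ((Iio ⌈δ * (n : ℝ)⌉₊).indicator K) (l + 1) n
      ≤ convPow ((Iio (b₀ * 2 ^ (J + 1))).indicator K) (l + 1) n :=
        convPow_mono (hw0 _) (fun t => indicator_le_indicator_of_subset (Iio_subset_Iio hceil)
          (fun t => hK.nonneg t) t) _ _
    _ ≤ ε' / 2 * (n * K n) + C * C₃ * K n * (2 * δ * n) := by
        refine (hiter (J + 1) n l hJ4 hlμ).trans (add_le_add hbase ?_)
        gcongr
    _ = ε' / 2 * (n * K n) + C * C₃ * (2 * δ) * (n * K n) := by ring
    _ ≤ ε' / 2 * (n * K n) + ε' / 2 * (n * K n) := by gcongr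
    _ = _ := by ring

end BigJump

/-! ### Macroscopic gaps of the conditioned model -/

section PartTwo

variable {Ω : Type*} [MeasurableSpace Ω] {P : Measure Ω} {T : ℕ → Ω → ℕ} {α : ℝ} {ℓ : ℝ → ℝ}
  {C : ℝ} {A : ℕ}

/-- By compactness, `sSup R < ρ_c` gives a uniform relative excess `κ` of `n` over `l / ρ_c`, and
`sInf R > 0` keeps `l` proportional to `n`, as the one-big-jump estimates require. -/
theorem InterArrival.tendsto_maxGap_div (hT : InterArrival P T α ℓ)
    (hreg : PolynomiallyRegular (stepLaw P T) C A) (hc : 0 < criticalDensity P T) (h : ℝ)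
    {R : Set ℝ} {ε : ℝ} (hR : IsClosed R) (hsub : R ⊆ Ioo 0 (criticalDensity P T)) (hε : 0 < ε) :
    Tendsto (fun n : ℕ => ⨆ l ∈ scaledNat n R,
        (ProbabilityTheory.cond (pinningMeasure P T n h 0)
          {s | contactNumber T n s = l})
          {s | ε < |(maxGap T n s : ℝ) / n - (1 - ((l : ℝ) / n) / criticalDensity P T)|})
        atTop (𝓝 0) := by
  set K := stepLaw P T with hKdef
  have hK : IsStepLaw K := hT.isStepLaw
  set ρ := criticalDensity P T with hρ
  have hμ : HasSum (fun t : ℕ => (t : ℝ) * K t) ρ⁻¹ := hT.hasSum_mean hreg hc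
  have hw : WeakLaw K ρ⁻¹ := fun η hη => hT.exists_sumMass_le hμ hη
  rcases R.eq_empty_or_nonempty with rfl | hne
  · simp [scaledNat]
  have hcomp : IsCompact R := Metric.isCompact_of_isClosed_isBounded hR
    ((Metric.isBounded_Ioo _ _).subset hsub)
  have hmin := hsub (hcomp.sInf_mem hne)
  have hmax := hsub (hcomp.sSup_mem hne)
  set κ := 1 - sSup R / ρ with hκ
  have hκ0 : 0 < κ := by
    rw [hκ, sub_pos, div_lt_one hc]; exact hmax.2
  obtain ⟨c, hc0, hlow⟩ := hK.exists_le_convPow hreg hμ hw hκ0 hmin.1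
  rw [ENNReal.tendsto_nhds_zero]
  intro ε₀ hε₀
  rcases eq_or_ne ε₀ ⊤ with rfl | htop
  · exact Eventually.of_forall fun _ => le_top
  -- Each exceptional contribution is allowed half of `ε₀` times the lower bound `c n K(n)`; `δ`
  -- depends on this choice.
  set ε₁ := c * ε₀.toReal / 2 with hε1
  have hε₀' : 0 < ε₀.toReal := ENNReal.toReal_pos hε₀.ne' htop
  have hε10 : 0 < ε₁ := by positivity
  obtain ⟨δ, hδ, hsmall⟩ := hK.exists_small_jumps_le hreg hμ hκ0 hε10
  filter_upwards [hlow, hsmall, hK.eventually_wrong_jump_le hreg hμ hw hκ0 hmin.1 hε hδ hε10,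
    eventually_ge_atTop 1] with n h1 h2 h3 hn1
  refine iSup₂_le fun l hl => ?_
  obtain ⟨hl1, r, hr, hlr⟩ := hl
  obtain ⟨j, rfl⟩ : ∃ j, l = j + 1 := ⟨l - 1, by omega⟩
  have hn0 : (0 : ℝ) < n := by exact_mod_cast hn1
  have hjr : (j : ℝ) + 1 = n * r := by rw [← hlr]; push_cast; ring
  have ha : sInf R * n ≤ j + 1 := by
    rw [hjr, mul_comm]
    exact mul_le_mul_of_nonneg_left (csInf_le hcomp.bddBelow hr) hn0.le
  have hb : ((j : ℝ) + 1) * ρ⁻¹ ≤ (1 - κ) * n := by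
    have h4 : r ≤ sSup R := le_csSup hcomp.bddAbove hr
    rw [hjr, hκ]
    calc n * r * ρ⁻¹ ≤ n * sSup R * ρ⁻¹ := by gcongr
      _ = _ := by ring
  refine (hT.cond_pinningMeasure_le n j h
    (B := {m : ℕ | ε < |(m : ℝ) / n - (1 - (((j + 1 : ℕ) : ℝ) / n) / ρ)|})
    (b := ⌈δ * (n : ℝ)⌉₊)
    (G := {t : ℕ | δ * n ≤ t ∧ ε * n < |(t : ℝ) - (n - (j + 1) * ρ⁻¹)|}) fun m hm => ?_).trans ?_
  · have hm' : ε < |(m : ℝ) / n - (1 - (((j + 1 : ℕ) : ℝ) / n) / ρ)| := hm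
    rcases lt_or_ge (m : ℝ) (δ * n) with h4 | h4
    · exact Or.inl (Nat.lt_ceil.2 h4)
    · refine Or.inr ⟨h4, ?_⟩
      have e1 : (m : ℝ) - (n - (j + 1) * ρ⁻¹) =
          ((m : ℝ) / n - (1 - (((j + 1 : ℕ) : ℝ) / n) / ρ)) * n := by
        push_cast; field_simp
      rw [e1, abs_mul, abs_of_pos hn0]
      exact mul_lt_mul_of_pos_right hm' hn0
  · rw [← ENNReal.ofReal_toReal htop]
    refine ENNReal.ofReal_le_ofReal ?_
    have hKn : 0 < n * K n := mul_pos hn0 (hK.pos n hn1)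
    have h5 := h1 j ha hb
    have h6 : 0 < convPow K (j + 1) n := lt_of_lt_of_le (by positivity) h5
    rw [div_le_iff₀ h6]
    refine (add_le_add (h2 j hb) (h3 j ha hb)).trans ?_
    calc ε₁ * (n * K n) + ε₁ * (n * K n) = ε₀.toReal * (c * (n * K n)) := by rw [hε1]; ring
      _ ≤ _ := by gcongr

end PartTwo

end Pinning

theorem proposition1p2 {Ω : Type*} [MeasurableSpace Ω] (P : Measure Ω) (T : ℕ → Ω → ℕ)
    (α : ℝ) (ℓ : ℝ → ℝ) (hT : Pinning.InterArrival P T α ℓ) :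
    Pinning.WellDefined P T ∧
    (∀ (h : ℝ) (R : Set ℝ) (ε : ℝ), IsClosed R → R ⊆ Ioo (Pinning.criticalDensity P T) 1 →
      0 < ε →
      Tendsto (fun n : ℕ => ⨆ l ∈ Pinning.scaledNat n R,
        (ProbabilityTheory.cond (Pinning.pinningMeasure P T n h 0)
          {s | Pinning.contactNumber T n s = l})
          {s | ε < |(Pinning.maxGap T n s : ℝ) / Real.log n
            - 1 / Pinning.freeEnergy P T (Pinning.inverseDensity P T ((l : ℝ) / n))|})
        atTop (𝓝 0)) ∧
    (0 < Pinning.criticalDensity P T →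
      ∀ (h : ℝ) (R : Set ℝ) (ε : ℝ), IsClosed R → R ⊆ Ioo 0 (Pinning.criticalDensity P T) →
      0 < ε →
      Tendsto (fun n : ℕ => ⨆ l ∈ Pinning.scaledNat n R,
        (ProbabilityTheory.cond (Pinning.pinningMeasure P T n h 0)
          {s | Pinning.contactNumber T n s = l})
          {s | ε < |(Pinning.maxGap T n s : ℝ) / n
            - (1 - ((l : ℝ) / n) / Pinning.criticalDensity P T)|})
        atTop (𝓝 0)) := by
  obtain ⟨C, A, hreg⟩ := hT.exists_polynomiallyRegular
  exact ⟨hT.wellDefined hreg,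
    fun h R ε hR hsub hε => hT.tendsto_maxGap_div_log hreg h hR hsub hε,
    fun hc h R ε hR hsub hε => hT.tendsto_maxGap_div hreg hc h hR hsub hε⟩
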